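/- **Setting.** All vectors carry the maximum norm $\|\cdot\|_\infty$, and $\|H\|_{\mathcal L_1}=\max_i\sum_j\|h_{ij}\|_{\mathcal L_1}$ is the $\mathcal L_1$ norm of a proper stable transfer matrix with impulse response $(h_{ij})$ (a direct term $d\,\delta$ contributes $|d|$). Let $(A_m,B_m,C_m)$ be a minimal single-input single-output system with state dimension $N\ge 1$, $A_m$ Hurwitz and $-C_mA_m^{-1}B_m=1$. Let $K\in\mathbb R^{1\times N}$, $A_z=A_m+B_mK$ (so $A_m=A_z-B_mK$; for $K=0$ the plant below is the system $\dot x=A_mx+B_m(z_{\rm aug}+\sigma_z)$), $H_0(s)=(sI-A_m)^{-1}B_m$, $M_z(s)=C_mH_0(s)$, $C_m^\dagger=C_m^\top(C_mC_m^\top)^{-1}$. Let $C(s)$ be a strictly proper stable real rational function with $C(0)=1$, and put $G(s)=H_0(s)(1-C(s))$, $H_1(s)=H_0(s)C(s)M_z^{-1}(s)$, $H_{\rm in}(s)=C_m(sI-A_m)^{-1}(I-C_m^\dagger C_m)$. *Plant.* $\dot x_z=A_zx_z+B_m\bigl(z_{\rm aug}+\sigma_z(x_z,t)\bigr)$, $z=C_mx_z$,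 $x_z(0)=x_0$. Here $\sigma_z$ is measurable in $t$, $|\sigma_z(0,t)|\le L_0$, and for every $\delta>0$, $|\sigma_z(x_2,t)-\sigma_z(x_1,t)|\le F_\delta\|x_2-x_1\|_\infty$ whenever $\|x_1\|_\infty,\|x_2\|_\infty\le\delta$ and $t\ge0$. The command $z_{\rm cmd}$ is measurable with $|z_{\rm cmd}(t)|\le M_r$ for all $t\ge0$. Solutions are in the sense of Carathéodory. *Controller with sampling time $T_s>0$.* Write $z[i]=z(iT_s)$ and $z_{\rm cmd}[i]=z_{\rm cmd}(iT_s)$. The predictor is $\hat x[0]=C_m^\dagger z(0)$, $\hat x[i+1]=e^{A_mT_s}\hat x[i]+A_m^{-1}(e^{A_mT_s}-I)(B_mz_{\rm aug}[i]+\hat\sigma[i])$, $\hat z[i]=C_m\hat x[i]$. The adaptation law is $\hat\sigma[i]=-\Phi^{-1}(T_s)e^{\Lambda A_m\Lambda^{-1}T_s}e_1(\hat z[i]-z[i])$, with $\Phi(T_s)=\int_0^{T_s}e^{\Lambda A_m\Lambda^{-1}(T_s-\tau)}\Lambda\,d\tau$ and $\Lambda=\begin{bmatrix}C_m\\ D\sqrt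 P\end{bmatrix}$ invertible, where $P=\sqrt P^\top\sqrt P$ is positive definite with $A_m^\top P+PA_m=-Q$ for a positive definite $Q$, and $D\in\mathbb R^{(N-1)\times N}$ satisfies $D(C_m(\sqrt P)^{-1})^\top=0$. The control law is $x_u[0]=0$, $x_u[i+1]=e^{A_oT_s}x_u[i]+A_o^{-1}(e^{A_oT_s}-I)B_oe^{-A_mT_s}\hat\sigma[i]$, $z_{\rm aug}(t)=z_{\rm cmd}[i]-C_ox_u[i]$ for $t\in[iT_s,(i+1)T_s)$, with $(A_o,B_o,C_o)$ a minimal realization of $C(s)M_z^{-1}(s)C_m(sI-A_m)^{-1}$. *Reference system.* $\dot x_{\rm ref}=A_zx_{\rm ref}+B_m\bigl(u_{\rm ref}+\sigma_z(x_{\rm ref},t)\bigr)$, $x_{\rm ref}(0)=x_0$, $u_{\rm ref}(s)=z_{\rm cmd}(s)-C(s)\bigl(\omega_{\rm ref}(s)+M_z^{-1}(s)H_{\rm in}(s)x_0\bigr)$, where $\omega_{\rm ref}(s)$ is the Laplace transform of $Kx_{\rm ref}(t)+\sigma_z(x_{\rm ref}(t),t)$. **Theorem.** Assume that $C(s)M_z^{-1}(s)$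 is proper and that, for given $\rho_0$ and $\bar\gamma_0>0$, there is $\rho_r>0$ such that the $\mathcal L_1$ norms below exist and $$\|G\|_{\mathcal L_1}\,(L_{\rho_r}\rho_r+L_0)<\rho_r-\rho_1-\rho_2,$$ where $\rho_1=\|s(sI-A_m)^{-1}-sH_1(s)H_{\rm in}(s)\|_{\mathcal L_1}\rho_0$, $\rho_2=\|H_0\|_{\mathcal L_1}M_r$, $L_{\rho_r}=\frac{\bar\gamma_0+\rho_r}{\rho_r}\bigl(F_{\bar\gamma_0+\rho_r}+\|K\|_\infty\bigr)$ and $\|K\|_\infty=\sum_j|K_j|$. Then there are $\bar T>0$, functions $\alpha_x,\alpha_u$ of $T_s$ with $\lim_{T_s\to0^+}\alpha_x=\lim_{T_s\to0^+}\alpha_u=0$, and constants $\kappa_x,\kappa_u$, all independent of $\sigma_z$, $z_{\rm cmd}$ and $x_0$ (they depend only on the design data and on $F,L_0,M_r,\rho_0,\rho_r,\bar\gamma_0$), such that the following holds for every $\sigma_z$ and $z_{\rm cmd}$ as above, every $x_0$ with $\|x_0\|_\infty\le\rho_0$ and every $T_s\in(0,\bar T]$. If $\nu$ bounds the inter-sample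 variation of the command, $|z_{\rm cmd}(t)-z_{\rm cmd}(\lfloor t/T_s\rfloor T_s)|\le\nu$ for all $t\ge0$, then on every interval $[0,\tau]$ on which trajectories of both systems are given, $$\|x_{\rm ref}(t)-x_z(t)\|_\infty\le\gamma_x:=\alpha_x(T_s)+\kappa_x\nu,\qquad |u_{\rm ref}(t)-z_{\rm aug}(t)|\le\gamma_u:=\alpha_u(T_s)+\kappa_u\nu .$$ In particular $\gamma_x,\gamma_u\to0$ as $T_s\to0$ whenever $\nu=\nu(T_s)\to0$, e.g. with $\nu=0$ when the command is constant between sampling instants, or for every uniformly continuous command. -/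

import Mathlib

open Matrix Filter Topology MeasureTheory

namespace L1Aug

noncomputable section

/-! ### Rational transfer functions and state-space systems -/

section Systems

variable {k : ℕ} {ι κ p m : Type} [Fintype ι] [DecidableEq ι] [Fintype p] [Fintype m]

/-- A real matrix, seen as a constant transfer matrix. The Laplace variable `s` is `RatFunc.X`. -/
def const (M : Matrix p m ℝ) : Matrix p m (RatFunc ℝ) := M.map RatFunc.C

/-- The resolvent `(sI - A)⁻¹`. -/
def resolvent (A : Matrix ι ι ℝ) : Matrix ι ι (RatFunc ℝ) :=
  ((RatFunc.X : RatFunc ℝ) • (1 : Matrix ι ι (RatFunc ℝ)) - const A)⁻¹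

/-- All (complex) eigenvalues have negative real part. -/
def IsHurwitz (A : Matrix ι ι ℝ) : Prop :=
  ∀ μ ∈ spectrum ℂ (A.map (algebraMap ℝ ℂ)), μ.re < 0

/-- Controllability: the columns of `B, AB, A²B, …` span the state space. -/
def IsControllable (A : Matrix ι ι ℝ) (B : Matrix ι m ℝ) : Prop :=
  Submodule.span ℝ (Set.range fun q : ℕ × m => (A ^ q.1 * B).col q.2) = ⊤

/-- Observability, as controllability of the dual pair. -/
def IsObservable (A : Matrix ι ι ℝ) (C : Matrix p ι ℝ) : Prop :=
  IsControllable Aᵀ Cᵀ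

/-- The system `x' = A x + B v`, `y = C x + D v` with `k` states. -/
structure StateSpace (k : ℕ) (p m : Type) where
  A : Matrix (Fin k) (Fin k) ℝ
  B : Matrix (Fin k) m ℝ
  C : Matrix p (Fin k) ℝ
  D : Matrix p m ℝ

/-- The transfer matrix `C (sI - A)⁻¹ B + D`. -/
def StateSpace.transfer (S : StateSpace k p m) : Matrix p m (RatFunc ℝ) :=
  const S.C * resolvent S.A * const S.B + const S.D

def StateSpace.IsMinimal (S : StateSpace k p m) : Prop :=
  IsControllable S.A S.B ∧ IsObservable S.A S.C

/-- The inverse Laplace transform of the proper rational matrix `G` is `D δ + g`, that is, `G` is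
the transfer matrix of the input-output map `y t = D v t + ∫ s in 0..t, g (t - s) v s`. -/
def IsImpulseResponse (G : Matrix p m (RatFunc ℝ)) (D : Matrix p m ℝ) (g : ℝ → Matrix p m ℝ) :
    Prop :=
  ∃ (k : ℕ) (S : StateSpace k p m), S.transfer = G ∧ S.D = D ∧
    ∀ t, g t = S.C * NormedSpace.exp (t • S.A) * S.B

/-- `G` is a proper stable transfer matrix (its impulse response is integrable up to the direct
term) and `c` is its `ℒ₁` norm `max_i ∑_j ‖g_ij‖_{ℒ₁}`, the gain from `L∞` to `L∞` for the
maximum norms. -/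
def HasL1Norm (G : Matrix p m (RatFunc ℝ)) (c : ℝ) : Prop :=
  ∃ (D : Matrix p m ℝ) (g : ℝ → Matrix p m ℝ), IsImpulseResponse G D g ∧
    (∀ i j, IntegrableOn (fun t => g t i j) (Set.Ioi 0)) ∧
    c = ⨆ i, ∑ j, (|D i j| + ∫ t in Set.Ioi (0 : ℝ), |g t i j|)

end Systems

/-- `f` is proper. -/
def IsProper (f : RatFunc ℝ) : Prop := f.num.degree ≤ f.denom.degree

/-- `f` is strictly proper. -/
def IsStrictlyProper (f : RatFunc ℝ) : Prop := f.num.degree < f.denom.degree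

/-- All (complex) poles of `f` have negative real part. -/
def IsStable (f : RatFunc ℝ) : Prop := ∀ s : ℂ, Polynomial.aeval s f.denom = 0 → s.re < 0

/-! ### The design data -/

/-- The data chosen by the designer, for a desired system with `n + 1` states:
the desired system `(Am, Bm, Cm)`, the gain `K`, the filter `C(s)`, the matrices `P = √Pᵀ √P`, `Q`
and `D` of the adaptation law, and the state-space system `(Ao, Bo, Co)` of the control law. -/
structure Design (n k : ℕ) where
  Am : Matrix (Fin (n + 1)) (Fin (n + 1)) ℝ
  Bm : Fin (n + 1) → ℝ
  Cm : Fin (n + 1) → ℝ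
  K : Fin (n + 1) → ℝ
  filt : RatFunc ℝ
  P : Matrix (Fin (n + 1)) (Fin (n + 1)) ℝ
  Q : Matrix (Fin (n + 1)) (Fin (n + 1)) ℝ
  sqrtP : Matrix (Fin (n + 1)) (Fin (n + 1)) ℝ
  D : Matrix (Fin n) (Fin (n + 1)) ℝ
  ctl : StateSpace k (Fin 1) (Fin (n + 1))

namespace Design

variable {n k : ℕ} (d : Design n k)

/-- The matrix `Az`, for which `Am = Az - Bm K`. -/
def Az : Matrix (Fin (n + 1)) (Fin (n + 1)) ℝ := d.Am + vecMulVec d.Bm d.K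

/-- The Moore-Penrose inverse `Cm† = Cmᵀ (Cm Cmᵀ)⁻¹` of the row `Cm`. -/
def CmDag : Fin (n + 1) → ℝ := (d.Cm ⬝ᵥ d.Cm)⁻¹ • d.Cm

/-- `H₀(s) = (sI - Am)⁻¹ Bm`. -/
def H0 : Fin (n + 1) → RatFunc ℝ := resolvent d.Am *ᵥ fun i => RatFunc.C (d.Bm i)

/-- The row `Cm (sI - Am)⁻¹`. -/
def CmRes : Fin (n + 1) → RatFunc ℝ := (fun i => RatFunc.C (d.Cm i)) ᵥ* resolvent d.Am

/-- `M(s) = Cm (sI - Am)⁻¹ Bm`. -/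
def M : RatFunc ℝ := (fun i => RatFunc.C (d.Cm i)) ⬝ᵥ d.H0

/-- `G(s) = H₀(s) (1 - C(s))`. -/
def G : Fin (n + 1) → RatFunc ℝ := (1 - d.filt) • d.H0

/-- `H₁(s) = H₀(s) C(s) M(s)⁻¹`. -/
def H1 : Fin (n + 1) → RatFunc ℝ := (d.filt * d.M⁻¹) • d.H0

/-- The row `H_in(s) = Cm (sI - Am)⁻¹ (I - Cm† Cm)`. -/
def Hin : Fin (n + 1) → RatFunc ℝ := d.CmRes ᵥ* const (1 - vecMulVec d.CmDag d.Cm)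

/-- `s (sI - Am)⁻¹ - s H₁(s) H_in(s)`. -/
def Tin : Matrix (Fin (n + 1)) (Fin (n + 1)) (RatFunc ℝ) :=
  (RatFunc.X : RatFunc ℝ) • resolvent d.Am - (RatFunc.X : RatFunc ℝ) • vecMulVec d.H1 d.Hin

/-- The row `O(s) = C(s) M(s)⁻¹ Cm (sI - Am)⁻¹`. -/
def O : Fin (n + 1) → RatFunc ℝ := (d.filt * d.M⁻¹) • d.CmRes

/-- `Λ`, with first row `Cm` and the rows of `D √P` below it. -/
def Lam : Matrix (Fin (n + 1)) (Fin (n + 1)) ℝ := Matrix.of (Matrix.vecCons d.Cm (d.D * d.sqrtP))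

/-- The requirements on the design data. -/
structure Valid : Prop where
  hurwitz : IsHurwitz d.Am
  controllable : IsControllable d.Am (replicateCol (Fin 1) d.Bm)
  observable : IsObservable d.Am (replicateRow (Fin 1) d.Cm)
  dcgain : -(d.Cm ⬝ᵥ (d.Am⁻¹ *ᵥ d.Bm)) = 1
  filt_strictlyProper : IsStrictlyProper d.filt
  filt_stable : IsStable d.filt
  filt_dcgain : d.filt.eval (RingHom.id ℝ) 0 = 1
  /-- `C(s) M(s)⁻¹` is proper. -/
  proper : IsProper (d.filt * d.M⁻¹)
  posDef_P : d.P.PosDef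
  posDef_Q : d.Q.PosDef
  lyapunov : d.Amᵀ * d.P + d.P * d.Am = -d.Q
  sqrt : d.sqrtPᵀ * d.sqrtP = d.P
  /-- `D (Cm (√P)⁻¹)ᵀ = 0`. -/
  orthogonal : d.D *ᵥ (d.Cm ᵥ* d.sqrtP⁻¹) = 0
  lam_invertible : IsUnit d.Lam.det
  /-- `(Ao, Bo, Co)` is a minimal realization of `O(s)`. -/
  ctl_transfer : d.ctl.transfer = replicateRow (Fin 1) d.O
  ctl_direct : d.ctl.D = 0
  ctl_minimal : d.ctl.IsMinimal

/-- The `ℒ₁`-norm condition `‖G‖ < (ρr - ρ₁ - ρ₂) / (L ρr + L₀)`, multiplied out so that it also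
covers a zero denominator, with `ρ₁ = ‖s (sI - Am)⁻¹ - s H₁ H_in‖ ρ₀`, `ρ₂ = ‖H₀‖ Mr` and
`L = (γ₀ + ρr) / ρr * (F (γ₀ + ρr) + ‖K‖_∞)`. -/
def L1Condition (F : ℝ → ℝ) (L0 Mr ρ0 ρr γ0 : ℝ) : Prop :=
  ∃ nG nIn nH0 : ℝ, HasL1Norm (replicateCol (Fin 1) d.G) nG ∧ HasL1Norm d.Tin nIn ∧
    HasL1Norm (replicateCol (Fin 1) d.H0) nH0 ∧
    nG * ((γ0 + ρr) / ρr * (F (γ0 + ρr) + ∑ j, |d.K j|) * ρr + L0) < ρr - nIn * ρ0 - nH0 * Mr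

/-! ### The sampled-data controller with sampling time `T` -/

/-- `Φ(T) = ∫_0^T e^{Λ Am Λ⁻¹ (T - τ)} Λ dτ`, entry by entry. -/
def Phi (T : ℝ) : Matrix (Fin (n + 1)) (Fin (n + 1)) ℝ :=
  Matrix.of fun i j =>
    ∫ τ in (0 : ℝ)..T, (NormedSpace.exp ((T - τ) • (d.Lam * d.Am * d.Lam⁻¹)) * d.Lam) i j

/-- Adaptation law: the estimate as a function of the output prediction error `ẑ[i] - z[i]`. -/
def sigmaHat (T e : ℝ) : Fin (n + 1) → ℝ :=
  -((d.Phi T)⁻¹ *ᵥ (NormedSpace.exp (T • (d.Lam * d.Am * d.Lam⁻¹)) *ᵥ Pi.single 0 e))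

/-- The states `(x̂[i], x_u[i])` of the output predictor and of the control law, driven by the
output samples `z` and the command samples `r`; the input is `z_aug[i] = r[i] - Co x_u[i]`. -/
def ctrlState (T : ℝ) (z r : ℕ → ℝ) : ℕ → (Fin (n + 1) → ℝ) × (Fin k → ℝ)
  | 0 => (z 0 • d.CmDag, 0)
  | i + 1 =>
    let xhat := (ctrlState T z r i).1
    let xu := (ctrlState T z r i).2
    let σ := d.sigmaHat T (d.Cm ⬝ᵥ xhat - z i)
    let u := r i - (d.ctl.C *ᵥ xu) 0
    (NormedSpace.exp (T • d.Am) *ᵥ xhat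
        + (d.Am⁻¹ * (NormedSpace.exp (T • d.Am) - 1)) *ᵥ (u • d.Bm + σ),
      NormedSpace.exp (T • d.ctl.A) *ᵥ xu
        + (d.ctl.A⁻¹ * (NormedSpace.exp (T • d.ctl.A) - 1)) *ᵥ
            (d.ctl.B *ᵥ (NormedSpace.exp (-T • d.Am) *ᵥ σ)))

/-- The control input `z_aug(t) = z_aug[i]` for `t ∈ [iT, (i+1)T)`. -/
def ctrlInput (T : ℝ) (z r : ℕ → ℝ) (t : ℝ) : ℝ :=
  r ⌊t / T⌋₊ - (d.ctl.C *ᵥ (d.ctrlState T z r ⌊t / T⌋₊).2) 0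

/-! ### Trajectories on a time interval `[0, τ]` -/

/-- `x` is a (Carathéodory) solution on `[0, τ]` of `x' = Az x + Bm (u + σ(x, t))`, `x(0) = x0`. -/
def IsSolution (τ : ℝ) (σ : (Fin (n + 1) → ℝ) → ℝ → ℝ) (x0 : Fin (n + 1) → ℝ)
    (x : ℝ → Fin (n + 1) → ℝ) (u : ℝ → ℝ) : Prop :=
  ContinuousOn x (Set.Icc 0 τ) ∧
    ∀ t ∈ Set.Icc 0 τ, x t = x0 + ∫ s in (0 : ℝ)..t, (d.Az *ᵥ x s + (u s + σ (x s) s) • d.Bm)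

/-- `(x, zaug)` is the state and the input of the closed loop with sampling time `T`. -/
def IsClosedLoop (T τ : ℝ) (σ : (Fin (n + 1) → ℝ) → ℝ → ℝ) (zcmd : ℝ → ℝ)
    (x0 : Fin (n + 1) → ℝ) (x : ℝ → Fin (n + 1) → ℝ) (zaug : ℝ → ℝ) : Prop :=
  d.IsSolution τ σ x0 x zaug ∧
    ∀ t ∈ Set.Icc 0 τ,
      zaug t = d.ctrlInput T (fun i => d.Cm ⬝ᵥ x (i * T)) (fun i => zcmd (i * T)) t

/-- `(xref, uref)` is the state and the input of the reference system:
`uref(s) = zcmd(s) - C(s) (ω(s) + M(s)⁻¹ H_in(s) x0)`, where `ω(t) = K xref(t) + σ(xref(t), t)`;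
`c` and `h` are the inverse Laplace transforms of `C(s)` and `C(s) M(s)⁻¹ H_in(s)`. -/
def IsReference (τ : ℝ) (σ : (Fin (n + 1) → ℝ) → ℝ → ℝ) (zcmd : ℝ → ℝ)
    (x0 : Fin (n + 1) → ℝ) (xref : ℝ → Fin (n + 1) → ℝ) (uref : ℝ → ℝ) : Prop :=
  d.IsSolution τ σ x0 xref uref ∧
    ∃ (c : ℝ → Matrix (Fin 1) (Fin 1) ℝ) (h : ℝ → Matrix (Fin 1) (Fin (n + 1)) ℝ),
      IsImpulseResponse (Matrix.of fun _ _ => d.filt) 0 c ∧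
      IsImpulseResponse (replicateRow (Fin 1) ((d.filt * d.M⁻¹) • d.Hin)) 0 h ∧
      ∀ t ∈ Set.Icc 0 τ, uref t = zcmd t
        - (∫ s in (0 : ℝ)..t, c (t - s) 0 0 * (d.K ⬝ᵥ xref s + σ (xref s) s))
        - (h t *ᵥ x0) 0

end Design

/-- The uncertainty `σ(x, t)` is measurable in time, locally Lipschitz in the state uniformly in
time, with constant `F δ` on the ball of radius `δ`, and `|σ(0, t)| ≤ L0`.
(The norm of `Fin (n + 1) → ℝ` is the maximum norm.) -/
structure IsUncertainty {n : ℕ} (F : ℝ → ℝ) (L0 : ℝ) (σ : (Fin (n + 1) → ℝ) → ℝ → ℝ) :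
    Prop where
  measurable : ∀ x, Measurable (σ x)
  lipschitz : ∀ δ > 0, ∀ x₁ x₂, ‖x₁‖ ≤ δ → ‖x₂‖ ≤ δ → ∀ t ≥ 0,
    |σ x₂ t - σ x₁ t| ≤ F δ * ‖x₂ - x₁‖
  bounded : ∀ t ≥ 0, |σ 0 t| ≤ L0

end

end L1Aug

/-! Write ω = K x + σ(x,t) along a trajectory; both loops are then x' = A_m x + B_m (u + ω). The
realization (A_o, B_o, C_o) of O(s) also realizes what the reference input needs, because O B_m =
C(s) and O (I − C_m†C_m) = C M⁻¹ H_in. Hence u_ref = z_cmd − C_o ξ, where ξ' = A_o ξ + B_o B_m ω and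
ξ(0) = B_o (I − C_m†C_m) x0 (`filterState`). For the closed loop, let ξ be driven by its own ω and
put q = z_aug + C_o ξ (`residualInput`). Both states are then the same `response` to disturbance,
command and initial state, with command z_cmd or q, and its gains are the ℒ₁ norms of G, T_in and H₀
(`Valid.norm_response_le`).

The heart is `Valid.exists_control_error_bound`: C_o x_u − C_o ξ = O(T) as long as ω is bounded. By
the choice of Λ, the adaptation law replaces the predictor error e by its P-orthogonal projection
onto ker C_m before the flow of A_m acts, and the Lyapunov equation makes that flow a contraction in
the same norm. So e stays bounded, C_m e = O(T), and σ̂ stays bounded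
(`Valid.exists_predictor_bound`). The error e itself need not be small. What saves the argument is
A_o B_o − B_o A_m = b C_m (`Valid.sylvester`): in ζ = x_u − B_o e − ξ the estimate cancels to first
order, each step contributes O(T²), and stability of A_o gives ζ = O(T). Likewise C_o B_o e is a
multiple of C_m e, hence O(T).

Stability of A_o is not assumed. It follows from integrability of the impulse response of T_in,
stability of C(s), minimality and the unit DC gain (`Valid.isHurwitz_ctl`).

Finally, |q − z_cmd[i]| ≤ C T and the ℒ₁ condition keep both trajectories inside the ball of radius
γ₀ + ρ_r by a first-exit argument. The same condition forces ‖G‖ L < 1 for the Lipschitz constant L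
of ω on that ball, so the largest deviation D satisfies D ≤ ‖G‖ L D + ‖H₀‖ (ν + C T). -/

namespace L1Aug
noncomputable section

/-! ### Rational transfer matrices determine their impulse responses. -/

section Realizations

set_option linter.unusedSectionVars false

variable {ι κ p q m : Type} [Fintype ι] [DecidableEq ι] [Fintype κ] [DecidableEq κ]

@[simp] lemma const_apply (M : Matrix p m ℝ) (i : p) (j : m) :
    const M i j = RatFunc.C (M i j) := rfl

lemma const_mul [Fintype m] (M : Matrix p m ℝ) (N : Matrix m q ℝ) :
    const (M * N) = const M * const N := by
  ext i j; simp [Matrix.mul_apply, map_sum]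

lemma const_add (M N : Matrix p m ℝ) : const (M + N) = const M + const N := by
  ext i j; simp

lemma const_sub (M N : Matrix p m ℝ) : const (M - N) = const M - const N := by
  ext i j; simp

lemma const_neg (M : Matrix p m ℝ) : const (-M) = -const M := by
  ext i j; simp

@[simp] lemma const_zero : const (0 : Matrix p m ℝ) = 0 := by
  ext i j; simp

@[simp] lemma const_one : const (1 : Matrix ι ι ℝ) = 1 := by
  ext i j; by_cases h : i = j <;> simp [h, Matrix.one_apply]

lemma const_fromBlocks (a : Matrix ι ι ℝ) (b : Matrix ι κ ℝ) (c : Matrix κ ι ℝ)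
    (e : Matrix κ κ ℝ) :
    const (fromBlocks a b c e) = fromBlocks (const a) (const b) (const c) (const e) :=
  Matrix.fromBlocks_map ..

lemma isUnit_resolvent_matrix (A : Matrix ι ι ℝ) :
    IsUnit ((RatFunc.X : RatFunc ℝ) • (1 : Matrix ι ι (RatFunc ℝ)) - const A) := by
  have h : ((RatFunc.X : RatFunc ℝ) • (1 : Matrix ι ι (RatFunc ℝ)) - const A)
      = (algebraMap (Polynomial ℝ) (RatFunc ℝ)).mapMatrix (charmatrix A) := by
    ext i j
    by_cases hij : i = j
    · subst hij; simp [RatFunc.algebraMap_X, RatFunc.algebraMap_C]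
    · simp [hij, RatFunc.algebraMap_C]
  rw [Matrix.isUnit_iff_isUnit_det, h, ← RingHom.map_det, isUnit_iff_ne_zero]
  have := (A.charpoly_monic).ne_zero
  rw [Matrix.charpoly] at this
  simpa using this

lemma mul_resolvent (A : Matrix ι ι ℝ) :
    ((RatFunc.X : RatFunc ℝ) • (1 : Matrix ι ι (RatFunc ℝ)) - const A) * resolvent A = 1 :=
  Matrix.mul_nonsing_inv _ ((Matrix.isUnit_iff_isUnit_det _).1 (isUnit_resolvent_matrix A))

lemma resolvent_mul (A : Matrix ι ι ℝ) :
    resolvent A * ((RatFunc.X : RatFunc ℝ) • (1 : Matrix ι ι (RatFunc ℝ)) - const A) = 1 :=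
  Matrix.nonsing_inv_mul _ ((Matrix.isUnit_iff_isUnit_det _).1 (isUnit_resolvent_matrix A))

lemma X_smul_resolvent (A : Matrix ι ι ℝ) :
    (RatFunc.X : RatFunc ℝ) • resolvent A = 1 + const A * resolvent A := by
  have h := mul_resolvent A
  rw [sub_mul, smul_mul_assoc, one_mul, sub_eq_iff_eq_add] at h
  exact h

lemma X_smul_resolvent' (A : Matrix ι ι ℝ) :
    (RatFunc.X : RatFunc ℝ) • resolvent A = 1 + resolvent A * const A := by
  have h := resolvent_mul A
  rw [mul_sub, mul_smul_comm, mul_one, sub_eq_iff_eq_add] at h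
  exact h

open Classical in
/-- The valuation at infinity; a rational function is strictly proper when it is less than one. -/
def inftyVal : Valuation (RatFunc ℝ) (WithZero (Multiplicative ℤ)) := RatFunc.inftyValuation ℝ

lemma inftyVal_C {c : ℝ} (h : c ≠ 0) : inftyVal (RatFunc.C c) = 1 := by
  classical exact RatFunc.inftyValuation.C _ h

lemma inftyVal_C_le (c : ℝ) : inftyVal (RatFunc.C c) ≤ 1 := by
  by_cases h : c = 0
  · simp [h]
  · rw [inftyVal_C h]

lemma one_lt_inftyVal_X : 1 < inftyVal (RatFunc.X : RatFunc ℝ) := by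
  classical
  rw [inftyVal, RatFunc.inftyValuation.X, ← WithZero.exp_zero, WithZero.exp_lt_exp]; norm_num

/-- The entries of the resolvent are strictly proper. -/
lemma inftyVal_resolvent_lt (A : Matrix ι ι ℝ) (i j : ι) :
    inftyVal (resolvent A i j) < 1 := by
  set v := inftyVal
  obtain ⟨⟨i₀, j₀⟩, -, hmax⟩ := Finset.exists_max_image Finset.univ
    (fun q : ι × ι => v (resolvent A q.1 q.2)) ⟨(i, j), Finset.mem_univ _⟩
  refine (hmax (i, j) (Finset.mem_univ _)).trans_lt ?_
  by_contra! hge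
  set r := v (resolvent A i₀ j₀) with hr
  change 1 ≤ r at hge
  -- In s R = I + A R the right side has valuation at most r when r ≥ 1, while multiplying the
  -- maximal entry by s raises its valuation above r.
  have h := congrFun (congrFun (X_smul_resolvent A) i₀) j₀
  rw [Matrix.smul_apply, Matrix.add_apply, smul_eq_mul] at h
  have h1 : v (RatFunc.X * resolvent A i₀ j₀) ≤ r := by
    rw [h]
    refine v.map_add_le ?_ ?_
    · refine le_trans ?_ hge
      rw [Matrix.one_apply]; split_ifs <;> simp
    · rw [Matrix.mul_apply]
      refine v.map_sum_le fun x _ => ?_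
      rw [map_mul]
      refine (mul_le_mul' (inftyVal_C_le _) (hmax (x, j₀) (Finset.mem_univ _))).trans ?_
      rw [one_mul]
  rw [map_mul] at h1
  have hpos : 0 < r := lt_of_lt_of_le zero_lt_one hge
  have := mul_lt_mul_of_pos_right one_lt_inftyVal_X hpos
  rw [one_mul] at this
  exact absurd h1 (not_le.2 this)

lemma inftyVal_realization_lt (A : Matrix ι ι ℝ) (B : Matrix ι m ℝ) (C : Matrix p ι ℝ)
    (i : p) (j : m) :
    inftyVal ((const C * resolvent A * const B) i j) < 1 := by
  rw [Matrix.mul_apply]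
  refine Valuation.map_sum_lt _ one_ne_zero fun x _ => ?_
  rw [map_mul]
  refine lt_of_le_of_lt (mul_le_mul' le_rfl (inftyVal_C_le _)) ?_
  rw [mul_one, Matrix.mul_apply]
  refine Valuation.map_sum_lt _ one_ne_zero fun y _ => ?_
  rw [map_mul]
  refine lt_of_le_of_lt (mul_le_mul' (inftyVal_C_le _) le_rfl) ?_
  rw [one_mul]
  exact inftyVal_resolvent_lt A y x

/-- A nonzero constant has valuation one at infinity, so it cannot be a difference of two strictly
proper functions. -/
lemma direct_eq_of_transfer_eq {A : Matrix ι ι ℝ} {B : Matrix ι m ℝ} {C : Matrix p ι ℝ}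
    {D : Matrix p m ℝ} {A' : Matrix κ κ ℝ} {B' : Matrix κ m ℝ} {C' : Matrix p κ ℝ}
    {D' : Matrix p m ℝ}
    (h : const C * resolvent A * const B + const D
      = const C' * resolvent A' * const B' + const D') :
    D = D' ∧ const C * resolvent A * const B = const C' * resolvent A' * const B' := by
  have hD : D = D' := by
    ext i j
    have h1 : const (D - D') i j = (const C' * resolvent A' * const B') i j
        - (const C * resolvent A * const B) i j := by
      have := congrFun (congrFun h i) j
      simp only [Matrix.add_apply] at this
      rw [const_sub, Matrix.sub_apply]
      linear_combination this
    by_contra hne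
    have h2 : inftyVal (const (D - D') i j) < 1 := by
      rw [h1]
      exact Valuation.map_sub_lt _ (inftyVal_realization_lt ..)
        (inftyVal_realization_lt ..)
    rw [const_apply, inftyVal_C (by simpa [sub_eq_zero] using hne)] at h2
    exact lt_irrefl _ h2
  refine ⟨hD, ?_⟩
  subst hD
  exact add_right_cancel h

/-- Equal transfer matrices have equal Markov parameters. -/
lemma markov_eq_of_transfer_eq {A : Matrix ι ι ℝ} {B : Matrix ι m ℝ} {C : Matrix p ι ℝ}
    {A' : Matrix κ κ ℝ} {B' : Matrix κ m ℝ} {C' : Matrix p κ ℝ}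
    (h : const C * resolvent A * const B = const C' * resolvent A' * const B') (k : ℕ) :
    C * A ^ k * B = C' * A' ^ k * B' := by
  have key : ∀ k : ℕ, const (C * A ^ k) * resolvent A * const B
      = const (C' * A' ^ k) * resolvent A' * const B' →
      C * A ^ k * B = C' * A' ^ k * B' ∧ const (C * A ^ (k + 1)) * resolvent A * const B
        = const (C' * A' ^ (k + 1)) * resolvent A' * const B' := by
    intro k hk
    -- Multiplication by s turns the k-th Markov parameter into a direct term, where it can be
    -- compared, and leaves the realization with C A^(k+1).
    have e : ∀ {ι : Type} [Fintype ι] [DecidableEq ι] (A : Matrix ι ι ℝ) (B : Matrix ι m ℝ)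
        (C : Matrix p ι ℝ), const (C * A ^ (k + 1)) * resolvent A * const B + const (C * A ^ k * B)
          = (RatFunc.X : RatFunc ℝ) • (const (C * A ^ k) * resolvent A * const B) := by
      intro ι _ _ A B C
      rw [← Matrix.smul_mul, ← Matrix.mul_smul, X_smul_resolvent, Matrix.mul_add, Matrix.add_mul,
        Matrix.mul_one, ← const_mul, add_comm, ← Matrix.mul_assoc, ← const_mul, pow_succ,
        Matrix.mul_assoc C, Matrix.mul_assoc C]
    have := direct_eq_of_transfer_eq (by rw [e, e, hk] :
      const (C * A ^ (k + 1)) * resolvent A * const B + const (C * A ^ k * B)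
        = const (C' * A' ^ (k + 1)) * resolvent A' * const B' + const (C' * A' ^ k * B'))
    exact this
  have all : ∀ k : ℕ, const (C * A ^ k) * resolvent A * const B
      = const (C' * A' ^ k) * resolvent A' * const B' := by
    intro k
    induction k with
    | zero => simpa using h
    | succ k ih => exact (key k ih).2
  exact (key k (all k)).1

section Exp

attribute [local instance] Matrix.linftyOpNormedRing Matrix.linftyOpNormedAlgebra

lemma hasSum_exp_realization (A : Matrix ι ι ℝ) (B : Matrix ι m ℝ) (C : Matrix p ι ℝ) (t : ℝ)
    (i : p) (j : m) :
    HasSum (fun k : ℕ => ((k.factorial : ℝ)⁻¹ * t ^ k) * (C * A ^ k * B) i j)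
      ((C * NormedSpace.exp (t • A) * B) i j) := by
  have h := NormedSpace.exp_series_hasSum_exp' (𝕂 := ℝ) (t • A)
  let L : Matrix ι ι ℝ →ₗ[ℝ] ℝ :=
    { toFun := fun X => (C * X * B) i j
      map_add' := fun X Y => by simp [Matrix.mul_add, Matrix.add_mul]
      map_smul' := fun c X => by simp }
  have h2 := h.mapL (LinearMap.toContinuousLinearMap L)
  have e : ∀ k : ℕ, L ((k.factorial : ℝ)⁻¹ • (t • A) ^ k)
      = ((k.factorial : ℝ)⁻¹ * t ^ k) * (C * A ^ k * B) i j := fun k => by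
    change (C * ((k.factorial : ℝ)⁻¹ • (t • A) ^ k) * B) i j = _
    rw [smul_pow, smul_smul, Matrix.mul_smul, Matrix.smul_mul, Matrix.smul_apply, smul_eq_mul]
  exact (funext e) ▸ h2

end Exp

lemma exp_realization_eq {A : Matrix ι ι ℝ} {B : Matrix ι m ℝ} {C : Matrix p ι ℝ}
    {A' : Matrix κ κ ℝ} {B' : Matrix κ m ℝ} {C' : Matrix p κ ℝ}
    (h : ∀ k : ℕ, C * A ^ k * B = C' * A' ^ k * B') (t : ℝ) :
    C * NormedSpace.exp (t • A) * B = C' * NormedSpace.exp (t • A') * B' := by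
  ext i j
  have h1 := hasSum_exp_realization A B C t i j
  have h2 := hasSum_exp_realization A' B' C' t i j
  exact h1.unique (by simpa only [h] using h2)

/-- The impulse response of a transfer matrix does not depend on the realization. -/
lemma IsImpulseResponse.eq_realization [Fintype p] [Fintype m] {G : Matrix p m (RatFunc ℝ)}
    {D : Matrix p m ℝ}
    {g : ℝ → Matrix p m ℝ} (h : IsImpulseResponse G D g) {A : Matrix ι ι ℝ} {B : Matrix ι m ℝ}
    {C : Matrix p ι ℝ} {D' : Matrix p m ℝ}
    (hG : const C * resolvent A * const B + const D' = G) :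
    D = D' ∧ ∀ t, g t = C * NormedSpace.exp (t • A) * B := by
  obtain ⟨k, S, hS, hD, hg⟩ := h
  obtain ⟨h1, h2⟩ := direct_eq_of_transfer_eq (hS.trans hG.symm)
  exact ⟨hD ▸ h1, fun t => (hg t).trans (exp_realization_eq (markov_eq_of_transfer_eq h2) t)⟩

end Realizations
end
end L1Aug

namespace L1Aug
noncomputable section

/-! ### Exponential decay of Hurwitz flows and integrability of impulse responses. -/

section MatrixExponential

set_option linter.unusedSectionVars false

attribute [local instance] Matrix.linftyOpNormedAddCommGroup Matrix.linftyOpNormedSpace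
  Matrix.linftyOpNormedRing Matrix.linftyOpNormedAlgebra

variable {ι p m : Type} [Fintype ι] [DecidableEq ι] [Fintype p] [Fintype m]

/-- The flow `e^{tA}` of a square matrix. -/
def expM (A : Matrix ι ι ℝ) (t : ℝ) : Matrix ι ι ℝ := NormedSpace.exp (t • A)

@[simp] lemma expM_zero (A : Matrix ι ι ℝ) : expM A 0 = 1 := by
  simp [expM]

lemma expM_add (A : Matrix ι ι ℝ) (s t : ℝ) : expM A (s + t) = expM A s * expM A t := by
  rw [expM, add_smul, Matrix.exp_add_of_commute]
  · rfl
  · exact ((Commute.refl A).smul_left s).smul_right t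

lemma expM_mul_neg (A : Matrix ι ι ℝ) (t : ℝ) : expM A t * expM A (-t) = 1 := by
  rw [← expM_add]; simp

lemma commute_expM (A : Matrix ι ι ℝ) (t : ℝ) : A * expM A t = expM A t * A :=
  (((Commute.refl A).smul_right t).exp_right).eq

lemma hasDerivAt_expM (A : Matrix ι ι ℝ) (t : ℝ) : HasDerivAt (expM A) (A * expM A t) t :=
  hasDerivAt_exp_smul_const' A t

lemma continuous_expM (A : Matrix ι ι ℝ) : Continuous (expM A) :=
  continuous_iff_continuousAt.2 fun t => (hasDerivAt_expM A t).continuousAt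

lemma continuous_expM_apply (A : Matrix ι ι ℝ) (i j : ι) : Continuous fun t => expM A t i j :=
  (continuous_expM A).matrix_elem i j

lemma HasDerivAt.linearMap {E F : Type*} [NormedAddCommGroup E] [NormedSpace ℝ E]
    [FiniteDimensional ℝ E] [NormedAddCommGroup F] [NormedSpace ℝ F] (L : E →ₗ[ℝ] F)
    {f : ℝ → E} {f' : E} {t : ℝ} (hf : HasDerivAt f f' t) :
    HasDerivAt (fun s => L (f s)) (L f') t :=
  (LinearMap.toContinuousLinearMap L).hasFDerivAt.comp_hasDerivAt t hf

lemma hasDerivAt_expM_mulVec (A : Matrix ι ι ℝ) (v : ι → ℝ) (t : ℝ) :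
    HasDerivAt (fun t => expM A t *ᵥ v) (A *ᵥ (expM A t *ᵥ v)) t := by
  have h := HasDerivAt.linearMap ((Matrix.mulVecBilin ℝ ℝ).flip v) (hasDerivAt_expM A t)
  rw [mulVec_mulVec]
  exact h

/-- The flow acting on complex vectors. -/
def cflow (A : Matrix ι ι ℝ) (w : ι → ℂ) (t : ℝ) : ι → ℂ :=
  (expM A t).map (algebraMap ℝ ℂ) *ᵥ w

lemma hasDerivAt_cflow (A : Matrix ι ι ℝ) (w : ι → ℂ) (t : ℝ) :
    HasDerivAt (cflow A w) (A.map (algebraMap ℝ ℂ) *ᵥ cflow A w t) t := by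
  have e : A.map (algebraMap ℝ ℂ) *ᵥ cflow A w t = (A * expM A t).map (algebraMap ℝ ℂ) *ᵥ w := by
    rw [cflow, mulVec_mulVec, Matrix.map_mul]
  rw [e, hasDerivAt_pi]
  intro i
  simp only [cflow, mulVec, dotProduct, Matrix.map_apply]
  refine HasDerivAt.fun_sum fun j _ => ?_
  refine HasDerivAt.mul_const ?_ _
  have h := (hasDerivAt_pi.1 (hasDerivAt_pi.1 (hasDerivAt_expM A t) i) j)
  exact h.ofReal_comp

lemma cflow_mulVec (A : Matrix ι ι ℝ) (w : ι → ℂ) (t : ℝ) :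
    A.map (algebraMap ℝ ℂ) *ᵥ cflow A w t = cflow A (A.map (algebraMap ℝ ℂ) *ᵥ w) t := by
  rw [cflow, cflow, mulVec_mulVec, mulVec_mulVec, ← Matrix.map_mul, ← Matrix.map_mul, commute_expM]

/-- The trajectory through `w` tends to zero exponentially, with any small enough rate. -/
def Decays (A : Matrix ι ι ℝ) (w : ι → ℂ) : Prop :=
  ∀ᶠ a in 𝓝[>] (0 : ℝ), ∃ M : ℝ, ∀ t ≥ 0, ‖cflow A w t‖ ≤ M * Real.exp (-a * t)

/-- The curve e^{−μs} e^{sA} w has derivative e^{−μs} e^{sA} (A − μ) w, of norm at most M e^{(β−a)s}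
with β = −Re μ. Integrating and multiplying back by e^{−βt} keeps the rate a, provided a < β. Asking
only for small rates lets finitely many such conditions be combined. -/
lemma Decays.of_sub_smul {A : Matrix ι ι ℝ} {w : ι → ℂ} {μ : ℂ} (hμ : μ.re < 0)
    (h : Decays A (A.map (algebraMap ℝ ℂ) *ᵥ w - μ • w)) : Decays A w := by
  have hsmall : ∀ᶠ a in 𝓝[>] (0 : ℝ), a < -μ.re :=
    nhdsWithin_le_nhds (Iio_mem_nhds (by linarith))
  filter_upwards [h, hsmall] with a ⟨M, hM⟩ ha
  have hM0 : 0 ≤ M := by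
    have := (norm_nonneg _).trans (hM 0 le_rfl)
    simpa using this
  set β := -μ.re with hβ
  have hβa : 0 < β - a := by linarith
  refine ⟨‖w‖ + M / (β - a), fun t ht => ?_⟩
  set z : ℝ → ι → ℂ := fun s => Complex.exp (-μ * s) • cflow A w s with hz
  have hnorm : ∀ s : ℝ, ‖Complex.exp (-μ * s)‖ = Real.exp (β * s) := by
    intro s; rw [Complex.norm_exp]; simp [hβ]
  have hdz : ∀ s : ℝ, HasDerivAt z
      (Complex.exp (-μ * s) • cflow A (A.map (algebraMap ℝ ℂ) *ᵥ w - μ • w) s) s := by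
    intro s
    have h1 : HasDerivAt (fun s : ℝ => Complex.exp (-μ * s)) (Complex.exp (-μ * s) * (-μ)) s := by
      have := ((hasDerivAt_id (s : ℂ)).const_mul (-μ)).cexp
      simpa using this.comp_ofReal
    refine (h1.smul (hasDerivAt_cflow A w s) : HasDerivAt z _ s).congr_deriv ?_
    rw [cflow_mulVec]
    simp only [cflow, mulVec_sub, mulVec_smul, smul_sub, smul_smul]
    rw [mul_neg, neg_smul, sub_eq_add_neg]
  have hB : ∀ s : ℝ, HasDerivAt (fun s => ‖w‖ + M / (β - a) * Real.exp ((β - a) * s))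
      (M * Real.exp ((β - a) * s)) s := by
    intro s
    have h1 := (((hasDerivAt_id s).const_mul (β - a)).exp.const_mul (M / (β - a))).const_add ‖w‖
    refine h1.congr_deriv ?_
    simp only [id, mul_one]
    field_simp
  have key := image_norm_le_of_norm_deriv_right_le_deriv_boundary (f := z) (a := 0) (b := t)
    (fun s _ => (hdz s).continuousAt.continuousWithinAt)
    (fun s _ => (hdz s).hasDerivWithinAt) ?_ hB ?_ (x := t) ⟨ht, le_rfl⟩
  · rw [hz] at key
    simp only [norm_smul, hnorm] at key
    have e1 : ‖cflow A w t‖ ≤ Real.exp (-β * t) * (‖w‖ + M / (β - a) * Real.exp ((β - a) * t)) := by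
      have h1 := mul_le_mul_of_nonneg_left key (Real.exp_pos (-β * t)).le
      rwa [← mul_assoc, ← Real.exp_add, neg_mul, neg_add_cancel, Real.exp_zero, one_mul,
        ← neg_mul] at h1
    refine e1.trans ?_
    have e2 : Real.exp (-β * t) * Real.exp ((β - a) * t) = Real.exp (-a * t) := by
      rw [← Real.exp_add]; ring_nf
    have e3 : Real.exp (-β * t) ≤ Real.exp (-a * t) :=
      Real.exp_le_exp.2 (by nlinarith)
    calc _ = ‖w‖ * Real.exp (-β * t)
          + M / (β - a) * (Real.exp (-β * t) * Real.exp ((β - a) * t)) := by ring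
      _ ≤ ‖w‖ * Real.exp (-a * t) + M / (β - a) * Real.exp (-a * t) := by
          rw [e2]; gcongr
      _ = _ := by ring
  · have : 0 ≤ M / (β - a) := by positivity
    simp [hz, cflow, this]
  · intro s hs
    rw [norm_smul, hnorm]
    calc _ ≤ Real.exp (β * s) * (M * Real.exp (-a * s)) := by
          gcongr; exact hM s hs.1
      _ = M * (Real.exp (β * s) * Real.exp (-a * s)) := by ring
      _ = _ := by rw [← Real.exp_add]; ring_nf

lemma decays_of_prod {A : Matrix ι ι ℝ} (s : Multiset ℂ) (hs : ∀ μ ∈ s, μ.re < 0) (w : ι → ℂ)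
    (h : Decays A (Polynomial.aeval (A.map (algebraMap ℝ ℂ))
      (s.map fun μ => Polynomial.X - Polynomial.C μ).prod *ᵥ w)) : Decays A w := by
  induction s using Multiset.induction_on with
  | empty => simpa using h
  | cons μ s ih =>
    refine ih (fun ν hν => hs ν (Multiset.mem_cons_of_mem hν)) ?_
    refine Decays.of_sub_smul (hs μ (Multiset.mem_cons_self _ _)) ?_
    convert h using 1
    rw [Multiset.map_cons, Multiset.prod_cons, map_mul, ← mulVec_mulVec, map_sub,
      Polynomial.aeval_X, Polynomial.aeval_C, sub_mulVec, Algebra.algebraMap_eq_smul_one,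
      smul_mulVec, one_mulVec]

/-- By Cayley–Hamilton the product of all factors A − μ annihilates w, and the factors are then
removed one at a time. No Jordan form is needed. -/
lemma IsHurwitz.decays {A : Matrix ι ι ℝ} (hA : IsHurwitz A) (w : ι → ℂ) : Decays A w := by
  have hsplit := (IsAlgClosed.splits (A.map (algebraMap ℝ ℂ)).charpoly).eq_prod_roots_of_monic
    (Matrix.charpoly_monic _)
  refine decays_of_prod (A.map (algebraMap ℝ ℂ)).charpoly.roots (fun μ hμ => hA μ ?_) w ?_
  · rw [Matrix.mem_spectrum_iff_isRoot_charpoly]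
    exact Polynomial.isRoot_of_mem_roots hμ
  · rw [← hsplit, Matrix.aeval_self_charpoly, zero_mulVec]
    exact Eventually.of_forall fun a => ⟨0, fun t _ => by simp [cflow]⟩

/-- The flow of a Hurwitz matrix tends to zero exponentially. -/
lemma IsHurwitz.exists_norm_expM_le {A : Matrix ι ι ℝ} (hA : IsHurwitz A) :
    ∃ a > 0, ∃ M > 0, ∀ t ≥ 0, ‖expM A t‖ ≤ M * Real.exp (-a * t) := by
  have h : ∀ᶠ a in 𝓝[>] (0 : ℝ), ∀ j : ι, ∃ M : ℝ, ∀ t ≥ 0,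
      ‖cflow A (Pi.single j 1) t‖ ≤ M * Real.exp (-a * t) :=
    eventually_all.2 fun j => hA.decays _
  obtain ⟨a, ha, ha0⟩ := (h.and self_mem_nhdsWithin).exists
  choose M hM using ha
  refine ⟨a, ha0, 1 + ∑ j, |M j|, by positivity, fun t ht => ?_⟩
  have hle : ∀ i j, |expM A t i j| ≤ |M j| * Real.exp (-a * t) := by
    intro i j
    have h1 := (norm_le_pi_norm (cflow A (Pi.single j 1) t) i).trans (hM j t ht)
    have h2 : ‖cflow A (Pi.single j 1) t i‖ = |expM A t i j| := by
      simp [cflow]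
    rw [h2] at h1
    exact h1.trans (mul_le_mul_of_nonneg_right (le_abs_self _) (Real.exp_pos _).le)
  rw [Matrix.linfty_opNorm_def]
  have hR : 0 ≤ (1 + ∑ j, |M j|) * Real.exp (-a * t) := by positivity
  have := Finset.sup_le (s := Finset.univ) (f := fun i => ∑ j, ‖expM A t i j‖₊)
    (a := ⟨_, hR⟩) (fun i _ => ?_)
  · exact_mod_cast this
  · refine NNReal.coe_le_coe.1 ?_
    rw [NNReal.coe_sum]
    change ∑ j, ‖expM A t i j‖ ≤ (1 + ∑ j, |M j|) * Real.exp (-a * t)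
    calc ∑ j, ‖expM A t i j‖ ≤ ∑ j, |M j| * Real.exp (-a * t) :=
          Finset.sum_le_sum fun j _ => hle i j
      _ = (∑ j, |M j|) * Real.exp (-a * t) := by rw [Finset.sum_mul]
      _ ≤ (1 + ∑ j, |M j|) * Real.exp (-a * t) := by gcongr; linarith

/-- If `C e^{tA} B` is integrable on the half-line, then so is its derivative. -/
lemma integrableOn_realization_mul {A : Matrix ι ι ℝ} {B : Matrix ι m ℝ} {C : Matrix p ι ℝ}
    (h : ∀ i j, IntegrableOn (fun t => (C * expM A t * B) i j) (Set.Ioi 0)) (i : p) (j : m) :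
    IntegrableOn (fun t => (C * A * expM A t * B) i j) (Set.Ioi 0) := by
  -- These X form a subspace, closed because it is finite-dimensional. It contains e^{sA} for s ≥ 0
  -- by shifting time, hence also the right derivative A of the flow at zero.
  let W : Submodule ℝ (Matrix ι ι ℝ) :=
    { carrier := {X | IntegrableOn (fun t => (C * X * expM A t * B) i j) (Set.Ioi 0)}
      zero_mem' := by simp
      add_mem' := by
        intro X Y hX hY
        have := Integrable.add hX hY
        refine this.congr (Eventually.of_forall fun t => ?_)
        simp [Matrix.mul_add, Matrix.add_mul]
      smul_mem' := by
        intro c X hX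
        have := Integrable.const_mul hX c
        refine this.congr (Eventually.of_forall fun t => ?_)
        simp }
  have hexp : ∀ s ≥ 0, expM A s ∈ W := by
    intro s hs
    have h1 := ((h i j).mono_set (Set.Ioi_subset_Ioi hs)).integrable_indicator measurableSet_Ioi
    have h2 := h1.comp_add_right s
    have h3 : IntegrableOn (fun t => (C * expM A (t + s) * B) i j) (Set.Ioi 0) := by
      rw [← integrable_indicator_iff measurableSet_Ioi]
      refine h2.congr (Eventually.of_forall fun t => ?_)
      simp [Set.indicator]
    refine Integrable.congr h3 (Eventually.of_forall fun t => ?_)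
    simp only [add_comm t s, expM_add, Matrix.mul_assoc]
  have hcl : IsClosed (W : Set (Matrix ι ι ℝ)) := W.closed_of_finiteDimensional
  have hd := (hasDerivAt_iff_tendsto_slope_zero.1 (hasDerivAt_expM A 0))
  have hd' := hd.mono_left (nhdsWithin_mono (0 : ℝ) (s := Set.Ioi 0) (fun x hx => ne_of_gt hx))
  have hmem : A * expM A 0 ∈ W := by
    refine hcl.mem_of_tendsto hd' ?_
    filter_upwards [self_mem_nhdsWithin] with s hs
    refine W.smul_mem _ (W.sub_mem (hexp _ ?_) (hexp _ le_rfl))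
    rw [zero_add]; exact le_of_lt hs
  rw [expM_zero, mul_one] at hmem
  exact hmem

/-- Since |e^{μt}| ≥ 1, integrability would pass to the constant c on a set of infinite measure. -/
lemma eq_zero_of_integrableOn_exp {μ c : ℂ} (hμ : 0 ≤ μ.re)
    (h : IntegrableOn (fun t : ℝ => Complex.exp (μ * t) * c) (Set.Ioi 0)) : c = 0 := by
  have h1 : IntegrableOn (fun _ : ℝ => c) (Set.Ioi 0) := by
    refine Integrable.mono h aestronglyMeasurable_const ?_
    refine (ae_restrict_iff' measurableSet_Ioi).2 (Eventually.of_forall fun t ht => ?_)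
    rw [norm_mul, Complex.norm_exp]
    refine le_mul_of_one_le_left (norm_nonneg _) (Real.one_le_exp ?_)
    simpa using mul_nonneg hμ (le_of_lt ht)
  rw [integrableOn_const_iff] at h1
  simpa using h1

end MatrixExponential
end
end L1Aug

namespace L1Aug
noncomputable section

/-! ### Controllability, observability and poles. -/

section StateSpaceTheory

set_option linter.unusedSectionVars false

variable {ι κ p m : Type} [Fintype ι] [DecidableEq ι] [Fintype κ] [DecidableEq κ]
  [Fintype p] [Fintype m]

lemma IsControllable.eq_top {A : Matrix ι ι ℝ} {B : Matrix ι m ℝ} (h : IsControllable A B)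
    {W : Submodule ℝ (ι → ℝ)} (hW : ∀ k j, (A ^ k * B).col j ∈ W) : W = ⊤ := by
  rw [eq_top_iff, ← h, Submodule.span_le]
  rintro _ ⟨⟨k, j⟩, rfl⟩
  exact hW k j

lemma IsControllable.linearMap_eq_zero {A : Matrix ι ι ℝ} {B : Matrix ι m ℝ}
    (h : IsControllable A B) {E : Type*} [AddCommGroup E] [Module ℝ E] {f : (ι → ℝ) →ₗ[ℝ] E}
    (hf : ∀ k j, f ((A ^ k * B).col j) = 0) : f = 0 := by
  have : LinearMap.ker f = ⊤ := h.eq_top fun k j => hf k j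
  exact LinearMap.ker_eq_top.1 this

lemma IsObservable.eq_top {A : Matrix ι ι ℝ} {C : Matrix p ι ℝ} (h : IsObservable A C)
    {W : Submodule ℝ (ι → ℝ)} (hW : ∀ k i, (C * A ^ k).row i ∈ W) : W = ⊤ := by
  refine IsControllable.eq_top h fun k i => ?_
  convert hW k i using 1
  rw [← transpose_pow, ← transpose_mul]
  rfl

lemma IsObservable.eq_zero {A : Matrix ι ι ℝ} {C : Matrix p ι ℝ} (h : IsObservable A C)
    {v : ι → ℝ} (hv : ∀ k : ℕ, (C * A ^ k) *ᵥ v = 0) : v = 0 := by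
  let W : Submodule ℝ (ι → ℝ) := LinearMap.ker ((dotProductBilin ℝ ℝ).flip v)
  have hW : W = ⊤ := h.eq_top fun k i => congrFun (hv k) i
  have : v ∈ W := hW ▸ Submodule.mem_top
  exact dotProduct_self_eq_zero.1 this

lemma pow_intertwine {A : Matrix ι ι ℝ} {A' : Matrix κ κ ℝ} {L : Matrix κ ι ℝ}
    (h : L * A = A' * L) (k : ℕ) : L * A ^ k = A' ^ k * L := by
  induction k with
  | zero => simp
  | succ k ih => rw [pow_succ, pow_succ, ← Matrix.mul_assoc, ih, Matrix.mul_assoc, h,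
      Matrix.mul_assoc]

lemma expM_intertwine {A : Matrix ι ι ℝ} {A' : Matrix κ κ ℝ} {L : Matrix κ ι ℝ}
    (h : L * A = A' * L) (t : ℝ) : L * expM A t = expM A' t * L := by
  have := exp_realization_eq (A := A) (B := 1) (C := L) (A' := A') (B' := L) (C' := 1)
    (fun k => by simpa using pow_intertwine h k) t
  simpa [expM] using this

lemma resolvent_fromBlocks (A : Matrix ι ι ℝ) (B : Matrix ι κ ℝ) (E : Matrix κ κ ℝ) :
    resolvent (fromBlocks A B 0 E)
      = fromBlocks (resolvent A) (resolvent A * const B * resolvent E) 0 (resolvent E) := by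
  have h : (RatFunc.X : RatFunc ℝ) • (1 : Matrix (ι ⊕ κ) (ι ⊕ κ) (RatFunc ℝ))
      - const (fromBlocks A B 0 E)
      = fromBlocks ((RatFunc.X : RatFunc ℝ) • 1 - const A) (-const B) 0
          ((RatFunc.X : RatFunc ℝ) • 1 - const E) := by
    rw [const_fromBlocks, const_zero, ← fromBlocks_one, fromBlocks_smul, sub_eq_add_neg,
      fromBlocks_neg, fromBlocks_add]
    simp [sub_eq_add_neg]
  rw [resolvent, h, inv_fromBlocks_zero₂₁_of_isUnit_iff _ _ _
    (iff_of_true (isUnit_resolvent_matrix A) (isUnit_resolvent_matrix E))]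
  simp [resolvent]

/-- Multiplying a resolvent by a polynomial in `s` amounts to multiplying it by the polynomial in
`A`, up to a polynomial matrix. -/
lemma exists_polynomial_resolvent (A : Matrix ι ι ℝ) (q : Polynomial ℝ) :
    ∃ N : Matrix ι ι (Polynomial ℝ), algebraMap (Polynomial ℝ) (RatFunc ℝ) q • resolvent A
      = const (Polynomial.aeval A q) * resolvent A
        + N.map (algebraMap (Polynomial ℝ) (RatFunc ℝ)) := by
  induction q using Polynomial.induction_on' with
  | add q r hq hr =>
    obtain ⟨N, hN⟩ := hq
    obtain ⟨N', hN'⟩ := hr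
    refine ⟨N + N', ?_⟩
    rw [map_add, add_smul, hN, hN', map_add, const_add, Matrix.add_mul,
      Matrix.map_add _ (by simp)]
    abel
  | monomial j c =>
    induction j with
    | zero =>
      refine ⟨0, ?_⟩
      have : (algebraMap (Polynomial ℝ) (RatFunc ℝ)) (Polynomial.monomial 0 c) = RatFunc.C c := by
        rw [Polynomial.monomial_zero_left, RatFunc.algebraMap_C]
      rw [this, Matrix.map_zero _ (map_zero _), add_zero, Polynomial.aeval_monomial, pow_zero,
        mul_one]
      have e : const ((algebraMap ℝ (Matrix ι ι ℝ)) c) = RatFunc.C c • 1 := by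
        ext i j
        by_cases h : i = j <;> simp [h, Matrix.algebraMap_matrix_apply]
      rw [e, Matrix.smul_mul, Matrix.one_mul]
    | succ j ih =>
      obtain ⟨N, hN⟩ := ih
      refine ⟨(Polynomial.X : Polynomial ℝ) • N
        + (Polynomial.aeval A (Polynomial.monomial j c)).map Polynomial.C, ?_⟩
      have e1 : Polynomial.monomial (j + 1) c = Polynomial.X * Polynomial.monomial j c := by
        rw [Polynomial.X_mul_monomial]
      rw [e1, map_mul, RatFunc.algebraMap_X, mul_smul, hN, smul_add, ← Matrix.mul_smul,
        X_smul_resolvent, Matrix.mul_add, Matrix.mul_one, map_mul, Polynomial.aeval_X]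
      have e2 : A * Polynomial.aeval A (Polynomial.monomial j c)
          = Polynomial.aeval A (Polynomial.monomial j c) * A := by
        have : Polynomial.aeval A (Polynomial.X * Polynomial.monomial j c)
          = Polynomial.aeval A (Polynomial.monomial j c * Polynomial.X) := by rw [mul_comm]
        rwa [map_mul, map_mul, Polynomial.aeval_X] at this
      rw [e2, const_mul, Matrix.mul_assoc, Matrix.map_add _ (by simp)]
      have e3 : ((Polynomial.aeval A (Polynomial.monomial j c)).map Polynomial.C).map
          (algebraMap (Polynomial ℝ) (RatFunc ℝ))
          = const (Polynomial.aeval A (Polynomial.monomial j c)) := by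
        ext a b
        simp only [Matrix.map_apply, const_apply, RatFunc.algebraMap_C]
      have e4 : ((Polynomial.X : Polynomial ℝ) • N).map (algebraMap (Polynomial ℝ) (RatFunc ℝ))
          = (RatFunc.X : RatFunc ℝ) • N.map (algebraMap (Polynomial ℝ) (RatFunc ℝ)) := by
        ext a b
        simp [RatFunc.algebraMap_X]
      rw [e3, e4]
      abel

lemma eq_zero_of_inftyVal_algebraMap_lt {q : Polynomial ℝ}
    (h : inftyVal (algebraMap (Polynomial ℝ) (RatFunc ℝ) q) < 1) : q = 0 := by
  classical
  by_contra hq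
  have h1 := RatFunc.inftyValuation.polynomial ℝ hq
  rw [inftyVal, RatFunc.inftyValuation_apply, h1, ← WithZero.exp_zero, WithZero.exp_lt_exp] at h
  have : (0 : ℤ) ≤ q.natDegree := Int.natCast_nonneg _
  omega

/-- The denominator of an observable transfer matrix with one input annihilates the input vector. -/
lemma IsObservable.aeval_denom_mulVec {A : Matrix ι ι ℝ} {C : Matrix (Fin 1) ι ℝ}
    (h : IsObservable A C) {v : ι → ℝ} {f : RatFunc ℝ}
    (hf : (const C * resolvent A * const (replicateCol (Fin 1) v)) 0 0 = f) :
    Polynomial.aeval A f.denom *ᵥ v = 0 := by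
  set P := Polynomial.aeval A f.denom
  obtain ⟨N, hN⟩ := exists_polynomial_resolvent A f.denom
  set a := algebraMap (Polynomial ℝ) (RatFunc ℝ)
  have hcomm : ∀ j : ℕ, P * A ^ j = A ^ j * P := by
    intro j
    have : Polynomial.aeval A (f.denom * Polynomial.X ^ j)
      = Polynomial.aeval A (Polynomial.X ^ j * f.denom) := by rw [mul_comm]
    simpa using this
  have h1 : const (C * P) * resolvent A * const (replicateCol (Fin 1) v)
      = a f.denom • (const C * resolvent A * const (replicateCol (Fin 1) v))
        - const C * N.map a * const (replicateCol (Fin 1) v) := by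
    rw [← Matrix.smul_mul, ← Matrix.mul_smul, hN, Matrix.mul_add, Matrix.add_mul, const_mul,
      Matrix.mul_assoc (const C)]
    abel
  -- The denominator times f is the numerator, so this strictly proper function is also a polynomial
  -- and must vanish. Its Markov parameters then give C A^j P v = 0 for all j, because P commutes
  -- with A.
  have h2 : ∃ q : Polynomial ℝ,
      (const (C * P) * resolvent A * const (replicateCol (Fin 1) v)) 0 0 = a q := by
    refine ⟨f.num - (C.map Polynomial.C * N
      * (replicateCol (Fin 1) v).map Polynomial.C) 0 0, ?_⟩
    rw [h1, Matrix.sub_apply, Matrix.smul_apply, hf, map_sub, smul_eq_mul]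
    congr 1
    · have hne : a f.denom ≠ 0 := by simpa [a] using f.denom_ne_zero
      conv_lhs => rw [← RatFunc.num_div_denom f]
      rw [mul_div_assoc']
      rw [RatFunc.num_div_denom, mul_div_cancel_left₀ _ hne]
    · simp only [Matrix.mul_apply, map_sum, map_mul, Matrix.map_apply, const_apply, a,
        RatFunc.algebraMap_C]
  obtain ⟨q, hq⟩ := h2
  have hq0 : q = 0 := eq_zero_of_inftyVal_algebraMap_lt (by
    rw [← hq]; exact inftyVal_realization_lt ..)
  have h3 : const (C * P) * resolvent A * const (replicateCol (Fin 1) v)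
      = const (0 : Matrix (Fin 1) ι ℝ) * resolvent A * const (replicateCol (Fin 1) v) := by
    ext i j
    rw [Subsingleton.elim i 0, Subsingleton.elim j 0, hq, hq0]
    simp
  refine h.eq_zero fun j => ?_
  have h4 := markov_eq_of_transfer_eq h3 j
  rw [Matrix.mul_assoc C, hcomm, Matrix.zero_mul, Matrix.zero_mul] at h4
  rw [mulVec_mulVec, Matrix.mul_assoc]
  ext i
  have h5 := congrFun (congrFun h4 i) 0
  simpa [Matrix.mul_apply, mulVec, dotProduct] using h5

end StateSpaceTheory
end
end L1Aug

namespace L1Aug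
noncomputable section
-- Realizations built on the control law, and the Sylvester identity.
namespace Design

variable {n k : ℕ} (d : Design n k)

/-- The response of the control law to the predictor error outside the output direction. -/
def V : Matrix (Fin k) (Fin (n + 1)) ℝ := d.ctl.B * (1 - vecMulVec d.CmDag d.Cm)

/-- The plant `Am` in feedback with the filter `C(s)`, realized on the states of the control law. -/
def AG : Matrix (Fin (n + 1) ⊕ Fin k) (Fin (n + 1) ⊕ Fin k) ℝ :=
  fromBlocks d.Am (-(replicateCol (Fin 1) d.Bm * d.ctl.C)) 0 d.ctl.A

/-- The output matrix selecting the plant state. -/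
def CG (n k : ℕ) : Matrix (Fin (n + 1)) (Fin (n + 1) ⊕ Fin k) ℝ := fromCols 1 0

/-- The input matrix of the uncertainty in the system `AG`. -/
def BG : Matrix (Fin (n + 1) ⊕ Fin k) (Fin 1) ℝ :=
  fromRows (replicateCol (Fin 1) d.Bm) (d.ctl.B * replicateCol (Fin 1) d.Bm)

/-- The initial state of the system `AG` as a function of the initial state of the plant. -/
def IG : Matrix (Fin (n + 1) ⊕ Fin k) (Fin (n + 1)) ℝ := fromRows 1 d.V

variable {d}

lemma Valid.isUnit_Am (hd : d.Valid) : IsUnit d.Am.det := by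
  by_contra h
  have := hd.dcgain
  rw [nonsing_inv_apply_not_isUnit _ h] at this
  simp at this

lemma Valid.Cm_ne_zero (hd : d.Valid) : d.Cm ≠ 0 := by
  intro h
  have := hd.dcgain
  simp [h] at this

lemma Valid.Bm_ne_zero (hd : d.Valid) : d.Bm ≠ 0 := by
  intro h
  have := hd.dcgain
  simp [h] at this

lemma Valid.Cm_CmDag (hd : d.Valid) : d.Cm ⬝ᵥ d.CmDag = 1 := by
  have : d.Cm ⬝ᵥ d.Cm ≠ 0 := fun h => hd.Cm_ne_zero (dotProduct_self_eq_zero.1 h)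
  rw [CmDag, dotProduct_smul, smul_eq_mul, inv_mul_cancel₀ this]

/-- Otherwise C_m vanishes on the controllable subspace, which is everything, against the DC gain.
This is what makes M invertible. -/
lemma Valid.exists_Cm_pow_Bm_ne_zero (hd : d.Valid) : ∃ j : ℕ, d.Cm ⬝ᵥ (d.Am ^ j *ᵥ d.Bm) ≠ 0 := by
  by_contra! h
  have h1 : dotProductBilin ℝ ℝ d.Cm = 0 := hd.controllable.linearMap_eq_zero fun j _ => by
    rw [← h j]; rfl
  exact hd.Cm_ne_zero (dotProduct_self_eq_zero.1 (LinearMap.congr_fun h1 d.Cm))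

lemma replicateCol_H0 : replicateCol (Fin 1) d.H0
    = resolvent d.Am * const (replicateCol (Fin 1) d.Bm) := by
  rw [H0, replicateCol_mulVec]; rfl

lemma replicateRow_CmRes : replicateRow (Fin 1) d.CmRes
    = const (replicateRow (Fin 1) d.Cm) * resolvent d.Am := by
  rw [CmRes, replicateRow_vecMul]; rfl

lemma of_M : (Matrix.of fun _ _ => d.M : Matrix (Fin 1) (Fin 1) (RatFunc ℝ))
    = const (replicateRow (Fin 1) d.Cm) * resolvent d.Am * const (replicateCol (Fin 1) d.Bm) := by
  rw [Matrix.mul_assoc, ← replicateCol_H0]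
  rfl

lemma Valid.M_ne_zero (hd : d.Valid) : d.M ≠ 0 := by
  intro h
  obtain ⟨j, hj⟩ := hd.exists_Cm_pow_Bm_ne_zero
  apply hj
  have h1 : const (replicateRow (Fin 1) d.Cm) * resolvent d.Am * const (replicateCol (Fin 1) d.Bm)
      = const (0 : Matrix (Fin 1) (Fin (n + 1)) ℝ) * resolvent d.Am
        * const (replicateCol (Fin 1) d.Bm) := by
    rw [← of_M, h]; ext; simp
  have h2 := congrFun (congrFun (markov_eq_of_transfer_eq h1 j) 0) 0
  rw [Matrix.zero_mul, Matrix.zero_mul, Matrix.mul_assoc, ← replicateCol_mulVec] at h2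
  exact h2

lemma Valid.replicateRow_O (hd : d.Valid) : const d.ctl.C * resolvent d.ctl.A * const d.ctl.B
    = replicateRow (Fin 1) d.O := by
  rw [← hd.ctl_transfer, StateSpace.transfer, hd.ctl_direct]; simp

lemma replicateRow_O_eq : replicateRow (Fin 1) d.O
    = (d.filt * d.M⁻¹) • (const (replicateRow (Fin 1) d.Cm) * resolvent d.Am) := by
  rw [← replicateRow_CmRes]; rfl

/-- The filter is realized on the states of the control law. -/
lemma Valid.filt_realization (hd : d.Valid) : const d.ctl.C * resolvent d.ctl.A
      * const (d.ctl.B * replicateCol (Fin 1) d.Bm) + const 0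
    = (Matrix.of fun _ _ => d.filt : Matrix (Fin 1) (Fin 1) (RatFunc ℝ)) := by
  rw [const_mul, ← Matrix.mul_assoc, hd.replicateRow_O, replicateRow_O_eq, Matrix.smul_mul, ← of_M]
  ext
  simp [mul_assoc, inv_mul_cancel₀ hd.M_ne_zero]

lemma Valid.Hin_realization (hd : d.Valid) : const d.ctl.C * resolvent d.ctl.A * const d.V + const 0
    = replicateRow (Fin 1) ((d.filt * d.M⁻¹) • d.Hin) := by
  rw [V, const_mul, ← Matrix.mul_assoc, hd.replicateRow_O, replicateRow_O_eq, const_zero, add_zero,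
    ← replicateRow_CmRes, Matrix.smul_mul, ← replicateRow_vecMul]
  rfl

lemma H0_realization : const 1 * resolvent d.Am * const (replicateCol (Fin 1) d.Bm) + const 0
    = replicateCol (Fin 1) d.H0 := by
  rw [replicateCol_H0]; simp

/-- The block-triangular inverse shows the plant response minus H₀ times the filter response. The
pair (B_m, B_o B_m) yields G, and (I, V) yields the initial-state response. -/
lemma resolvent_AG_mul {q : Type} (N₁ : Matrix (Fin (n + 1)) q ℝ) (N₂ : Matrix (Fin k) q ℝ) :
    const (CG n k) * resolvent d.AG * const (fromRows N₁ N₂)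
      = resolvent d.Am * const N₁ - replicateCol (Fin 1) d.H0
        * (const d.ctl.C * resolvent d.ctl.A * const N₂) := by
  have e1 : const (CG n k) = fromCols 1 0 := by
    ext i (j | j)
    · simp only [CG, const_apply, fromCols_apply_inl, Matrix.one_apply]; split_ifs <;> simp
    · simp [CG]
  have e2 : const (fromRows N₁ N₂) = fromRows (const N₁) (const N₂) := by
    ext (i | i) j <;> simp
  rw [AG, resolvent_fromBlocks, e1, e2, fromCols_mul_fromBlocks, fromCols_mul_fromRows,
    replicateCol_H0, const_neg, const_mul]
  simp only [Matrix.one_mul, Matrix.zero_mul, add_zero, Matrix.mul_neg, Matrix.neg_mul,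
    Matrix.mul_assoc, sub_eq_add_neg]

lemma Valid.G_realization (hd : d.Valid) : const (CG n k) * resolvent d.AG * const d.BG + const 0
    = replicateCol (Fin 1) d.G := by
  have h := hd.filt_realization
  rw [const_zero, add_zero] at h
  rw [BG, resolvent_AG_mul, h, ← replicateCol_H0]
  ext i j
  simp [G, Matrix.mul_apply]
  ring

/-- The factor s in T_in differentiates the initial-state response: it moves A_G into the output
matrix and leaves the direct term C_G I_G = I. -/
lemma Valid.Tin_realization (hd : d.Valid) : const (CG n k * d.AG) * resolvent d.AG * const d.IG + const 1
    = d.Tin := by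
  have h : const (CG n k * d.AG) * resolvent d.AG * const d.IG + const (CG n k * d.IG)
      = (RatFunc.X : RatFunc ℝ) • (const (CG n k) * resolvent d.AG * const d.IG) := by
    rw [← Matrix.smul_mul, ← Matrix.mul_smul, X_smul_resolvent, Matrix.mul_add, Matrix.add_mul,
      Matrix.mul_one, ← const_mul, ← Matrix.mul_assoc, ← const_mul,
      add_comm (const (CG n k * d.IG))]
  have e : CG n k * d.IG = 1 := by
    rw [CG, IG, fromCols_mul_fromRows]; simp
  rw [e] at h
  have h2 := hd.Hin_realization
  rw [const_zero, add_zero] at h2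
  rw [h, IG, resolvent_AG_mul, h2, Tin, H1]
  ext i j
  simp [Matrix.mul_apply, vecMulVec_apply]
  ring

/-- On the kernel of the output row the control law is insensitive to the predictor error. -/
lemma Valid.sylvester_ker (hd : d.Valid) {e : Fin (n + 1) → ℝ} (he : d.Cm ⬝ᵥ e = 0) :
    d.ctl.C *ᵥ (d.ctl.B *ᵥ e) = 0 ∧ (d.ctl.A * d.ctl.B - d.ctl.B * d.Am) *ᵥ e = 0 := by
  set E := replicateCol (Fin 1) e
  set S := (RatFunc.X : RatFunc ℝ) • (1 : Matrix (Fin (n + 1)) (Fin (n + 1)) (RatFunc ℝ))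
    - const d.Am
  have hCE : replicateRow (Fin 1) d.Cm * E = 0 := by
    ext i j; simpa [E, Matrix.mul_apply, dotProduct] using he
  -- Here O(s)(sI − A_m) = C M⁻¹ C_m kills the kernel of C_m. Expanded, its direct part is C_o B_o e
  -- and its strictly proper part has input A_o B_o e − B_o A_m e; both vanish, and observability
  -- strips the output from the second.
  have h1 : const d.ctl.C * resolvent d.ctl.A * const d.ctl.B * S * const E = 0 := by
    rw [hd.replicateRow_O, replicateRow_O_eq, Matrix.smul_mul, Matrix.smul_mul,
      Matrix.mul_assoc _ _ S, resolvent_mul, Matrix.mul_one, ← const_mul, hCE]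
    simp
  have h2 : const d.ctl.C * resolvent d.ctl.A * const d.ctl.B * S * const E
      = const d.ctl.C * resolvent d.ctl.A
          * const ((d.ctl.A * d.ctl.B - d.ctl.B * d.Am) * E) + const (d.ctl.C * (d.ctl.B * E)) := by
    have h3 : const d.ctl.C * resolvent d.ctl.A * const d.ctl.B * S
        = const d.ctl.C * ((RatFunc.X : RatFunc ℝ) • resolvent d.ctl.A) * const d.ctl.B
          - const d.ctl.C * resolvent d.ctl.A * const d.ctl.B * const d.Am := by
      simp only [S, Matrix.mul_sub, Matrix.mul_smul, Matrix.mul_one, Matrix.smul_mul]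
    rw [h3, X_smul_resolvent']
    simp only [const_mul, const_sub, Matrix.mul_add, Matrix.add_mul, Matrix.mul_sub,
      Matrix.sub_mul, Matrix.mul_assoc, Matrix.mul_one]
    abel
  have h3 : const d.ctl.C * resolvent d.ctl.A
          * const ((d.ctl.A * d.ctl.B - d.ctl.B * d.Am) * E) + const (d.ctl.C * (d.ctl.B * E))
      = const (0 : Matrix (Fin 1) (Fin k) ℝ) * resolvent d.ctl.A
          * const ((d.ctl.A * d.ctl.B - d.ctl.B * d.Am) * E) + const 0 := by
    rw [← h2, h1]; simp
  obtain ⟨h4, h5⟩ := direct_eq_of_transfer_eq h3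
  constructor
  · ext i
    have := congrFun (congrFun h4 i) 0
    simpa [E, Matrix.mul_apply, mulVec, dotProduct] using this
  · refine hd.ctl_minimal.2.eq_zero fun j => ?_
    have := markov_eq_of_transfer_eq h5 j
    rw [Matrix.zero_mul, Matrix.zero_mul] at this
    ext i
    have := congrFun (congrFun this i) 0
    rw [← replicateCol_mulVec, ← replicateCol_mulVec] at this
    exact this

lemma Valid.Cm_sub (hd : d.Valid) {e : Fin (n + 1) → ℝ} : d.Cm ⬝ᵥ (e - (d.Cm ⬝ᵥ e) • d.CmDag) = 0 := by
  rw [dotProduct_sub, dotProduct_smul, hd.Cm_CmDag]; simp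

/-- `Ao Bo - Bo Am = b Cm` for some column `b`. -/
lemma Valid.sylvester (hd : d.Valid) (e : Fin (n + 1) → ℝ) :
    d.ctl.A *ᵥ (d.ctl.B *ᵥ e) - d.ctl.B *ᵥ (d.Am *ᵥ e)
      = (d.Cm ⬝ᵥ e) • ((d.ctl.A * d.ctl.B - d.ctl.B * d.Am) *ᵥ d.CmDag) := by
  have h := (hd.sylvester_ker (hd.Cm_sub (e := e))).2
  rw [mulVec_sub, mulVec_smul, sub_eq_zero] at h
  rw [← h, sub_mulVec, mulVec_mulVec, mulVec_mulVec]

/-- This makes C_o B_o e small whenever C_m e is small, even if e is merely bounded. -/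
lemma Valid.ctl_C_B (hd : d.Valid) (e : Fin (n + 1) → ℝ) :
    d.ctl.C *ᵥ (d.ctl.B *ᵥ e) = (d.Cm ⬝ᵥ e) • (d.ctl.C *ᵥ (d.ctl.B *ᵥ d.CmDag)) := by
  have h := (hd.sylvester_ker (hd.Cm_sub (e := e))).1
  rwa [mulVec_sub, mulVec_smul, mulVec_sub, mulVec_smul, sub_eq_zero] at h

end Design
end
end L1Aug

namespace L1Aug
noncomputable section

/-! ### Internal stability of the control law. -/

section Eigenfunctional

set_option linter.unusedSectionVars false

variable {ι : Type} [Fintype ι] [DecidableEq ι]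

/-- The real-linear functional `v ↦ ∑ i, l i * v i` with complex coefficients `l`. -/
def cpair (l : ι → ℂ) : (ι → ℝ) →ₗ[ℝ] ℂ where
  toFun v := ∑ i, l i * (v i : ℂ)
  map_add' v w := by simp [mul_add, Finset.sum_add_distrib]
  map_smul' c v := by simp [Finset.mul_sum, mul_left_comm]

lemma cpair_apply (l : ι → ℂ) (v : ι → ℝ) : cpair l v = ∑ i, l i * (v i : ℂ) := rfl

lemma cpair_ne_zero {l : ι → ℂ} (hl : l ≠ 0) : cpair l ≠ 0 := by
  intro h
  apply hl
  ext i
  have := LinearMap.congr_fun h (Pi.single i 1)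
  simpa [cpair_apply, Pi.single_apply, apply_ite (fun x : ℝ => (x : ℂ))] using this

/-- Every spectral value has an eigenfunctional. -/
lemma exists_eigenfunctional {A : Matrix ι ι ℝ} {μ : ℂ}
    (hμ : μ ∈ spectrum ℂ (A.map (algebraMap ℝ ℂ))) :
    ∃ l : ι → ℂ, l ≠ 0 ∧ ∀ v, cpair l (A *ᵥ v) = μ * cpair l v := by
  rw [spectrum.mem_iff, Matrix.isUnit_iff_isUnit_det, isUnit_iff_ne_zero, not_not,
    ← Matrix.exists_vecMul_eq_zero_iff] at hμ
  obtain ⟨l, hl, h⟩ := hμ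
  refine ⟨l, hl, fun v => ?_⟩
  have h1 : l ᵥ* A.map (algebraMap ℝ ℂ) = μ • l := by
    rw [vecMul_sub, sub_eq_zero, Algebra.algebraMap_eq_smul_one, vecMul_smul, vecMul_one] at h
    exact h.symm
  have h2 : ∀ v : ι → ℝ, cpair l v = l ⬝ᵥ fun i => (v i : ℂ) := fun v => rfl
  have h3 : (fun i => (((A *ᵥ v) i : ℝ) : ℂ)) = A.map (algebraMap ℝ ℂ) *ᵥ fun i => (v i : ℂ) := by
    ext i; simp [mulVec, dotProduct]
  rw [h2, h3, dotProduct_mulVec, h1, smul_dotProduct, smul_eq_mul, h2]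

variable {A : Matrix ι ι ℝ} {μ : ℂ} {f : (ι → ℝ) →ₗ[ℝ] ℂ}

lemma eigenfunctional_pow (hf : ∀ v, f (A *ᵥ v) = μ * f v) (j : ℕ) (v : ι → ℝ) :
    f (A ^ j *ᵥ v) = μ ^ j * f v := by
  induction j with
  | zero => simp
  | succ j ih => rw [pow_succ', ← mulVec_mulVec, hf, ih, pow_succ']; ring

lemma eigenfunctional_aeval (hf : ∀ v, f (A *ᵥ v) = μ * f v) (q : Polynomial ℝ) (v : ι → ℝ) :
    f (Polynomial.aeval A q *ᵥ v) = Polynomial.aeval μ q * f v := by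
  induction q using Polynomial.induction_on' with
  | add q r hq hr => rw [map_add, add_mulVec, map_add, hq, hr, map_add, add_mul]
  | monomial j c =>
    rw [Polynomial.aeval_monomial, Polynomial.aeval_monomial, Algebra.algebraMap_eq_smul_one,
      smul_mul_assoc, one_mul, smul_mulVec, map_smul, eigenfunctional_pow hf, Complex.real_smul]
    simp [mul_assoc]

lemma eigenfunctional_expM (hf : ∀ v, f (A *ᵥ v) = μ * f v) (v : ι → ℝ) (t : ℝ) :
    f (expM A t *ᵥ v) = Complex.exp (μ * t) * f v := by
  have hd : ∀ s : ℝ, HasDerivAt (fun s : ℝ => Complex.exp (-μ * s) * f (expM A s *ᵥ v)) 0 s := by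
    intro s
    have h1 : HasDerivAt (fun s : ℝ => Complex.exp (-μ * s)) (Complex.exp (-μ * s) * (-μ)) s := by
      have := ((hasDerivAt_id (s : ℂ)).const_mul (-μ)).cexp
      simpa using this.comp_ofReal
    refine (h1.mul (HasDerivAt.linearMap f (hasDerivAt_expM_mulVec A v s))).congr_deriv ?_
    rw [hf]; ring
  have h := is_const_of_deriv_eq_zero (fun s => (hd s).differentiableAt) (fun s => (hd s).deriv) t 0
  simp only [expM_zero, one_mulVec, Complex.ofReal_zero, mul_zero, Complex.exp_zero, one_mul] at h
  rw [← h, ← mul_assoc, ← Complex.exp_add]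
  simp

end Eigenfunctional

namespace Design

variable {n k : ℕ} {d : Design n k}

/-- The output matrix selecting the controller state. -/
def LG (n k : ℕ) : Matrix (Fin k) (Fin (n + 1) ⊕ Fin k) ℝ := fromCols 0 1

lemma CG_mul_AG : CG n k * d.AG = d.Am * CG n k
    - replicateCol (Fin 1) d.Bm * d.ctl.C * LG n k := by
  rw [CG, LG, AG, fromCols_mul_fromBlocks, mul_fromCols, mul_fromCols]
  ext i (j | j) <;> simp

lemma lower_mul_AG : LG n k * d.AG
    = d.ctl.A * LG n k := by
  rw [LG, AG, fromCols_mul_fromBlocks, mul_fromCols]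
  simp

/-- The controller modes excited by the initial state are integrable. -/
lemma Valid.integrableOn_expM_mul_V (hd : d.Valid) {c : ℝ} (h : HasL1Norm d.Tin c)
    (r : Fin k → ℝ) (j : Fin (n + 1)) :
    IntegrableOn (fun t => r ⬝ᵥ ((expM d.ctl.A t * (d.ctl.A * d.V)).col j)) (Set.Ioi 0) := by
  obtain ⟨D, g, hg, hint, -⟩ := h
  obtain ⟨-, hg'⟩ := hg.eq_realization hd.Tin_realization
  have h1 : ∀ i j, IntegrableOn (fun t => (CG n k * d.AG * expM d.AG t * d.IG) i j)
      (Set.Ioi 0) := by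
    intro i j
    simpa only [hg', expM] using hint i j
  have h2 := integrableOn_realization_mul h1
  -- Because C_G A_G = A_m C_G − B_m C_o L_G, the controller output is read off from the impulse
  -- response of T_in and its derivative, both integrable. A nonzero entry of B_m then isolates it.
  have h3 : ∀ t, replicateCol (Fin 1) d.Bm * (d.ctl.C * d.ctl.A * expM d.ctl.A t * d.V)
      = d.Am * (CG n k * d.AG * expM d.AG t * d.IG)
        - CG n k * d.AG * d.AG * expM d.AG t * d.IG := by
    intro t
    have e : LG n k * d.IG = d.V := by
      rw [LG, IG, fromCols_mul_fromRows]; simp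
    have e2 := expM_intertwine (lower_mul_AG (d := d)) t
    have e3 : d.ctl.C * d.ctl.A * expM d.ctl.A t * d.V
        = d.ctl.C * (LG n k * d.AG * expM d.AG t * d.IG) := by
      rw [lower_mul_AG, Matrix.mul_assoc d.ctl.A, e2, Matrix.mul_assoc d.ctl.A, Matrix.mul_assoc
        (expM _ _), e]
      simp only [Matrix.mul_assoc]
    rw [e3]
    conv_rhs => rw [CG_mul_AG]
    have e4 : d.Am * ((d.Am * CG n k - replicateCol (Fin 1) d.Bm * d.ctl.C
        * LG n k) * expM d.AG t * d.IG)
        = d.Am * (CG n k * d.AG * expM d.AG t * d.IG) := by rw [CG_mul_AG]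
    rw [e4]
    simp only [Matrix.sub_mul, Matrix.mul_assoc]
    abel
  obtain ⟨i, hi⟩ := Function.ne_iff.1 hd.Bm_ne_zero
  have h4 : ∀ (a : Fin 1) j, IntegrableOn
      (fun t => (d.ctl.C * d.ctl.A * expM d.ctl.A t * d.V) a j) (Set.Ioi 0) := by
    intro a j
    have h5 : IntegrableOn (fun t => (d.Bm i)⁻¹ * ((∑ x, d.Am i x *
        (CG n k * d.AG * expM d.AG t * d.IG) x j)
          - (CG n k * d.AG * d.AG * expM d.AG t * d.IG) i j)) (Set.Ioi 0) :=
      ((integrable_finsetSum _ fun x _ => (h1 x j).const_mul _).sub (h2 i j)).const_mul _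
    refine h5.congr (Eventually.of_forall fun t => ?_)
    have h6 := congrFun (congrFun (h3 t) i) j
    rw [Matrix.sub_apply, Matrix.mul_apply (M := d.Am)] at h6
    simp only
    rw [← h6, Subsingleton.elim a 0]
    simp [Matrix.mul_apply (M := replicateCol (Fin 1) d.Bm)]
    rw [inv_mul_cancel_left₀ hi]
  -- Further differentiation gives C_o A_o^{l+1} e^{tA_o} V for every l, and observability recovers
  -- all rows of e^{tA_o} A_o V.
  have h5 : ∀ (l : ℕ) (a : Fin 1) j, IntegrableOn
      (fun t => (d.ctl.C * d.ctl.A * d.ctl.A ^ l * expM d.ctl.A t * d.V) a j) (Set.Ioi 0) := by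
    intro l
    induction l with
    | zero => simpa using h4
    | succ l ih =>
      intro a j
      have := integrableOn_realization_mul ih a j
      simpa only [pow_succ, Matrix.mul_assoc] using this
  let W : Submodule ℝ (Fin k → ℝ) :=
    { carrier := {r | IntegrableOn
        (fun t => r ⬝ᵥ ((expM d.ctl.A t * (d.ctl.A * d.V)).col j)) (Set.Ioi 0)}
      zero_mem' := by simp
      add_mem' := by
        intro X Y hX hY
        refine (Integrable.add hX hY).congr (Eventually.of_forall fun t => ?_)
        simp [add_dotProduct]
      smul_mem' := by
        intro c X hX
        refine (Integrable.const_mul hX c).congr (Eventually.of_forall fun t => ?_)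
        simp }
  have hW : W = ⊤ := hd.ctl_minimal.2.eq_top fun l a => by
    refine (h5 l a j).congr (Eventually.of_forall fun t => ?_)
    have e : d.ctl.C * d.ctl.A * d.ctl.A ^ l * expM d.ctl.A t * d.V
        = (d.ctl.C * d.ctl.A ^ l) * (expM d.ctl.A t * (d.ctl.A * d.V)) := by
      rw [← Matrix.mul_assoc (expM _ _), ← commute_expM, Matrix.mul_assoc d.ctl.C,
        (Commute.refl d.ctl.A).pow_right l |>.eq]
      simp only [Matrix.mul_assoc]
    simp only [e]
    rfl
  have : r ∈ W := hW ▸ Submodule.mem_top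
  exact this

/-- The control law is internally stable. -/
lemma Valid.isHurwitz_ctl (hd : d.Valid) {c : ℝ} (h : HasL1Norm d.Tin c) :
    IsHurwitz d.ctl.A := by
  intro μ hμ
  by_contra! hre
  obtain ⟨l, hl, heig⟩ := exists_eigenfunctional hμ
  set f := cpair l
  have hf0 : f ≠ 0 := cpair_ne_zero hl
  -- Controllability makes φ nonzero. The Sylvester identity turns the eigenvalue relation for A_o
  -- into φ(A_m v) = μ φ(v) − (C_m v) β.
  set φ : (Fin (n + 1) → ℝ) →ₗ[ℝ] ℂ := f.comp (Matrix.mulVecLin d.ctl.B) with hφ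
  have hφ0 : φ ≠ 0 := by
    intro h0
    refine hf0 (hd.ctl_minimal.1.linearMap_eq_zero fun j i => ?_)
    have e : (d.ctl.A ^ j * d.ctl.B).col i = d.ctl.A ^ j *ᵥ (d.ctl.B *ᵥ Pi.single i 1) := by
      rw [mulVec_mulVec, mulVec_single_one]
    rw [e, eigenfunctional_pow heig]
    have := LinearMap.congr_fun h0 (Pi.single i 1)
    simp only [hφ, LinearMap.comp_apply, mulVecLin_apply, LinearMap.zero_apply] at this
    rw [this, mul_zero]
  set β := f ((d.ctl.A * d.ctl.B - d.ctl.B * d.Am) *ᵥ d.CmDag)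
  have hsyl : ∀ v, φ (d.Am *ᵥ v) = μ * φ v - (d.Cm ⬝ᵥ v : ℝ) * β := by
    intro v
    have := congrArg f (hd.sylvester v)
    rw [map_sub, heig, map_smul, Complex.real_smul] at this
    simp only [hφ, LinearMap.comp_apply, mulVecLin_apply]
    linear_combination -this
  -- The denominator of C(s), evaluated at A_o, annihilates B_o B_m; stability of C(s) says it does
  -- not vanish at μ.
  have hBm : φ d.Bm = 0 := by
    have h1 := hd.filt_realization
    rw [const_zero, add_zero, ← replicateCol_mulVec] at h1
    have h2 := hd.ctl_minimal.2.aeval_denom_mulVec (congrFun (congrFun h1 0) 0)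
    have h3 := eigenfunctional_aeval heig d.filt.denom (d.ctl.B *ᵥ d.Bm)
    rw [Matrix.of_apply] at h2
    rw [h2, map_zero] at h3
    refine (mul_eq_zero.1 h3.symm).resolve_left fun h4 => ?_
    exact absurd (hd.filt_stable μ h4) (not_lt.2 hre)
  have hV : ∀ j, μ * f (d.V *ᵥ Pi.single j 1) = 0 := by
    intro j
    have e : ∀ t, (expM d.ctl.A t * (d.ctl.A * d.V)).col j
        = expM d.ctl.A t *ᵥ (d.ctl.A *ᵥ (d.V *ᵥ Pi.single j 1)) := by
      intro t
      rw [mulVec_mulVec, mulVec_mulVec, mulVec_single_one, Matrix.mul_assoc]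
    refine eq_zero_of_integrableOn_exp hre ?_
    have h1 : IntegrableOn (fun t => f ((expM d.ctl.A t * (d.ctl.A * d.V)).col j))
        (Set.Ioi 0) := by
      simp only [f, cpair_apply]
      refine integrable_finsetSum _ fun i _ => Integrable.const_mul ?_ _
      have := hd.integrableOn_expM_mul_V h (Pi.single i 1) j
      simp only [single_one_dotProduct] at this
      exact this.ofReal
    refine h1.congr (Eventually.of_forall fun t => ?_)
    simp only
    rw [e, eigenfunctional_expM heig, heig]
  have hCB : d.Am *ᵥ (d.Am⁻¹ *ᵥ d.Bm) = d.Bm := by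
    rw [mulVec_mulVec, mul_nonsing_inv _ hd.isUnit_Am, one_mulVec]
  -- The factor s in T_in hides a mode at zero, so integrability says nothing there. Evaluating at
  -- A_m⁻¹ B_m, the unit DC gain gives β = 0; then φ ∘ A_m = 0 with A_m invertible.
  by_cases hμ0 : μ = 0
  · have h1 := hsyl (d.Am⁻¹ *ᵥ d.Bm)
    have hdc : d.Cm ⬝ᵥ (d.Am⁻¹ *ᵥ d.Bm) = -1 := by linarith [hd.dcgain]
    rw [hCB, hBm, hμ0, hdc] at h1
    have hβ : β = 0 := by
      push_cast at h1
      linear_combination -h1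
    apply hφ0
    refine LinearMap.ext fun v => ?_
    have h2 := hsyl (d.Am⁻¹ *ᵥ v)
    rw [mulVec_mulVec, mul_nonsing_inv _ hd.isUnit_Am, one_mulVec, hμ0, hβ] at h2
    rw [h2]; simp
  -- Now φ factors through C_m, so C_m is a left eigenvector of A_m and C_m B_m = 0. All Markov
  -- parameters of M would vanish.
  · have h1 : ∀ v, f (d.V *ᵥ v) = 0 := by
      have : f.comp (Matrix.mulVecLin d.V) = 0 := LinearMap.pi_ext' fun j => by
        refine LinearMap.ext_ring ?_
        have := (mul_eq_zero.1 (hV j)).resolve_left hμ0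
        simpa using this
      intro v
      exact LinearMap.congr_fun this v
    have h2 : ∀ v, φ v = (d.Cm ⬝ᵥ v : ℝ) * φ d.CmDag := by
      intro v
      have := h1 v
      rw [V, ← mulVec_mulVec, sub_mulVec, one_mulVec, vecMulVec_mulVec, mulVec_sub, map_sub,
        sub_eq_zero] at this
      simp only [hφ, LinearMap.comp_apply, mulVecLin_apply]
      rw [this, op_smul_eq_smul, mulVec_smul, map_smul, Complex.real_smul]
    have hlam : φ d.CmDag ≠ 0 := fun h0 => hφ0 (LinearMap.ext fun v => by rw [h2, h0]; simp)
    have h3 : ∀ v, ((d.Cm ⬝ᵥ (d.Am *ᵥ v) : ℝ) : ℂ)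
        = (μ - β / φ d.CmDag) * (d.Cm ⬝ᵥ v : ℝ) := by
      intro v
      have := hsyl v
      rw [h2, h2 v] at this
      field_simp
      linear_combination this
    obtain ⟨j, hj⟩ := hd.exists_Cm_pow_Bm_ne_zero
    have h4 : ∀ j : ℕ, ((d.Cm ⬝ᵥ (d.Am ^ j *ᵥ d.Bm) : ℝ) : ℂ) = 0 := by
      intro j
      induction j with
      | zero =>
        have := h2 d.Bm
        rw [hBm] at this
        rw [pow_zero, one_mulVec]
        exact (mul_eq_zero.1 this.symm).resolve_right hlam
      | succ j ih => rw [pow_succ', ← mulVec_mulVec, h3, ih, mul_zero]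
    exact hj (by exact_mod_cast h4 j)

end Design
end
end L1Aug

namespace L1Aug
noncomputable section

/-! ### Variation of constants for Carathéodory solutions. -/

section VariationOfConstants

set_option linter.unusedSectionVars false

variable {ι κ : Type} [Fintype ι] [Fintype κ]

lemma intervalIntegrable_pi {f : ℝ → ι → ℝ} {a b : ℝ}
    (h : ∀ i, IntervalIntegrable (fun t => f t i) volume a b) : IntervalIntegrable f volume a b :=
  ⟨Integrable.of_eval fun i => (h i).1, Integrable.of_eval fun i => (h i).2⟩

lemma _root_.IntervalIntegrable.pi_apply {f : ℝ → ι → ℝ} {a b : ℝ}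
    (h : IntervalIntegrable f volume a b) (i : ι) :
    IntervalIntegrable (fun t => f t i) volume a b :=
  ⟨Integrable.eval h.1 i, Integrable.eval h.2 i⟩

lemma intervalIntegral_apply {f : ℝ → ι → ℝ} {a b : ℝ}
    (h : IntervalIntegrable f volume a b) (i : ι) :
    (∫ t in a..b, f t) i = ∫ t in a..b, f t i :=
  ((ContinuousLinearMap.proj (R := ℝ) (φ := fun _ : ι => ℝ) i).intervalIntegral_comp_comm h).symm

lemma intervalIntegrable_mulVec {Φ : ℝ → Matrix κ ι ℝ} {f : ℝ → ι → ℝ} {a b : ℝ}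
    (hΦ : ∀ i j, Continuous fun t => Φ t i j) (h : IntervalIntegrable f volume a b) :
    IntervalIntegrable (fun t => Φ t *ᵥ f t) volume a b := by
  refine intervalIntegrable_pi fun i => ?_
  simp only [mulVec, dotProduct]
  have := IntervalIntegrable.sum Finset.univ (f := fun j t => Φ t i j * f t j) (μ := volume)
    (a := a) (b := b)
    (fun j _ => (h.pi_apply j).continuousOn_mul (hΦ i j).continuousOn)
  simpa only [Finset.sum_fn] using this

lemma mulVec_intervalIntegral (M : Matrix κ ι ℝ) {f : ℝ → ι → ℝ} {a b : ℝ}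
    (h : IntervalIntegrable f volume a b) :
    M *ᵥ (∫ t in a..b, f t) = ∫ t in a..b, M *ᵥ f t :=
  ((LinearMap.toContinuousLinearMap (Matrix.mulVecLin M)).intervalIntegral_comp_comm h).symm

/-- The input is only integrable, so q is differentiable merely almost everywhere; integration by
parts is used in its absolutely continuous form. -/
lemma integral_deriv_mul_primitive {Φ Φ' q φ : ℝ → ℝ} {q0 T : ℝ} (hT : 0 ≤ T)
    (hΦ : ∀ t, HasDerivAt Φ (Φ' t) t) (hΦ' : Continuous Φ')
    (hφ : IntervalIntegrable φ volume 0 T)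
    (hq : ∀ t ∈ Set.Icc 0 T, q t = q0 + ∫ s in (0 : ℝ)..t, φ s) :
    Φ T * q T = Φ 0 * q0 + ∫ s in (0 : ℝ)..T, (Φ' s * q s + Φ s * φ s) := by
  have hdΦ : deriv Φ = Φ' := funext fun t => (hΦ t).deriv
  have hC : ContDiff ℝ 1 Φ := contDiff_one_iff_deriv.2
    ⟨fun t => (hΦ t).differentiableAt, hdΦ ▸ hΦ'⟩
  set Q : ℝ → ℝ := fun t => ∫ s in (0 : ℝ)..t, φ s
  have hAC : AbsolutelyContinuousOnInterval Q 0 T :=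
    hφ.absolutelyContinuousOnInterval_intervalIntegral (Set.left_mem_uIcc)
  have h1 := AbsolutelyContinuousOnInterval.integral_deriv_mul_eq_sub
    (hC.contDiffOn.absolutelyContinuousOnInterval (a := 0) (b := T)) hAC
  have hΦc : Continuous Φ := hC.continuous
  have h2 : ∫ x in (0 : ℝ)..T, deriv Φ x * Q x + Φ x * deriv Q x
      = ∫ x in (0 : ℝ)..T, (Φ' x * Q x + Φ x * φ x) := by
    refine intervalIntegral.integral_congr_ae ?_
    filter_upwards [hφ.ae_hasDerivAt_integral] with x hx hx'
    have := (hx (Set.uIoc_subset_uIcc hx') 0 Set.left_mem_uIcc).deriv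
    rw [hdΦ]
    simp only [Q] at this ⊢
    rw [this]
  have h3 : ∫ x in (0 : ℝ)..T, (Φ' x * q x + Φ x * φ x)
      = (∫ x in (0 : ℝ)..T, (Φ' x * Q x + Φ x * φ x)) + ∫ x in (0 : ℝ)..T, Φ' x * q0 := by
    rw [← intervalIntegral.integral_add]
    · refine intervalIntegral.integral_congr fun x hx => ?_
      rw [Set.uIcc_of_le hT] at hx
      simp only [hq x hx, Q]
      ring
    · exact ((hΦ'.continuousOn.mul hAC.continuousOn).intervalIntegrable).add
        (hφ.continuousOn_mul hΦc.continuousOn)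
    · exact (hΦ'.mul continuous_const).intervalIntegrable _ _
  have h4 : ∫ x in (0 : ℝ)..T, Φ' x * q0 = (Φ T - Φ 0) * q0 := by
    rw [intervalIntegral.integral_mul_const,
      intervalIntegral.integral_eq_sub_of_hasDerivAt (fun x _ => hΦ x)
      (hΦ'.intervalIntegrable _ _)]
  rw [h2] at h1
  rw [h3, h1, h4, hq T ⟨hT, le_rfl⟩]
  simp only [Q, intervalIntegral.integral_same]
  ring

/-- The product rule for a smooth matrix and an absolutely continuous vector. -/
lemma mulVec_primitive {Φ Φ' : ℝ → Matrix κ ι ℝ} {q φ : ℝ → ι → ℝ} {q0 : ι → ℝ} {T : ℝ}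
    (hT : 0 ≤ T) (hΦ : ∀ i j t, HasDerivAt (fun s => Φ s i j) (Φ' t i j) t)
    (hΦ' : ∀ i j, Continuous fun t => Φ' t i j) (hφ : IntervalIntegrable φ volume 0 T)
    (hq : ∀ t ∈ Set.Icc 0 T, q t = q0 + ∫ s in (0 : ℝ)..t, φ s) :
    Φ T *ᵥ q T = Φ 0 *ᵥ q0 + ∫ s in (0 : ℝ)..T, (Φ' s *ᵥ q s + Φ s *ᵥ φ s) := by
  have hΦc : ∀ i j, Continuous fun t => Φ t i j := fun i j =>
    continuous_iff_continuousAt.2 fun t => (hΦ i j t).continuousAt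
  have hqi : ∀ i, ∀ t ∈ Set.Icc 0 T, q t i = q0 i + ∫ s in (0 : ℝ)..t, φ s i := by
    intro i t ht
    have hsub : IntervalIntegrable φ volume 0 t := hφ.mono_set (by
      rw [Set.uIcc_of_le hT, Set.uIcc_of_le ht.1]; exact Set.Icc_subset_Icc_right ht.2)
    rw [← intervalIntegral_apply hsub, ← Pi.add_apply, ← hq t ht]
  have hqc : ContinuousOn q (Set.uIcc 0 T) := by
    rw [Set.uIcc_of_le hT]
    refine ContinuousOn.congr (continuousOn_const.add ?_) hq
    have := intervalIntegral.continuousOn_primitive_interval' hφ Set.left_mem_uIcc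
    rwa [Set.uIcc_of_le hT] at this
  have hint : ∀ i j, IntervalIntegrable (fun s => Φ' s i j * q s j + Φ s i j * φ s j)
      volume 0 T := fun i j =>
    (((hΦ' i j).continuousOn.mul ((continuous_apply j).comp_continuousOn hqc)).intervalIntegrable).add
      ((hφ.pi_apply j).continuousOn_mul (hΦc i j).continuousOn)
  have e : ∀ s i, (Φ' s *ᵥ q s + Φ s *ᵥ φ s) i
      = ∑ j, (Φ' s i j * q s j + Φ s i j * φ s j) := by
    intro s i
    simp [mulVec, dotProduct, Finset.sum_add_distrib]
  have hvec : IntervalIntegrable (fun s => Φ' s *ᵥ q s + Φ s *ᵥ φ s) volume 0 T := by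
    refine intervalIntegrable_pi fun i => ?_
    simp only [e]
    have := IntervalIntegrable.sum Finset.univ (fun j _ => hint i j)
    simpa only [Finset.sum_fn] using this
  ext i
  rw [Pi.add_apply, intervalIntegral_apply hvec]
  simp only [e]
  rw [intervalIntegral.integral_finsetSum fun j _ => hint i j]
  simp only [mulVec, dotProduct]
  rw [← Finset.sum_add_distrib]
  exact Finset.sum_congr rfl fun j _ =>
    integral_deriv_mul_primitive hT (hΦ i j) (hΦ' i j) (hφ.pi_apply j) (hqi j)

variable [DecidableEq ι]

attribute [local instance] Matrix.linftyOpNormedAddCommGroup Matrix.linftyOpNormedSpace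
  Matrix.linftyOpNormedRing Matrix.linftyOpNormedAlgebra in
lemma hasDerivAt_expM_apply (A : Matrix ι ι ℝ) (i j : ι) (t : ℝ) :
    HasDerivAt (fun s => expM A s i j) ((A * expM A t) i j) t :=
  hasDerivAt_pi.1 (hasDerivAt_pi.1 (hasDerivAt_expM A t) i) j

lemma continuous_mul_expM_apply (A : Matrix ι ι ℝ) (C : Matrix κ ι ℝ) (i : κ) (j : ι) :
    Continuous fun t => (C * expM A t) i j := by
  simp only [Matrix.mul_apply]
  exact continuous_finsetSum _ fun x _ => (continuous_expM_apply A x j).const_mul _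

/-- `y` solves `y' = A y + f`, `y 0 = y0`, on `[0, T]`. -/
def SolvesLinear (A : Matrix ι ι ℝ) (f : ℝ → ι → ℝ) (y0 : ι → ℝ) (T : ℝ) (y : ℝ → ι → ℝ) : Prop :=
  ContinuousOn y (Set.Icc 0 T) ∧
    ∀ t ∈ Set.Icc 0 T, y t = y0 + ∫ s in (0 : ℝ)..t, (A *ᵥ y s + f s)

lemma SolvesLinear.mono {A : Matrix ι ι ℝ} {f : ℝ → ι → ℝ} {y0 : ι → ℝ} {T T' : ℝ} {y : ℝ → ι → ℝ}
    (h : SolvesLinear A f y0 T y) (hT : T' ≤ T) : SolvesLinear A f y0 T' y :=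
  ⟨h.1.mono (Set.Icc_subset_Icc_right hT), fun t ht => h.2 t ⟨ht.1, ht.2.trans hT⟩⟩

lemma _root_.IntervalIntegrable.restrict_right {E : Type*} [NormedAddCommGroup E] {f : ℝ → E}
    {T t : ℝ} (h : IntervalIntegrable f volume 0 T) (ht : t ∈ Set.Icc 0 T) :
    IntervalIntegrable f volume 0 t :=
  h.mono_set (by
    rw [Set.uIcc_of_le (ht.1.trans ht.2), Set.uIcc_of_le ht.1]
    exact Set.Icc_subset_Icc_right ht.2)

/-- Variation of constants. -/
lemma SolvesLinear.eq_convolution {A : Matrix ι ι ℝ} {f : ℝ → ι → ℝ} {y0 : ι → ℝ} {T : ℝ}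
    {y : ℝ → ι → ℝ} (h : SolvesLinear A f y0 T y) (hf : IntervalIntegrable f volume 0 T)
    {t : ℝ} (ht : t ∈ Set.Icc 0 T) :
    y t = expM A t *ᵥ y0 + ∫ s in (0 : ℝ)..t, expM A (t - s) *ᵥ f s := by
  have hft := hf.restrict_right ht
  have hy : ContinuousOn y (Set.uIcc 0 t) := by
    rw [Set.uIcc_of_le ht.1]; exact h.1.mono (Set.Icc_subset_Icc_right ht.2)
  have hφ : IntervalIntegrable (fun s => A *ᵥ y s + f s) volume 0 t :=
    (((LinearMap.toContinuousLinearMap (Matrix.mulVecLin A)).continuous.comp_continuousOn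
      hy).intervalIntegrable).add hft
  -- With Φ(s) = e^{(t−s)A} the two terms in A y cancel under the integral and only e^{(t−s)A} f(s)
  -- remains.
  have key := mulVec_primitive (Φ := fun s => expM A (t - s))
    (Φ' := fun s => -(A * expM A (t - s))) ht.1 ?_ ?_ hφ
    (fun s hs => h.2 s ⟨hs.1, hs.2.trans ht.2⟩)
  · simp only [sub_self, expM_zero, one_mulVec, sub_zero] at key
    rw [key]
    congr 1
    refine intervalIntegral.integral_congr fun s _ => ?_
    simp only [mulVec_add, neg_mulVec, mulVec_mulVec, commute_expM]
    abel
  · intro i j s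
    have := (hasDerivAt_expM_apply A i j (t - s)).comp s ((hasDerivAt_id s).const_sub t)
    refine this.congr_deriv ?_
    simp
  · intro i j
    exact ((continuous_mul_expM_apply A A i j).comp (continuous_const.sub continuous_id)).neg

/-- The converse of the variation of constants formula. -/
lemma solvesLinear_convolution (A : Matrix ι ι ℝ) {f : ℝ → ι → ℝ} (y0 : ι → ℝ) {T : ℝ} (hT : 0 ≤ T)
    (hf : IntervalIntegrable f volume 0 T) :
    SolvesLinear A f y0 T
      (fun t => expM A t *ᵥ y0 + ∫ s in (0 : ℝ)..t, expM A (t - s) *ᵥ f s) := by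
  set φ : ℝ → ι → ℝ := fun s => expM A (-s) *ᵥ f s
  have hφ : IntervalIntegrable φ volume 0 T := intervalIntegrable_mulVec
    (fun i j => (continuous_expM_apply A i j).comp continuous_neg) hf
  set q : ℝ → ι → ℝ := fun t => y0 + ∫ s in (0 : ℝ)..t, φ s
  set y : ℝ → ι → ℝ := fun t => expM A t *ᵥ y0 + ∫ s in (0 : ℝ)..t, expM A (t - s) *ᵥ f s
  have hyq : ∀ t ∈ Set.Icc 0 T, y t = expM A t *ᵥ q t := by
    intro t ht
    simp only [y, q, mulVec_add]
    rw [mulVec_intervalIntegral _ (hφ.restrict_right ht)]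
    congr 1
    refine intervalIntegral.integral_congr fun s _ => ?_
    simp only [φ, mulVec_mulVec, ← expM_add, sub_eq_add_neg]
  have hqc : ContinuousOn q (Set.Icc 0 T) := by
    have := intervalIntegral.continuousOn_primitive_interval' hφ Set.left_mem_uIcc
    rw [Set.uIcc_of_le hT] at this
    exact continuousOn_const.add this
  refine ⟨?_, fun t ht => ?_⟩
  · refine ContinuousOn.congr ?_ hyq
    refine continuousOn_pi.2 fun i => ?_
    simp only [mulVec, dotProduct]
    exact continuousOn_finsetSum _ fun j _ => (continuous_expM_apply A i j).continuousOn.mul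
      ((continuous_apply j).comp_continuousOn hqc)
  · have key := mulVec_primitive (Φ := fun s => expM A s) (Φ' := fun s => A * expM A s) ht.1
      (fun i j s => hasDerivAt_expM_apply A i j s) (fun i j => continuous_mul_expM_apply A A i j)
      (hφ.restrict_right ht) (q := q) (fun s _ => rfl)
    rw [hyq t ht, key, expM_zero, one_mulVec]
    congr 1
    refine intervalIntegral.integral_congr fun s hs => ?_
    rw [Set.uIcc_of_le ht.1] at hs
    simp only [hyq s ⟨hs.1, hs.2.trans ht.2⟩, mulVec_mulVec, φ, expM_mul_neg, one_mulVec]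

end VariationOfConstants
end
end L1Aug

namespace L1Aug
noncomputable section

/-! ### Taylor bounds and perturbed sampled flows. -/

section ExponentialBounds

set_option linter.unusedSectionVars false

attribute [local instance] Matrix.linftyOpNormedAddCommGroup Matrix.linftyOpNormedSpace
  Matrix.linftyOpNormedRing Matrix.linftyOpNormedAlgebra

variable {ι κ : Type} [Fintype ι] [DecidableEq ι] [Fintype κ] [DecidableEq κ]

lemma expM_neg_matrix (A : Matrix ι ι ℝ) (t : ℝ) : expM (-A) t = expM A (-t) := by
  simp [expM]

/-- Taylor bounds for the flow on the unit interval. -/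
lemma exists_expM_bounds (A : Matrix ι ι ℝ) : ∃ c ≥ 0, ∀ t ∈ Set.Icc (0 : ℝ) 1,
    ‖expM A t‖ ≤ c ∧ ‖expM A t - 1‖ ≤ c * t ∧ ‖expM A t - 1 - t • A‖ ≤ c * t ^ 2 := by
  obtain ⟨b, hb⟩ := isCompact_Icc.exists_bound_of_continuousOn (s := Set.Icc (0 : ℝ) 1)
    (continuous_expM A).continuousOn
  have hb0 : 0 ≤ b := (norm_nonneg _).trans (hb 0 ⟨le_rfl, zero_le_one⟩)
  have h1 : ∀ t ∈ Set.Icc (0 : ℝ) 1, ‖expM A t - 1‖ ≤ ‖A‖ * b * t := by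
    intro t ht
    have := norm_image_sub_le_of_norm_deriv_right_le_segment (f := expM A) (a := 0) (b := 1)
      (f' := fun s => A * expM A s) (C := ‖A‖ * b) (continuous_expM A).continuousOn
      (fun s _ => (hasDerivAt_expM A s).hasDerivWithinAt)
      (fun s hs => (norm_mul_le _ _).trans (mul_le_mul_of_nonneg_left
        (hb s ⟨hs.1, hs.2.le⟩) (norm_nonneg _))) t ht
    simpa using this
  have h2 : ∀ t ∈ Set.Icc (0 : ℝ) 1, ‖expM A t - 1 - t • A‖ ≤ ‖A‖ * (‖A‖ * b) * t ^ 2 := by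
    intro t ht
    have hder : ∀ s : ℝ, HasDerivAt (fun s => expM A s - 1 - s • A) (A * (expM A s - 1)) s := by
      intro s
      have := ((hasDerivAt_expM A s).sub_const 1).sub ((hasDerivAt_id s).smul_const A)
      refine this.congr_deriv ?_
      rw [one_smul, mul_sub, mul_one]
    have := norm_image_sub_le_of_norm_deriv_right_le_segment
      (f := fun s => expM A s - 1 - s • A) (a := 0) (b := t)
      (f' := fun s => A * (expM A s - 1)) (C := ‖A‖ * (‖A‖ * b * t))
      (fun s _ => (hder s).continuousAt.continuousWithinAt)
      (fun s _ => (hder s).hasDerivWithinAt)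
      (fun s hs => (norm_mul_le _ _).trans (mul_le_mul_of_nonneg_left
        ((h1 s ⟨hs.1, hs.2.le.trans ht.2⟩).trans
          (mul_le_mul_of_nonneg_left hs.2.le (by positivity))) (norm_nonneg _)))
      t ⟨ht.1, le_rfl⟩
    simp only [expM_zero, sub_self, zero_smul, sub_zero] at this
    refine this.trans (le_of_eq ?_)
    ring
  refine ⟨max b (max (‖A‖ * b) (‖A‖ * (‖A‖ * b))), hb0.trans (le_max_left _ _), fun t ht =>
    ⟨(hb t ht).trans (le_max_left _ _), (h1 t ht).trans ?_, (h2 t ht).trans ?_⟩⟩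
  · exact mul_le_mul_of_nonneg_right ((le_max_left _ _).trans (le_max_right _ _)) ht.1
  · exact mul_le_mul_of_nonneg_right ((le_max_right _ _).trans (le_max_right _ _)) (sq_nonneg t)

/-- `A⁻¹ (e^{AT} - 1) = ∫_0^T e^{As} ds`, the input matrix of the sampled system. -/
def holdM (A : Matrix ι ι ℝ) (T : ℝ) : Matrix ι ι ℝ := A⁻¹ * (expM A T - 1)

lemma exists_holdM_bound {A : Matrix ι ι ℝ} (hA : IsUnit A.det) : ∃ c ≥ 0,
    ∀ T ∈ Set.Icc (0 : ℝ) 1, ‖holdM A T - T • (1 : Matrix ι ι ℝ)‖ ≤ c * T ^ 2 := by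
  obtain ⟨c, hc, h⟩ := exists_expM_bounds A
  refine ⟨‖A⁻¹‖ * c, by positivity, fun T hT => ?_⟩
  have e : holdM A T - T • (1 : Matrix ι ι ℝ) = A⁻¹ * (expM A T - 1 - T • A) := by
    rw [holdM, mul_sub A⁻¹ (expM A T - 1), mul_smul_comm, nonsing_inv_mul _ hA]
  rw [e, mul_assoc]
  exact (norm_mul_le _ _).trans (mul_le_mul_of_nonneg_left (h T hT).2.2 (norm_nonneg _))

lemma integral_expM_mulVec {A : Matrix ι ι ℝ} (hA : IsUnit A.det) (v : ι → ℝ) (a b : ℝ) :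
    ∫ s in a..b, expM A (b - s) *ᵥ v = holdM A (b - a) *ᵥ v := by
  have hder : ∀ s, HasDerivAt (fun s => -(A⁻¹ *ᵥ (expM A (b - s) *ᵥ v))) (expM A (b - s) *ᵥ v) s := by
    intro s
    have h1 := (hasDerivAt_expM_mulVec A v (b - s)).scomp s ((hasDerivAt_id s).const_sub b)
    have h2 := (HasDerivAt.linearMap (Matrix.mulVecLin A⁻¹) h1).neg
    refine h2.congr_deriv ?_
    simp only [mulVecLin_apply, neg_smul, one_smul]
    rw [mulVec_neg, neg_neg, mulVec_mulVec, nonsing_inv_mul _ hA, one_mulVec]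
  have hcont : Continuous fun s => expM A (b - s) *ᵥ v :=
    (continuous_iff_continuousAt.2 fun t => (hasDerivAt_expM_mulVec A v t).continuousAt).comp
      (continuous_const.sub continuous_id)
  rw [intervalIntegral.integral_eq_sub_of_hasDerivAt (fun s _ => hder s)
    (hcont.intervalIntegrable _ _)]
  simp only [sub_self, expM_zero, one_mulVec, holdM]
  rw [← mulVec_mulVec, sub_mulVec, one_mulVec, mulVec_sub]
  abel

/-- A lower bound, linear in T, for the contraction gained in one step; it absorbs an error
proportional to T at every step with constants independent of T. -/
lemma one_sub_exp_ge {a T : ℝ} (ha : 0 < a) (hT : 0 ≤ T) (hT1 : T ≤ 1) :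
    a / (1 + a) * T ≤ 1 - Real.exp (-(a * T)) := by
  have h1 : Real.exp (-(a * T)) ≤ 1 / (1 + a * T) := by
    rw [Real.exp_neg, one_div]
    exact inv_anti₀ (by positivity) (by linarith [Real.add_one_le_exp (a * T)])
  have h2 : a / (1 + a) * T ≤ 1 - 1 / (1 + a * T) := by
    have : 1 - 1 / (1 + a * T) = a * T / (1 + a * T) := by field_simp; ring
    rw [this, div_mul_eq_mul_div]
    have h3 : 0 ≤ a * T := by positivity
    apply div_le_div_of_nonneg_left h3 (by positivity)
    nlinarith
  linarith

/-- A perturbed sampled flow stays small. -/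
lemma norm_le_of_expM_recursion {A : Matrix ι ι ℝ} {a M T ρ : ℝ} (ha : 0 < a) (hM : 0 < M)
    (hA : ∀ t ≥ 0, ‖expM A t‖ ≤ M * Real.exp (-a * t)) (hT : 0 ≤ T) (hT1 : T ≤ 1) (hρ : 0 ≤ ρ)
    {N : ℕ} {z : ℕ → ι → ℝ} (h0 : z 0 = 0)
    (hz : ∀ i < N, ‖z (i + 1) - expM A T *ᵥ z i‖ ≤ ρ * T) :
    ∀ i ≤ N, ‖z i‖ ≤ M * ρ * ((1 + a) / a) := by
  set K := M * ρ * ((1 + a) / a) with hK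
  have hK0 : 0 ≤ K := by positivity
  have hKT : M * ρ * T ≤ K * (1 - Real.exp (-(a * T))) := by
    have h1 := mul_le_mul_of_nonneg_left (one_sub_exp_ge ha hT hT1) hK0
    refine le_trans (le_of_eq ?_) h1
    rw [hK]
    field_simp
  -- The induction controls the whole future e^{sA} z, which avoids a factor M at each step. The
  -- loss K(1 − e^{−aT}) pays for the new error MρT.
  have key : ∀ i ≤ N, ∀ s ≥ 0, ‖expM A s *ᵥ z i‖ ≤ K * Real.exp (-a * s) := by
    intro i
    induction i with
    | zero => intro _ s _; rw [h0, mulVec_zero, norm_zero]; positivity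
    | succ i ih =>
      intro hi s hs
      have e : expM A s *ᵥ z (i + 1)
          = expM A (s + T) *ᵥ z i + expM A s *ᵥ (z (i + 1) - expM A T *ᵥ z i) := by
        rw [mulVec_sub, mulVec_mulVec, ← expM_add]; abel
      rw [e]
      have h1 := ih (by omega) (s + T) (by positivity)
      have h2 : ‖expM A s *ᵥ (z (i + 1) - expM A T *ᵥ z i)‖
          ≤ M * Real.exp (-a * s) * (ρ * T) :=
        (Matrix.linfty_opNorm_mulVec _ _).trans
          (mul_le_mul (hA s hs) (hz i (by omega)) (norm_nonneg _) (by positivity))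
      have h3 : Real.exp (-a * (s + T)) = Real.exp (-a * s) * Real.exp (-(a * T)) := by
        rw [← Real.exp_add]; ring_nf
      rw [h3] at h1
      refine (norm_add_le _ _).trans ((add_le_add h1 h2).trans ?_)
      have h4 := mul_le_mul_of_nonneg_left hKT (Real.exp_pos (-a * s)).le
      linarith
  intro i hi
  simpa using key i hi 0 le_rfl

end ExponentialBounds
end
end L1Aug

namespace L1Aug
noncomputable section

/-! ### The Lyapunov norm and the sampled predictor error. -/

section Energy

set_option linter.unusedSectionVars false

attribute [local instance] Matrix.linftyOpNormedAddCommGroup Matrix.linftyOpNormedSpace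
  Matrix.linftyOpNormedRing Matrix.linftyOpNormedAlgebra

variable {ι : Type} [Fintype ι] [DecidableEq ι]

/-- The Euclidean norm of `S v`, that is, the square root of the quadratic form of `Sᵀ S`. -/
def energy (S : Matrix ι ι ℝ) (v : ι → ℝ) : ℝ := ‖WithLp.toLp 2 (S *ᵥ v)‖

lemma energy_nonneg (S : Matrix ι ι ℝ) (v : ι → ℝ) : 0 ≤ energy S v := norm_nonneg _

lemma energy_sub_le (S : Matrix ι ι ℝ) (v w : ι → ℝ) :
    energy S (v - w) ≤ energy S v + energy S w := by
  rw [energy, mulVec_sub, WithLp.toLp_sub]; exact norm_sub_le _ _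

lemma energy_sq (S : Matrix ι ι ℝ) (v : ι → ℝ) : energy S v ^ 2 = v ⬝ᵥ ((Sᵀ * S) *ᵥ v) := by
  rw [energy, EuclideanSpace.real_norm_sq_eq, ← mulVec_mulVec, dotProduct_mulVec, vecMul_transpose]
  simp [dotProduct, sq]

lemma exists_energy_bounds {S : Matrix ι ι ℝ} (hS : IsUnit S.det) :
    ∃ c > 0, ∀ v, energy S v ≤ c * ‖v‖ ∧ ‖v‖ ≤ c * energy S v := by
  let L := LinearMap.toContinuousLinearMap
    (((WithLp.linearEquiv 2 ℝ (ι → ℝ)).symm : (ι → ℝ) →ₗ[ℝ] EuclideanSpace ℝ ι).comp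
      (Matrix.mulVecLin S))
  refine ⟨1 + ‖L‖ + ‖S⁻¹‖, by positivity, fun v => ⟨?_, ?_⟩⟩
  · refine (L.le_opNorm v).trans (mul_le_mul_of_nonneg_right ?_ (norm_nonneg _))
    linarith [norm_nonneg S⁻¹]
  · have h1 : ‖S *ᵥ v‖ ≤ energy S v :=
      (pi_norm_le_iff_of_nonneg (energy_nonneg _ _)).2 fun i =>
        PiLp.norm_apply_le (WithLp.toLp 2 (S *ᵥ v)) i
    have h2 : v = S⁻¹ *ᵥ (S *ᵥ v) := by rw [mulVec_mulVec, nonsing_inv_mul _ hS, one_mulVec]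
    calc ‖v‖ = ‖S⁻¹ *ᵥ (S *ᵥ v)‖ := by rw [← h2]
      _ ≤ ‖S⁻¹‖ * energy S v :=
        (Matrix.linfty_opNorm_mulVec _ _).trans (mul_le_mul_of_nonneg_left h1 (norm_nonneg _))
      _ ≤ _ := mul_le_mul_of_nonneg_right (by linarith [norm_nonneg L]) (energy_nonneg _ _)

lemma continuous_quadratic (Q : Matrix ι ι ℝ) : Continuous fun v : ι → ℝ => v ⬝ᵥ (Q *ᵥ v) := by
  simp only [dotProduct, mulVec]
  fun_prop

lemma exists_posDef_lower_bound {Q : Matrix ι ι ℝ} (hQ : Q.PosDef) :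
    ∃ q > 0, ∀ v, q * ‖v‖ ^ 2 ≤ v ⬝ᵥ (Q *ᵥ v) := by
  rcases isEmpty_or_nonempty ι with hι | hι
  · exact ⟨1, one_pos, fun v => by simp [Subsingleton.elim v 0]⟩
  obtain ⟨v₀, hv₀, hmin⟩ := (isCompact_sphere (0 : ι → ℝ) 1).exists_isMinOn
    (NormedSpace.sphere_nonempty.2 zero_le_one) (continuous_quadratic Q).continuousOn
  have hne : v₀ ≠ 0 := ne_zero_of_mem_unit_sphere ⟨v₀, hv₀⟩
  have hpos := hQ.dotProduct_mulVec_pos hne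
  rw [star_trivial] at hpos
  refine ⟨_, hpos, fun v => ?_⟩
  by_cases hv : v = 0
  · simp [hv]
  have hv' : 0 < ‖v‖ := norm_pos_iff.2 hv
  have h1 := hmin (show ‖v‖⁻¹ • v ∈ Metric.sphere (0 : ι → ℝ) 1 by
    simp [norm_smul, inv_mul_cancel₀ hv'.ne'])
  simp only [mulVec_smul, dotProduct_smul, smul_dotProduct, smul_eq_mul, Set.mem_ofPred_eq] at h1
  have h2 := mul_le_mul_of_nonneg_right h1 (sq_nonneg ‖v‖)
  refine h2.trans (le_of_eq ?_)
  field_simp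

/-- The Lyapunov equation makes the flow a contraction in the energy norm. -/
lemma exists_energy_expM_le {A P Q S : Matrix ι ι ℝ} (hP : P.PosDef) (hQ : Q.PosDef)
    (hlyap : Aᵀ * P + P * A = -Q) (hS : Sᵀ * S = P) :
    ∃ a > 0, ∀ t ≥ 0, ∀ v, energy S (expM A t *ᵥ v) ≤ Real.exp (-(a * t)) * energy S v := by
  have hSdet : IsUnit S.det := by
    have := hP.det_pos
    rw [← hS, det_mul, det_transpose] at this
    exact isUnit_iff_ne_zero.2 fun h => by simp [h] at this
  obtain ⟨c, hc, hcb⟩ := exists_energy_bounds hSdet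
  obtain ⟨q, hq, hqb⟩ := exists_posDef_lower_bound hQ
  -- Q is at least q‖v‖² and the squared energy at most c²‖v‖², so the squared energy decays at rate
  -- q/c²; the energy itself at half of it.
  refine ⟨q / c ^ 2 / 2, by positivity, fun t ht v => ?_⟩
  set b := q / c ^ 2 with hb
  set y : ℝ → ι → ℝ := fun s => expM A s *ᵥ v
  have hy : ∀ s, HasDerivAt y (A *ᵥ y s) s := fun s => hasDerivAt_expM_mulVec A v s
  have hPy : ∀ s, HasDerivAt (fun s => P *ᵥ y s) (P *ᵥ (A *ᵥ y s)) s := fun s =>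
    HasDerivAt.linearMap (Matrix.mulVecLin P) (hy s)
  have hN : ∀ s, HasDerivAt (fun s => y s ⬝ᵥ (P *ᵥ y s)) (-(y s ⬝ᵥ (Q *ᵥ y s))) s := by
    intro s
    have h1 : HasDerivAt (fun s => y s ⬝ᵥ (P *ᵥ y s))
        (∑ i, ((A *ᵥ y s) i * (P *ᵥ y s) i + y s i * (P *ᵥ (A *ᵥ y s)) i)) s := by
      simp only [dotProduct]
      exact HasDerivAt.fun_sum fun i _ =>
        (hasDerivAt_pi.1 (hy s) i).mul (hasDerivAt_pi.1 (hPy s) i)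
    refine h1.congr_deriv ?_
    rw [← dotProduct_neg, ← neg_mulVec, ← hlyap, add_mulVec, dotProduct_add, ← mulVec_mulVec,
      ← mulVec_mulVec, dotProduct_mulVec _ Aᵀ, vecMul_transpose, Finset.sum_add_distrib]
    rfl
  have hW : Antitone fun s => Real.exp (b * s) * (y s ⬝ᵥ (P *ᵥ y s)) := by
    refine antitone_of_hasDerivAt_nonpos
      (fun s => (((hasDerivAt_id s).const_mul b).exp.mul (hN s))) fun s => ?_
    have h1 : b * (y s ⬝ᵥ (P *ᵥ y s)) ≤ y s ⬝ᵥ (Q *ᵥ y s) := by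
      rw [← hS, ← energy_sq]
      refine le_trans ?_ (hqb (y s))
      have h2 : energy S (y s) ^ 2 ≤ (c * ‖y s‖) ^ 2 :=
        pow_le_pow_left₀ (energy_nonneg _ _) (hcb (y s)).1 2
      calc b * energy S (y s) ^ 2 ≤ b * (c * ‖y s‖) ^ 2 := by gcongr
        _ = q * ‖y s‖ ^ 2 := by rw [hb]; field_simp
    have h3 := mul_le_mul_of_nonneg_left h1 (Real.exp_pos (b * s)).le
    simp only [id, mul_one, Pi.zero_apply]
    linarith
  have h1 := hW ht
  simp only [mul_zero, Real.exp_zero, one_mul] at h1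
  rw [← hS, ← energy_sq, ← energy_sq] at h1
  have h2 : y 0 = v := by simp [y]
  rw [h2] at h1
  refine le_of_sq_le_sq ?_ (mul_nonneg (Real.exp_pos _).le (energy_nonneg _ _))
  have h3 : Real.exp (-(b / 2 * t)) ^ 2 * Real.exp (b * t) = 1 := by
    rw [← Real.exp_nat_mul, ← Real.exp_add]; ring_nf; simp
  calc energy S (y t) ^ 2
      = Real.exp (-(b / 2 * t)) ^ 2 * (Real.exp (b * t) * energy S (y t) ^ 2) := by
        rw [← mul_assoc, h3, one_mul]
    _ ≤ Real.exp (-(b / 2 * t)) ^ 2 * energy S v ^ 2 := by gcongr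
    _ = _ := by ring

end Energy

namespace Design

variable {n k : ℕ} {d : Design n k}

attribute [local instance] Matrix.linftyOpNormedAddCommGroup Matrix.linftyOpNormedSpace
  Matrix.linftyOpNormedRing Matrix.linftyOpNormedAlgebra

/-- The direction `Λ⁻¹ e₁` removed from the predictor error by the adaptation law. -/
def adaptDir (d : Design n k) : Fin (n + 1) → ℝ := d.Lam⁻¹ *ᵥ Pi.single 0 1

lemma Valid.Lam_mulVec_adaptDir (hd : d.Valid) : d.Lam *ᵥ d.adaptDir = Pi.single 0 1 := by
  rw [adaptDir, mulVec_mulVec, mul_nonsing_inv _ hd.lam_invertible, one_mulVec]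

lemma Lam_mulVec_zero (v : Fin (n + 1) → ℝ) : (d.Lam *ᵥ v) 0 = d.Cm ⬝ᵥ v := rfl

lemma Lam_mulVec_succ (v : Fin (n + 1) → ℝ) (i : Fin n) :
    (d.Lam *ᵥ v) i.succ = ((d.D * d.sqrtP) *ᵥ v) i := rfl

lemma Valid.Cm_adaptDir (hd : d.Valid) : d.Cm ⬝ᵥ d.adaptDir = 1 := by
  rw [← Lam_mulVec_zero, hd.Lam_mulVec_adaptDir, Pi.single_eq_same]

lemma Valid.isUnit_sqrtP (hd : d.Valid) : IsUnit d.sqrtP.det := by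
  have := hd.posDef_P.det_pos
  rw [← hd.sqrt, det_mul, det_transpose] at this
  exact isUnit_iff_ne_zero.2 fun h => by simp [h] at this

/-- The removed direction is `P`-orthogonal to the kernel of the output row. -/
lemma Valid.exists_P_mulVec_adaptDir (hd : d.Valid) :
    ∃ κ > (0 : ℝ), d.P *ᵥ d.adaptDir = κ • d.Cm := by
  have hPdet : IsUnit d.P.det := isUnit_iff_ne_zero.2 hd.posDef_P.det_pos.ne'
  set p0 := d.P⁻¹ *ᵥ d.Cm
  have hκ : 0 < d.Cm ⬝ᵥ p0 := by
    have := hd.posDef_P.inv.dotProduct_mulVec_pos hd.Cm_ne_zero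
    rwa [star_trivial] at this
  refine ⟨(d.Cm ⬝ᵥ p0)⁻¹, inv_pos.2 hκ, ?_⟩
  -- The orthogonality condition on D says that D√P kills P⁻¹C_mᵀ, so after normalization this
  -- vector is Λ⁻¹e₁.
  have h1 : d.Lam *ᵥ ((d.Cm ⬝ᵥ p0)⁻¹ • p0) = Pi.single 0 1 := by
    ext i
    refine Fin.cases ?_ (fun i => ?_) i
    · rw [Lam_mulVec_zero, dotProduct_smul, smul_eq_mul, inv_mul_cancel₀ hκ.ne', Pi.single_eq_same]
    · rw [Lam_mulVec_succ, mulVec_smul, Pi.single_eq_of_ne (Fin.succ_ne_zero i)]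
      have h2 : (d.D * d.sqrtP) *ᵥ p0 = 0 := by
        rw [← hd.orthogonal, mulVec_mulVec, ← hd.sqrt, Matrix.mul_inv_rev, Matrix.mul_assoc,
          ← Matrix.mul_assoc d.sqrtP, mul_nonsing_inv _ hd.isUnit_sqrtP, Matrix.one_mul,
          ← transpose_nonsing_inv, ← mulVec_mulVec, mulVec_transpose]
      rw [h2]; simp
  have h3 : d.adaptDir = (d.Cm ⬝ᵥ p0)⁻¹ • p0 := by
    rw [adaptDir, ← h1, mulVec_mulVec, nonsing_inv_mul _ hd.lam_invertible, one_mulVec]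
  rw [h3, mulVec_smul, mulVec_mulVec, mul_nonsing_inv _ hPdet, one_mulVec]

/-- Since P Λ⁻¹e₁ = κ C_mᵀ and C_m Λ⁻¹e₁ = 1, this is the P-orthogonal projection onto ker C_m; the
squared energy drops by κ(C_m v)². -/
lemma Valid.energy_proj_le (hd : d.Valid) (v : Fin (n + 1) → ℝ) :
    energy d.sqrtP (v - (d.Cm ⬝ᵥ v) • d.adaptDir) ≤ energy d.sqrtP v := by
  refine le_of_sq_le_sq ?_ (energy_nonneg _ _)
  obtain ⟨κ, hκ, hP⟩ := hd.exists_P_mulVec_adaptDir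
  rw [energy_sq, energy_sq, hd.sqrt]
  have hsymm : d.adaptDir ⬝ᵥ (d.P *ᵥ v) = κ * (d.Cm ⬝ᵥ v) := by
    have hPt : d.Pᵀ = d.P := by
      rw [← hd.sqrt, transpose_mul, transpose_transpose]
    rw [dotProduct_mulVec, ← mulVec_transpose, hPt, hP, smul_dotProduct, smul_eq_mul]
  have hq : d.adaptDir ⬝ᵥ d.Cm = 1 := by rw [dotProduct_comm]; exact hd.Cm_adaptDir
  rw [mulVec_sub, mulVec_smul, hP]
  simp only [dotProduct_sub, sub_dotProduct, dotProduct_smul, smul_dotProduct, smul_eq_mul, hsymm,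
    hq, dotProduct_comm v d.Cm]
  nlinarith [mul_nonneg hκ.le (sq_nonneg (d.Cm ⬝ᵥ v))]

lemma abs_dotProduct_le {ι : Type} [Fintype ι] (c v : ι → ℝ) :
    |c ⬝ᵥ v| ≤ (∑ j, |c j|) * ‖v‖ := by
  rw [Finset.sum_mul]
  refine (Finset.abs_sum_le_sum_abs _ _).trans (Finset.sum_le_sum fun j _ => ?_)
  rw [abs_mul]
  exact mul_le_mul_of_nonneg_left (norm_le_pi_norm v j) (abs_nonneg _)

/-- The sampled predictor error is bounded and its output is of the order of the sampling time. -/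
lemma Valid.exists_predictor_bound (hd : d.Valid) {w r : ℝ} (hw : 0 ≤ w) (hr : 0 ≤ r) :
    ∃ R ≥ 0, ∀ T, 0 < T → T ≤ 1 → ∀ (N : ℕ) (e W : ℕ → Fin (n + 1) → ℝ),
      ‖e 0‖ ≤ r → d.Cm ⬝ᵥ e 0 = 0 → (∀ i < N, ‖W i‖ ≤ w * T) →
      (∀ i < N, e (i + 1) = expM d.Am T *ᵥ (e i - (d.Cm ⬝ᵥ e i) • d.adaptDir) - W i) →
      ∀ i ≤ N, ‖e i‖ ≤ R ∧ |d.Cm ⬝ᵥ e i| ≤ R * T := by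
  obtain ⟨a, ha, hcontr⟩ := exists_energy_expM_le hd.posDef_P hd.posDef_Q hd.lyapunov hd.sqrt
  obtain ⟨c, hc, hcb⟩ := exists_energy_bounds hd.isUnit_sqrtP
  obtain ⟨c', hc', hexp⟩ := exists_expM_bounds d.Am
  -- The initial energy plus the level at which the contraction e^{−aT} absorbs an input of size c w
  -- T, uniformly for T ≤ 1.
  set K := c * r + c * w * ((1 + a) / a) with hK
  have hK0 : 0 ≤ K := by positivity
  set m := ∑ j, |d.Cm j|
  have hm : 0 ≤ m := by positivity
  set R := max (c * K) (m * (c' * (c * K) + w)) with hR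
  refine ⟨R, (by positivity : 0 ≤ c * K).trans (le_max_left _ _), ?_⟩
  intro T hT hT1 N e W h0 hz0 hW hrec
  have hKT : c * w * T ≤ K * (1 - Real.exp (-(a * T))) := by
    have h1 := mul_le_mul_of_nonneg_left (one_sub_exp_ge ha hT.le hT1)
      (show 0 ≤ c * w * ((1 + a) / a) by positivity)
    have h2 : c * w * T = c * w * ((1 + a) / a) * (a / (1 + a) * T) := by field_simp
    rw [h2]
    refine h1.trans (mul_le_mul_of_nonneg_right ?_ ?_)
    · rw [hK]; linarith [mul_nonneg hc.le hr]
    · have := one_sub_exp_ge ha hT.le hT1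
      exact (by positivity : 0 ≤ a / (1 + a) * T).trans this
  have hen : ∀ i ≤ N, energy d.sqrtP (e i) ≤ K := by
    intro i
    induction i with
    | zero =>
      intro _
      have : 0 ≤ c * w * ((1 + a) / a) := by positivity
      calc _ ≤ c * ‖e 0‖ := (hcb _).1
        _ ≤ c * r := by gcongr
        _ ≤ K := by rw [hK]; linarith
    | succ i ih =>
      intro hi
      rw [hrec i (by omega)]
      have h1 := (hcontr T hT.le (e i - (d.Cm ⬝ᵥ e i) • d.adaptDir)).trans
        (mul_le_mul_of_nonneg_left ((hd.energy_proj_le (e i)).trans (ih (by omega)))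
          (Real.exp_pos _).le)
      have h2 : energy d.sqrtP (W i) ≤ c * w * T := by
        rw [mul_assoc]
        exact (hcb _).1.trans (mul_le_mul_of_nonneg_left (hW i (by omega)) hc.le)
      refine (energy_sub_le _ _ _).trans ?_
      linarith
  have hnorm : ∀ i ≤ N, ‖e i‖ ≤ c * K := fun i hi =>
    (hcb _).2.trans (mul_le_mul_of_nonneg_left (hen i hi) hc.le)
  intro i hi
  refine ⟨(hnorm i hi).trans (le_max_left _ _), ?_⟩
  cases i with
  | zero =>
    rw [hz0, abs_zero]
    exact mul_nonneg ((by positivity : 0 ≤ c * K).trans (le_max_left _ _)) hT.le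
  | succ i =>
    -- The projected error lies in ker C_m, so the next output sees only e^{A_m T} − 1 and the
    -- disturbance over one step, both O(T).
    set v := e i - (d.Cm ⬝ᵥ e i) • d.adaptDir
    have hv : ‖v‖ ≤ c * K := (hcb _).2.trans (mul_le_mul_of_nonneg_left
      ((hd.energy_proj_le _).trans (hen i (by omega))) hc.le)
    have hCv : d.Cm ⬝ᵥ v = 0 := by
      simp only [v, dotProduct_sub, dotProduct_smul, hd.Cm_adaptDir, smul_eq_mul, mul_one, sub_self]
    have h1 : d.Cm ⬝ᵥ e (i + 1) = d.Cm ⬝ᵥ ((expM d.Am T - 1) *ᵥ v - W i) := by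
      rw [hrec i (by omega), sub_mulVec, one_mulVec]
      simp only [dotProduct_sub]
      rw [hCv, sub_zero]
    rw [h1]
    refine (abs_dotProduct_le _ _).trans ?_
    have h2 : ‖(expM d.Am T - 1) *ᵥ v - W i‖ ≤ c' * T * (c * K) + w * T :=
      (norm_sub_le _ _).trans (add_le_add ((Matrix.linfty_opNorm_mulVec _ _).trans
        (mul_le_mul (hexp T ⟨hT.le, hT1⟩).2.1 hv (norm_nonneg _) (by positivity)))
        (hW i (by omega)))
    calc m * _ ≤ m * (c' * T * (c * K) + w * T) := mul_le_mul_of_nonneg_left h2 hm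
      _ = m * (c' * (c * K) + w) * T := by ring
      _ ≤ R * T := mul_le_mul_of_nonneg_right (le_max_right _ _) hT.le

end Design
end
end L1Aug

namespace L1Aug
noncomputable section

/-! ### Sampling estimates and the closed form of the adaptation law. -/

section Sampling

set_option linter.unusedSectionVars false

attribute [local instance] Matrix.linftyOpNormedAddCommGroup Matrix.linftyOpNormedSpace
  Matrix.linftyOpNormedRing Matrix.linftyOpNormedAlgebra

variable {ι : Type} [Fintype ι] [DecidableEq ι]

lemma intervalIntegrable_expM_mulVec (A : Matrix ι ι ℝ) {f : ℝ → ι → ℝ} {a b : ℝ} (c : ℝ)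
    (hf : IntervalIntegrable f volume a b) :
    IntervalIntegrable (fun s => expM A (c - s) *ᵥ f s) volume a b :=
  intervalIntegrable_mulVec
    (fun i j => (continuous_expM_apply A i j).comp (continuous_const.sub continuous_id)) hf

/-- Variation of constants between two instants. -/
lemma SolvesLinear.eq_step {A : Matrix ι ι ℝ} {f : ℝ → ι → ℝ} {y0 : ι → ℝ} {T : ℝ}
    {y : ℝ → ι → ℝ} (h : SolvesLinear A f y0 T y) (hf : IntervalIntegrable f volume 0 T)
    {a b : ℝ} (ha : 0 ≤ a) (hab : a ≤ b) (hb : b ≤ T) :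
    y b = expM A (b - a) *ᵥ y a + ∫ s in a..b, expM A (b - s) *ᵥ f s := by
  have hfa := hf.restrict_right (t := a) ⟨ha, hab.trans hb⟩
  have hfb := hf.restrict_right (t := b) ⟨ha.trans hab, hb⟩
  have hfab : IntervalIntegrable f volume a b := hfa.symm.trans hfb
  rw [h.eq_convolution hf ⟨ha.trans hab, hb⟩, h.eq_convolution hf ⟨ha, hab.trans hb⟩, mulVec_add,
    mulVec_mulVec, ← expM_add, sub_add_cancel, mulVec_intervalIntegral _
      (intervalIntegrable_expM_mulVec A a hfa), add_assoc]
  congr 1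
  rw [← intervalIntegral.integral_add_adjacent_intervals
    (intervalIntegrable_expM_mulVec A b hfa) (intervalIntegrable_expM_mulVec A b hfab)]
  congr 1
  refine intervalIntegral.integral_congr fun s _ => ?_
  simp only [mulVec_mulVec, ← expM_add]
  rw [show b - a + (a - s) = b - s by ring]

lemma SolvesLinear.initial {A : Matrix ι ι ℝ} {f : ℝ → ι → ℝ} {y0 : ι → ℝ} {T : ℝ}
    {y : ℝ → ι → ℝ} (h : SolvesLinear A f y0 T y) (hT : 0 ≤ T) : y 0 = y0 := by
  have := h.2 0 ⟨le_rfl, hT⟩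
  simpa using this

/-- An exponentially stable system maps bounded inputs to bounded states. -/
lemma norm_integral_expM_mulVec_le {A : Matrix ι ι ℝ} {a M C t : ℝ} (ha : 0 < a) (hM : 0 < M)
    (hA : ∀ t ≥ 0, ‖expM A t‖ ≤ M * Real.exp (-a * t)) (ht : 0 ≤ t) {f : ℝ → ι → ℝ}
    (hC : ∀ s ∈ Set.Icc 0 t, ‖f s‖ ≤ C) :
    ‖∫ s in (0 : ℝ)..t, expM A (t - s) *ᵥ f s‖ ≤ M * C / a := by
  have hC0 : 0 ≤ C := (norm_nonneg _).trans (hC 0 ⟨le_rfl, ht⟩)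
  have hder : ∀ s, HasDerivAt (fun s => M * C / a * Real.exp (-a * (t - s)))
      (M * C * Real.exp (-a * (t - s))) s := by
    intro s
    have h1 := ((((hasDerivAt_id s).const_sub t).const_mul (-a)).exp).const_mul (M * C / a)
    refine h1.congr_deriv ?_
    simp only [id]
    field_simp
  have hcont : Continuous fun s => M * C * Real.exp (-a * (t - s)) := by fun_prop
  have h1 := intervalIntegral.norm_integral_le_of_norm_le (μ := volume) (a := 0) (b := t)
    (f := fun s => expM A (t - s) *ᵥ f s) (g := fun s => M * C * Real.exp (-a * (t - s))) ht
    (Eventually.of_forall fun s hs => ?_) (hcont.intervalIntegrable _ _)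
  · refine h1.trans ?_
    rw [intervalIntegral.integral_eq_sub_of_hasDerivAt (fun s _ => hder s)
      (hcont.intervalIntegrable _ _)]
    simp only [sub_self, mul_zero, Real.exp_zero, mul_one, sub_zero]
    have : 0 ≤ M * C / a * Real.exp (-a * t) := by positivity
    linarith
  · refine (Matrix.linfty_opNorm_mulVec _ _).trans ?_
    have := mul_le_mul (hA (t - s) (by linarith [hs.2])) (hC s ⟨hs.1.le, hs.2⟩) (norm_nonneg _)
      (by positivity)
    refine this.trans (le_of_eq ?_)
    ring

lemma intervalIntegrable_of_bounded {g : ℝ → ℝ} {t C : ℝ} (ht : 0 ≤ t) (hg : Measurable g)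
    (hC : ∀ s ∈ Set.Icc 0 t, |g s| ≤ C) : IntervalIntegrable g volume 0 t := by
  rw [intervalIntegrable_iff_integrableOn_Icc_of_le ht]
  refine Measure.integrableOn_of_bounded (M := C) measure_Icc_lt_top.ne hg.aestronglyMeasurable ?_
  exact (ae_restrict_iff' measurableSet_Icc).2 (Eventually.of_forall hC)

lemma intervalIntegrable_comp_floor {T : ℝ} (hT : 0 < T) (g : ℕ → ℝ) {t : ℝ} (ht : 0 ≤ t) :
    IntervalIntegrable (fun s => g ⌊s / T⌋₊) volume 0 t := by
  refine intervalIntegrable_of_bounded (C := ∑ i ∈ Finset.range (⌊t / T⌋₊ + 1), |g i|) ht ?_ ?_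
  · exact (measurable_of_countable g).comp (Nat.measurable_floor.comp (measurable_id.div_const T))
  · intro s hs
    refine Finset.single_le_sum (f := fun i => |g i|) (fun i _ => abs_nonneg _)
      (Finset.mem_range.2 (Nat.lt_succ_of_le (Nat.floor_mono ?_)))
    exact div_le_div_of_nonneg_right hs.2 hT.le

lemma floor_div_eq {T s : ℝ} (hT : 0 < T) {i : ℕ} (h1 : i * T ≤ s) (h2 : s < (i + 1 : ℕ) * T) :
    ⌊s / T⌋₊ = i := by
  have h0 : 0 ≤ s / T := div_nonneg ((by positivity : (0 : ℝ) ≤ i * T).trans h1) hT.le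
  rw [Nat.floor_eq_iff h0, le_div_iff₀ hT, div_lt_iff₀ hT]
  exact ⟨h1, by push_cast at h2; exact h2⟩

end Sampling

namespace Design

variable {n k : ℕ} {d : Design n k}

attribute [local instance] Matrix.linftyOpNormedAddCommGroup Matrix.linftyOpNormedSpace
  Matrix.linftyOpNormedRing Matrix.linftyOpNormedAlgebra

lemma Valid.expM_conj_mul_Lam (hd : d.Valid) (t : ℝ) :
    NormedSpace.exp (t • (d.Lam * d.Am * d.Lam⁻¹)) * d.Lam = d.Lam * expM d.Am t := by
  refine (expM_intertwine (L := d.Lam) (A := d.Am) (A' := d.Lam * d.Am * d.Lam⁻¹) ?_ t).symm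
  rw [Matrix.mul_assoc _ d.Lam⁻¹, nonsing_inv_mul _ hd.lam_invertible, Matrix.mul_one]

/-- Λ intertwines e^{tA_m} with the conjugated flow, so it can be pulled out of the integral. It
then cancels from the adaptation law except through Λ⁻¹e₁. -/
lemma Valid.Phi_eq (hd : d.Valid) (T : ℝ) : d.Phi T = d.Lam * holdM d.Am T := by
  ext i j
  simp only [Phi, Matrix.of_apply]
  have hcont : IntervalIntegrable (fun s => expM d.Am (T - s) *ᵥ Pi.single j 1) volume 0 T :=
    intervalIntegrable_expM_mulVec d.Am T (continuous_const.intervalIntegrable _ _)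
  have h1 := integral_expM_mulVec hd.isUnit_Am (Pi.single j 1) 0 T
  have h2 := congrFun (mulVec_intervalIntegral d.Lam hcont) i
  have hint : IntervalIntegrable (fun s => d.Lam *ᵥ (expM d.Am (T - s) *ᵥ Pi.single j 1))
      volume 0 T := intervalIntegrable_mulVec (Φ := fun _ => d.Lam)
        (fun _ _ => continuous_const) hcont
  rw [intervalIntegral_apply hint, h1,
    mulVec_mulVec, sub_zero, mulVec_single_one] at h2
  rw [show (d.Lam * holdM d.Am T) i j = (d.Lam * holdM d.Am T).col j i from rfl, h2]
  refine intervalIntegral.integral_congr fun s _ => ?_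
  rw [hd.expM_conj_mul_Lam, mulVec_mulVec, mulVec_single_one]
  rfl

/-- The adaptation law removes the direction `adaptDir` from the predicted error. -/
lemma Valid.holdM_mulVec_sigmaHat (hd : d.Valid) {T : ℝ} (hT : IsUnit (holdM d.Am T).det) (e : ℝ) :
    holdM d.Am T *ᵥ d.sigmaHat T e = -(e • (expM d.Am T *ᵥ d.adaptDir)) := by
  have h1 : (Pi.single 0 e : Fin (n + 1) → ℝ) = e • (d.Lam *ᵥ d.adaptDir) := by
    rw [hd.Lam_mulVec_adaptDir, ← Pi.single_smul, smul_eq_mul, mul_one]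
  rw [sigmaHat, h1, mulVec_smul, mulVec_mulVec, hd.expM_conj_mul_Lam, mulVec_smul, mulVec_neg,
    mulVec_smul, hd.Phi_eq, Matrix.mul_inv_rev, mulVec_mulVec, mulVec_mulVec]
  congr 3
  rw [← Matrix.mul_assoc (holdM d.Am T), mul_nonsing_inv _ hT, Matrix.one_mul,
    ← Matrix.mul_assoc d.Lam⁻¹, nonsing_inv_mul _ hd.lam_invertible, Matrix.one_mul]

/-- The hold matrix is T + O(T²), hence bounded below by T/2 for small T. This gives its
invertibility and turns C_m e = O(T) into a bounded estimate σ̂. -/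
lemma norm_holdM_mulVec_ge {ι : Type} [Fintype ι] [DecidableEq ι] {A : Matrix ι ι ℝ} {c T : ℝ}
    (hT : 0 < T)
    (h : ‖holdM A T - T • (1 : Matrix ι ι ℝ)‖ ≤ c * T ^ 2) (hcT : c * T ≤ 1 / 2) (v : ι → ℝ) :
    T / 2 * ‖v‖ ≤ ‖holdM A T *ᵥ v‖ := by
  have e : T • v = holdM A T *ᵥ v - (holdM A T - T • (1 : Matrix ι ι ℝ)) *ᵥ v := by
    rw [sub_mulVec, smul_mulVec, one_mulVec]; abel
  have h1 : T * ‖v‖ ≤ ‖holdM A T *ᵥ v‖ + c * T ^ 2 * ‖v‖ := by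
    have h2 : ‖T • v‖ = T * ‖v‖ := by rw [norm_smul, Real.norm_eq_abs, abs_of_pos hT]
    rw [← h2, e]
    exact (norm_sub_le _ _).trans (add_le_add le_rfl ((Matrix.linfty_opNorm_mulVec _ _).trans
      (mul_le_mul_of_nonneg_right h (norm_nonneg _))))
  have h3 : c * T ^ 2 * ‖v‖ ≤ T / 2 * ‖v‖ := by
    refine mul_le_mul_of_nonneg_right ?_ (norm_nonneg _)
    nlinarith
  linarith

lemma isUnit_holdM {ι : Type} [Fintype ι] [DecidableEq ι] {A : Matrix ι ι ℝ} {c T : ℝ}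
    (hT : 0 < T) (h : ‖holdM A T - T • (1 : Matrix ι ι ℝ)‖ ≤ c * T ^ 2) (hcT : c * T ≤ 1 / 2) :
    IsUnit (holdM A T).det := by
  rw [isUnit_iff_ne_zero]
  intro h0
  obtain ⟨v, hv, hv0⟩ := Matrix.exists_mulVec_eq_zero_iff.2 h0
  have := norm_holdM_mulVec_ge hT h hcT v
  rw [hv0, norm_zero] at this
  have : 0 < T / 2 * ‖v‖ := mul_pos (by linarith) (norm_pos_iff.2 hv)
  linarith

lemma IsHurwitz.isUnit_det {ι : Type} [Fintype ι] [DecidableEq ι] {A : Matrix ι ι ℝ}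
    (hA : IsHurwitz A) : IsUnit A.det := by
  rw [isUnit_iff_ne_zero]
  intro h0
  have h1 : (0 : ℂ) ∈ spectrum ℂ (A.map (algebraMap ℝ ℂ)) := by
    rw [spectrum.zero_mem_iff, Matrix.isUnit_iff_isUnit_det, isUnit_iff_ne_zero, not_not]
    have := (RingHom.map_det (algebraMap ℝ ℂ) A).symm
    rw [h0, map_zero] at this
    exact this
  exact lt_irrefl _ (hA 0 h1)

end Design
end
end L1Aug

namespace L1Aug
noncomputable section
-- One-step recursions of plant, predictor and control law.
namespace Design

attribute [local instance] Matrix.linftyOpNormedAddCommGroup Matrix.linftyOpNormedSpace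
  Matrix.linftyOpNormedRing Matrix.linftyOpNormedAlgebra

lemma intervalIntegrable_smul_const {ι : Type} [Fintype ι] {ω : ℝ → ℝ} {a b : ℝ}
    (h : IntervalIntegrable ω volume a b) (v : ι → ℝ) :
    IntervalIntegrable (fun s => ω s • v) volume a b :=
  intervalIntegrable_pi fun i => h.mul_const (v i)

variable {n k : ℕ} {d : Design n k}

/-- The state of the output predictor at the sampling instants. -/
def predictor (d : Design n k) (T : ℝ) (z r : ℕ → ℝ) (i : ℕ) : Fin (n + 1) → ℝ :=
  (d.ctrlState T z r i).1

/-- The state of the control law at the sampling instants. -/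
def ctrlLaw (d : Design n k) (T : ℝ) (z r : ℕ → ℝ) (i : ℕ) : Fin k → ℝ :=
  (d.ctrlState T z r i).2

lemma predictor_succ (T : ℝ) (z r : ℕ → ℝ) (i : ℕ) :
    d.predictor T z r (i + 1) = expM d.Am T *ᵥ d.predictor T z r i
      + holdM d.Am T *ᵥ ((r i - (d.ctl.C *ᵥ d.ctrlLaw T z r i) 0) • d.Bm
        + d.sigmaHat T (d.Cm ⬝ᵥ d.predictor T z r i - z i)) := rfl

lemma ctrlLaw_succ (T : ℝ) (z r : ℕ → ℝ) (i : ℕ) :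
    d.ctrlLaw T z r (i + 1) = expM d.ctl.A T *ᵥ d.ctrlLaw T z r i
      + holdM d.ctl.A T *ᵥ (d.ctl.B *ᵥ (expM d.Am (-T) *ᵥ
        d.sigmaHat T (d.Cm ⬝ᵥ d.predictor T z r i - z i))) := rfl

/-- The plant at the sampling instants. -/
lemma Valid.plant_succ (hd : d.Valid) {T t₁ : ℝ} (hT : 0 < T) {z r : ℕ → ℝ}
    {x0 : Fin (n + 1) → ℝ} {x : ℝ → Fin (n + 1) → ℝ} {ω : ℝ → ℝ} (ht₁ : 0 ≤ t₁)
    (hω : IntervalIntegrable ω volume 0 t₁)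
    (hx : SolvesLinear d.Am (fun s => (d.ctrlInput T z r s + ω s) • d.Bm) x0 t₁ x) {i : ℕ}
    (hi : ((i + 1 : ℕ) : ℝ) * T ≤ t₁) :
    x ((i + 1 : ℕ) * T) = expM d.Am T *ᵥ x (i * T)
      + holdM d.Am T *ᵥ ((r i - (d.ctl.C *ᵥ d.ctrlLaw T z r i) 0) • d.Bm)
      + ∫ s in (i * T)..((i + 1 : ℕ) * T), expM d.Am ((i + 1 : ℕ) * T - s) *ᵥ (ω s • d.Bm) := by
  have ha : (0 : ℝ) ≤ i * T := by positivity
  have hab : (i : ℝ) * T ≤ (i + 1 : ℕ) * T := by push_cast; nlinarith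
  have hu : IntervalIntegrable (d.ctrlInput T z r) volume 0 t₁ :=
    intervalIntegrable_comp_floor hT (fun i => r i - (d.ctl.C *ᵥ d.ctrlLaw T z r i) 0) ht₁
  have hstep := hx.eq_step (intervalIntegrable_smul_const (hu.add hω) _) ha hab hi
  have hlen : ((i + 1 : ℕ) : ℝ) * T - i * T = T := by push_cast; ring
  have hωi : IntervalIntegrable ω volume (i * T) ((i + 1 : ℕ) * T) :=
    (hω.restrict_right ⟨ha, hab.trans hi⟩).symm.trans (hω.restrict_right ⟨ha.trans hab, hi⟩)
  rw [hstep, hlen, add_assoc, ← hlen, ← integral_expM_mulVec hd.isUnit_Am, hlen,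
    ← intervalIntegral.integral_add]
  · congr 1
    -- The held input is constant on the open step only; at the right endpoint the next sample is
    -- already in force, which the integral does not see.
    refine intervalIntegral.integral_congr_Ioo_of_le hab fun s hs => ?_
    have hfl := floor_div_eq hT hs.1.le hs.2
    simp only [ctrlInput, hfl, ctrlLaw, add_smul, mulVec_add]
  · exact intervalIntegrable_expM_mulVec _ _ (continuous_const.intervalIntegrable _ _)
  · exact intervalIntegrable_expM_mulVec _ _ (intervalIntegrable_smul_const hωi _)

/-- The error of the output predictor at the sampling instants. -/
lemma Valid.predictor_error_succ (hd : d.Valid) {T t₁ : ℝ} (hT : 0 < T)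
    (hunit : IsUnit (holdM d.Am T).det) {r : ℕ → ℝ}
    {x0 : Fin (n + 1) → ℝ} {x : ℝ → Fin (n + 1) → ℝ} {ω : ℝ → ℝ} (ht₁ : 0 ≤ t₁)
    (hω : IntervalIntegrable ω volume 0 t₁) {z : ℕ → ℝ} (hz : z = fun i : ℕ => d.Cm ⬝ᵥ x (i * T))
    (hx : SolvesLinear d.Am (fun s => (d.ctrlInput T z r s + ω s) • d.Bm) x0 t₁ x)
    {e : ℕ → Fin (n + 1) → ℝ} (he : e = fun i : ℕ => d.predictor T z r i - x (i * T)) {i : ℕ}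
    (hi : ((i + 1 : ℕ) : ℝ) * T ≤ t₁) :
    e (i + 1) = expM d.Am T *ᵥ (e i - (d.Cm ⬝ᵥ e i) • d.adaptDir)
      - ∫ s in (i * T)..((i + 1 : ℕ) * T), expM d.Am ((i + 1 : ℕ) * T - s) *ᵥ (ω s • d.Bm) ∧
    d.Cm ⬝ᵥ d.predictor T z r i - z i = d.Cm ⬝ᵥ e i ∧
    e (i + 1) = expM d.Am T *ᵥ e i + holdM d.Am T *ᵥ d.sigmaHat T (d.Cm ⬝ᵥ e i)
      - ∫ s in (i * T)..((i + 1 : ℕ) * T), expM d.Am ((i + 1 : ℕ) * T - s) *ᵥ (ω s • d.Bm) := by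
  have h1 : d.Cm ⬝ᵥ d.predictor T z r i - z i = d.Cm ⬝ᵥ e i := by
    simp only [he, dotProduct_sub]; rw [hz]
  have h2 : e (i + 1) = expM d.Am T *ᵥ e i + holdM d.Am T *ᵥ d.sigmaHat T (d.Cm ⬝ᵥ e i)
      - ∫ s in (i * T)..((i + 1 : ℕ) * T), expM d.Am ((i + 1 : ℕ) * T - s) *ᵥ (ω s • d.Bm) := by
    have h3 : e (i + 1) = d.predictor T z r (i + 1) - x ((i + 1 : ℕ) * T) := by rw [he]
    have h4 : e i = d.predictor T z r i - x (i * T) := by rw [he]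
    have h5 : expM d.Am T *ᵥ e i = expM d.Am T *ᵥ d.predictor T z r i
        - expM d.Am T *ᵥ x (i * T) := by rw [h4, mulVec_sub]
    rw [h3, predictor_succ, hd.plant_succ hT ht₁ hω hx hi, h1, h5, mulVec_add]
    abel
  -- Substituting the adaptation law gives the projected form, which yields boundedness; the form
  -- with σ̂ left in place is the one compared with the control law.
  refine ⟨?_, h1, h2⟩
  rw [h2, hd.holdM_mulVec_sigmaHat hunit, mulVec_sub, mulVec_smul]
  abel

/-- One step of the deviation of the control law from its continuous-time counterpart. -/
lemma deviation_step {m p : ℕ} {E Γ A : Matrix (Fin m) (Fin m) ℝ} {Eo Γo Ao : Matrix (Fin p) (Fin p) ℝ}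
    {Einv : Matrix (Fin m) (Fin m) ℝ} {B : Matrix (Fin p) (Fin m) ℝ} {T c s z R : ℝ}
    {e σ W : Fin m → ℝ} {Ξ b : Fin p → ℝ} (hT : 0 ≤ T)
    (hE : ‖E - 1 - T • A‖ ≤ c * T ^ 2) (hEo : ‖Eo - 1 - T • Ao‖ ≤ c * T ^ 2)
    (hΓ : ‖Γ - T • (1 : Matrix (Fin m) (Fin m) ℝ)‖ ≤ c * T ^ 2)
    (hΓo : ‖Γo - T • (1 : Matrix (Fin p) (Fin p) ℝ)‖ ≤ c * T ^ 2)
    (hi : ‖Einv‖ ≤ c) (hi1 : ‖Einv - 1‖ ≤ c * T)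
    (hsyl : Ao *ᵥ (B *ᵥ e) - B *ᵥ (A *ᵥ e) = z • b) (hz : |z| ≤ R * T) (he : ‖e‖ ≤ R)
    (hσ : ‖σ‖ ≤ s) :
    ‖Eo *ᵥ (B *ᵥ e) - B *ᵥ (E *ᵥ e) + (Γo *ᵥ (B *ᵥ (Einv *ᵥ σ)) - B *ᵥ (Γ *ᵥ σ))
      + (B *ᵥ W - Ξ)‖ ≤ ((2 * c * ‖B‖ + ‖b‖) * R + (c * c + 2 * c) * ‖B‖ * s) * T ^ 2
        + ‖B *ᵥ W - Ξ‖ := by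
  have mv : ∀ {a b : ℕ} (M : Matrix (Fin a) (Fin b) ℝ) (v : Fin b → ℝ) {x y : ℝ}, ‖M‖ ≤ x →
      ‖v‖ ≤ y → ‖M *ᵥ v‖ ≤ x * y := fun M v x y hx hy =>
    (Matrix.linfty_opNorm_mulVec M v).trans
      (mul_le_mul hx hy (norm_nonneg _) ((norm_nonneg _).trans hx))
  -- The terms B e and T B σ cancel. At first order in e the Sylvester identity leaves only T z b,
  -- which is O(T²) because z, the output of e, is O(T).
  have e1 : Eo *ᵥ (B *ᵥ e) - B *ᵥ (E *ᵥ e) + (Γo *ᵥ (B *ᵥ (Einv *ᵥ σ)) - B *ᵥ (Γ *ᵥ σ))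
      + (B *ᵥ W - Ξ)
      = (Eo - 1 - T • Ao) *ᵥ (B *ᵥ e) - B *ᵥ ((E - 1 - T • A) *ᵥ e) + T • (z • b)
        + ((Γo - T • (1 : Matrix (Fin p) (Fin p) ℝ)) *ᵥ (B *ᵥ (Einv *ᵥ σ))
          + T • (B *ᵥ ((Einv - 1) *ᵥ σ))
          - B *ᵥ ((Γ - T • (1 : Matrix (Fin m) (Fin m) ℝ)) *ᵥ σ)) + (B *ᵥ W - Ξ) := by
    rw [← hsyl]
    simp only [sub_mulVec, mulVec_sub, smul_mulVec, one_mulVec, mulVec_smul, smul_sub]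
    abel
  rw [e1]
  have hTn : ‖T‖ = T := by rw [Real.norm_eq_abs, abs_of_nonneg hT]
  have hB := le_refl ‖B‖
  have n1 := mv _ _ hEo (mv B e hB he)
  have n2 := mv B _ hB (mv _ _ hE he)
  have n3 : ‖T • (z • b)‖ ≤ T * (R * T * ‖b‖) := by
    rw [norm_smul, norm_smul, hTn]
    exact mul_le_mul_of_nonneg_left (mul_le_mul_of_nonneg_right hz (norm_nonneg _)) hT
  have n4 := mv _ _ hΓo (mv B _ hB (mv _ _ hi hσ))
  have n5 : ‖T • (B *ᵥ ((Einv - 1) *ᵥ σ))‖ ≤ T * (‖B‖ * (c * T * s)) := by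
    rw [norm_smul, hTn]
    exact mul_le_mul_of_nonneg_left (mv B _ hB (mv _ _ hi1 hσ)) hT
  have n6 := mv B _ hB (mv _ _ hΓ hσ)
  refine (norm_add_le _ _).trans (add_le_add ?_ le_rfl)
  refine (norm_add_le _ _).trans ?_
  have m1 := (norm_add_le ((Eo - 1 - T • Ao) *ᵥ (B *ᵥ e) - B *ᵥ ((E - 1 - T • A) *ᵥ e))
    (T • (z • b))).trans (add_le_add ((norm_sub_le _ _).trans (add_le_add n1 n2)) n3)
  have m2 := (norm_sub_le ((Γo - T • (1 : Matrix (Fin p) (Fin p) ℝ)) *ᵥ (B *ᵥ (Einv *ᵥ σ))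
          + T • (B *ᵥ ((Einv - 1) *ᵥ σ)))
          (B *ᵥ ((Γ - T • (1 : Matrix (Fin m) (Fin m) ℝ)) *ᵥ σ))).trans
          (add_le_add ((norm_add_le _ _).trans (add_le_add n4 n5)) n6)
  refine (add_le_add m1 m2).trans (le_of_eq ?_)
  ring

end Design
end
end L1Aug

namespace L1Aug
noncomputable section
-- The sampled control law follows the continuous filter.
namespace Design

attribute [local instance] Matrix.linftyOpNormedAddCommGroup Matrix.linftyOpNormedSpace
  Matrix.linftyOpNormedRing Matrix.linftyOpNormedAlgebra

variable {n k : ℕ} {d : Design n k}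

set_option maxHeartbeats 1600000 in
/-- The sampled control law reproduces the filtered uncertainty up to the order of the sampling
time. -/
theorem Valid.exists_control_error_bound (hd : d.Valid) (hctl : IsHurwitz d.ctl.A) {ρ w : ℝ}
    (hρ : 0 ≤ ρ) (hw : 0 ≤ w) :
    ∃ C ≥ 0, ∃ T₀ > 0, ∀ T, 0 < T → T ≤ T₀ → ∀ t₁ ≥ 0, ∀ (r z : ℕ → ℝ) (x0 : Fin (n + 1) → ℝ)
      (x : ℝ → Fin (n + 1) → ℝ) (ξ : ℝ → Fin k → ℝ) (ω : ℝ → ℝ), ‖x0‖ ≤ ρ →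
      IntervalIntegrable ω volume 0 t₁ → (∀ s ∈ Set.Icc 0 t₁, |ω s| ≤ w) →
      (z = fun i : ℕ => d.Cm ⬝ᵥ x (i * T)) →
      SolvesLinear d.Am (fun s => (d.ctrlInput T z r s + ω s) • d.Bm) x0 t₁ x →
      SolvesLinear d.ctl.A (fun s => ω s • (d.ctl.B *ᵥ d.Bm)) (d.V *ᵥ x0) t₁ ξ →
      ∀ t ∈ Set.Icc 0 t₁,
        |(d.ctl.C *ᵥ d.ctrlLaw T z r ⌊t / T⌋₊) 0 - (d.ctl.C *ᵥ ξ t) 0| ≤ C * T := by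
  obtain ⟨cm, hcm0, hcm⟩ := exists_expM_bounds d.Am
  obtain ⟨cn, hcn0, hcn⟩ := exists_expM_bounds (-d.Am)
  obtain ⟨co, hco0, hco⟩ := exists_expM_bounds d.ctl.A
  obtain ⟨ch, hch0, hch⟩ := exists_holdM_bound hd.isUnit_Am
  obtain ⟨cg, hcg0, hcg⟩ := exists_holdM_bound (IsHurwitz.isUnit_det hctl)
  obtain ⟨a, ha, M, hM, hexp⟩ := hctl.exists_norm_expM_le
  set c := cm + cn + co + ch + cg with hc
  have hc0 : 0 ≤ c := by positivity
  set β := ‖d.ctl.B *ᵥ d.Bm‖ * w with hβ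
  have hβ0 : 0 ≤ β := by positivity
  obtain ⟨R, hR, hpred⟩ := hd.exists_predictor_bound (w := c * (‖d.Bm‖ * w))
    (r := ‖1 - vecMulVec d.CmDag d.Cm‖ * ρ) (by positivity) (by positivity)
  -- Bound on σ̂: the hold matrix is at least T/2, which gives the factor 2, and the output error is
  -- at most R T.
  set s := 2 * (R * (c * ‖d.adaptDir‖)) with hs
  set b := (d.ctl.A * d.ctl.B - d.ctl.B * d.Am) *ᵥ d.CmDag with hb
  set B := ‖d.ctl.B‖ with hB
  set K₁ := (2 * c * B + ‖b‖) * R + (c * c + 2 * c) * B * s + 2 * c * B * (‖d.Bm‖ * w) with hK₁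
  have hs0 : 0 ≤ s := by positivity
  have hK₁0 : 0 ≤ K₁ := by positivity
  set K₂ := M * (‖d.V‖ * ρ) + M * β / a with hK₂
  have hK₂0 : 0 ≤ K₂ := by positivity
  set m := ∑ j, |d.ctl.C 0 j| with hm
  have hm0 : 0 ≤ m := by positivity
  set D := |(d.ctl.C *ᵥ (d.ctl.B *ᵥ d.CmDag)) 0| with hD
  -- The summands bound C_o ζ, C_o B_o e and the drift of C_o ξ since the last sample. The choice of
  -- T₀ ensures c T ≤ 1/2 and T ≤ 1.
  refine ⟨m * (M * K₁ * ((1 + a) / a)) + R * D + m * (c * K₂ + c * β), by positivity,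
    1 / (2 * (c + 1)), by positivity, ?_⟩
  intro T hT hTle t₁ ht₁ r z x0 x ξ ω hx0 hωi hωb hz hx hξ t ht
  have hcT : c * T ≤ 1 / 2 := by
    have h1 : c * T ≤ c * (1 / (2 * (c + 1))) := mul_le_mul_of_nonneg_left hTle hc0
    have h2 : c * (1 / (2 * (c + 1))) ≤ 1 / 2 := by
      rw [mul_one_div, div_le_div_iff₀ (by positivity) (by norm_num)]; linarith
    linarith
  have hT1 : T ≤ 1 := by
    refine hTle.trans ?_
    rw [div_le_one (by positivity)]; linarith
  have hTm : T ∈ Set.Icc (0 : ℝ) 1 := ⟨hT.le, hT1⟩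
  have mono : ∀ {x y : ℝ} {q : ℝ}, x ≤ q * y → q ≤ c → 0 ≤ y → x ≤ c * y :=
    fun h1 h2 h3 => h1.trans (mul_le_mul_of_nonneg_right h2 h3)
  have hcm' : cm ≤ c := by rw [hc]; linarith
  have hcn' : cn ≤ c := by rw [hc]; linarith
  have hco' : co ≤ c := by rw [hc]; linarith
  have hch' : ch ≤ c := by rw [hc]; linarith
  have hcg' : cg ≤ c := by rw [hc]; linarith
  have hholdm := mono (hch T hTm) hch' (sq_nonneg T)
  have hholdo := mono (hcg T hTm) hcg' (sq_nonneg T)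
  have hunit := isUnit_holdM hT hholdm hcT
  have mv : ∀ {p q : ℕ} (A : Matrix (Fin p) (Fin q) ℝ) (v : Fin q → ℝ) {x y : ℝ}, ‖A‖ ≤ x →
      ‖v‖ ≤ y → ‖A *ᵥ v‖ ≤ x * y := fun A v x y hx hy =>
    (Matrix.linfty_opNorm_mulVec A v).trans
      (mul_le_mul hx hy (norm_nonneg _) ((norm_nonneg _).trans hx))
  set N := ⌊t / T⌋₊ with hN
  have hNt : (N : ℝ) * T ≤ t := by
    rw [← le_div_iff₀ hT]; exact Nat.floor_le (div_nonneg ht.1 hT.le)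
  have htN : t ≤ N * T + T := by
    have := (Nat.lt_floor_add_one (t / T)).le
    rw [div_le_iff₀ hT] at this
    linarith
  have hidx : ∀ i < N, ((i + 1 : ℕ) : ℝ) * T ≤ t₁ := fun i hi =>
    (mul_le_mul_of_nonneg_right (by exact_mod_cast hi) hT.le).trans (hNt.trans ht.2)
  set e : ℕ → Fin (n + 1) → ℝ := fun i => d.predictor T z r i - x (i * T) with he
  set W : ℕ → Fin (n + 1) → ℝ := fun i =>
    ∫ s in (i * T)..((i + 1 : ℕ) * T), expM d.Am ((i + 1 : ℕ) * T - s) *ᵥ (ω s • d.Bm) with hW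
  have hrec := fun (i : ℕ) (hi : i < N) =>
    hd.predictor_error_succ hT hunit ht₁ hωi hz hx he (hidx i hi)
  have hωv : ∀ {q : ℕ} (v : Fin q → ℝ), ∀ s ∈ Set.Icc 0 t₁, ‖ω s • v‖ ≤ ‖v‖ * w := by
    intro q v s hs
    rw [norm_smul, Real.norm_eq_abs, mul_comm]
    exact mul_le_mul_of_nonneg_left (hωb s hs) (norm_nonneg _)
  have hlen : ∀ i : ℕ, |((i + 1 : ℕ) : ℝ) * T - i * T| = T := fun i => by
    rw [show ((i + 1 : ℕ) : ℝ) * T - i * T = T by push_cast; ring, abs_of_pos hT]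
  have hle : ∀ i : ℕ, (i : ℝ) * T ≤ (i + 1 : ℕ) * T := fun i =>
    mul_le_mul_of_nonneg_right (by push_cast; linarith) hT.le
  have hmem : ∀ i < N, ∀ s ∈ Set.uIoc ((i : ℝ) * T) ((i + 1 : ℕ) * T),
      s ∈ Set.Icc 0 t₁ ∧ (i + 1 : ℕ) * T - s ∈ Set.Icc (0 : ℝ) T := by
    intro i hi s hs
    rw [Set.uIoc_of_le (hle i)] at hs
    have h0 : (0 : ℝ) ≤ i * T := by positivity
    refine ⟨⟨h0.trans hs.1.le, hs.2.trans (hidx i hi)⟩, by linarith [hs.2], ?_⟩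
    have := hs.1
    push_cast
    linarith
  have hWb : ∀ i < N, ‖W i‖ ≤ c * (‖d.Bm‖ * w) * T := by
    intro i hi
    refine (intervalIntegral.norm_integral_le_of_norm_le_const
      (C := c * (‖d.Bm‖ * w)) fun s hs => ?_).trans (le_of_eq (by rw [hlen i]))
    obtain ⟨h1, h2⟩ := hmem i hi s hs
    exact mv _ _ ((hcm _ ⟨h2.1, h2.2.trans hT1⟩).1.trans hcm') (hωv _ s h1)
  have hx00 : x 0 = x0 := hx.initial ht₁
  have hz0 : z 0 = d.Cm ⬝ᵥ x0 := by rw [hz]; simp [hx00]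
  -- The predictor starts from C_m† z(0), so its initial error has zero output; −B_o e[0] equals
  -- ξ(0), which makes ζ start at zero.
  have he0 : e 0 = -((1 - vecMulVec d.CmDag d.Cm) *ᵥ x0) := by
    have : d.predictor T z r 0 = z 0 • d.CmDag := rfl
    rw [he]
    simp only [this, hz0, Nat.cast_zero, zero_mul, hx00]
    rw [sub_mulVec, one_mulVec, vecMulVec_mulVec, op_smul_eq_smul]
    abel
  have hCe0 : d.Cm ⬝ᵥ e 0 = 0 := by
    rw [he0, dotProduct_neg, sub_mulVec, one_mulVec, vecMulVec_mulVec, op_smul_eq_smul, hd.Cm_sub,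
      neg_zero]
  have hpb := hpred T hT hT1 N e W (by rw [he0, norm_neg]; exact mv _ _ le_rfl hx0) hCe0 hWb
    (fun i hi => (hrec i hi).1)
  have hσ : ∀ i ≤ N, ‖d.sigmaHat T (d.Cm ⬝ᵥ e i)‖ ≤ s := by
    intro i hi
    have h1 := norm_holdM_mulVec_ge hT hholdm hcT (d.sigmaHat T (d.Cm ⬝ᵥ e i))
    rw [hd.holdM_mulVec_sigmaHat hunit, norm_neg, norm_smul, Real.norm_eq_abs] at h1
    have h2 := mul_le_mul (hpb i hi).2 (mv (expM d.Am T) d.adaptDir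
      ((hcm T hTm).1.trans hcm') le_rfl) (norm_nonneg _) (by positivity)
    have h3 := h1.trans h2
    have h4 : T / 2 * ‖d.sigmaHat T (d.Cm ⬝ᵥ e i)‖ ≤ T / 2 * s := by
      refine h3.trans (le_of_eq ?_)
      rw [hs]; ring
    exact le_of_mul_le_mul_left h4 (by positivity)
  -- To first order σ̂ enters x_u and B_o e alike and cancels, while −B_o e brings in the true
  -- disturbance, to be matched by the input of ξ.
  set ζ : ℕ → Fin k → ℝ := fun i => d.ctrlLaw T z r i - d.ctl.B *ᵥ e i - ξ (i * T) with hζ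
  have hξ0 : ξ 0 = d.V *ᵥ x0 := hξ.initial ht₁
  have hζ0 : ζ 0 = 0 := by
    have : d.ctrlLaw T z r 0 = 0 := rfl
    simp only [hζ, this, he0, Nat.cast_zero, zero_mul, hξ0]
    rw [V, ← mulVec_mulVec, mulVec_neg]
    abel
  have hωo := intervalIntegrable_smul_const hωi (d.ctl.B *ᵥ d.Bm)
  have hζstep : ∀ i < N, ‖ζ (i + 1) - expM d.ctl.A T *ᵥ ζ i‖ ≤ K₁ * T * T := by
    intro i hi
    obtain ⟨-, hinn, he1⟩ := hrec i hi
    set σ := d.sigmaHat T (d.Cm ⬝ᵥ e i)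
    set Ξ := ∫ s in (i * T)..((i + 1 : ℕ) * T),
      expM d.ctl.A ((i + 1 : ℕ) * T - s) *ᵥ (ω s • (d.ctl.B *ᵥ d.Bm)) with hΞ
    have h0 : (0 : ℝ) ≤ i * T := by positivity
    have hξ1 : ξ ((i + 1 : ℕ) * T) = expM d.ctl.A T *ᵥ ξ (i * T) + Ξ := by
      have := hξ.eq_step hωo h0 (hle i) (hidx i hi)
      rwa [show ((i + 1 : ℕ) : ℝ) * T - i * T = T by push_cast; ring] at this
    have h1 : ζ (i + 1) - expM d.ctl.A T *ᵥ ζ i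
        = expM d.ctl.A T *ᵥ (d.ctl.B *ᵥ e i) - d.ctl.B *ᵥ (expM d.Am T *ᵥ e i)
          + (holdM d.ctl.A T *ᵥ (d.ctl.B *ᵥ (expM d.Am (-T) *ᵥ σ))
            - d.ctl.B *ᵥ (holdM d.Am T *ᵥ σ)) + (d.ctl.B *ᵥ W i - Ξ) := by
      simp only [hζ]
      rw [he1, ctrlLaw_succ, hinn, hξ1]
      simp only [mulVec_sub, mulVec_add]
      abel
    rw [h1]
    have hωi' : IntervalIntegrable ω volume (i * T) ((i + 1 : ℕ) * T) :=
      (hωi.restrict_right ⟨h0, (hle i).trans (hidx i hi)⟩).symm.trans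
        (hωi.restrict_right ⟨h0.trans (hle i), hidx i hi⟩)
    have hWΞ : ‖d.ctl.B *ᵥ W i - Ξ‖ ≤ 2 * c * B * (‖d.Bm‖ * w) * T * T := by
      have hI1 := intervalIntegrable_expM_mulVec d.Am ((i + 1 : ℕ) * T)
        (intervalIntegrable_smul_const hωi' d.Bm)
      have hI2 := intervalIntegrable_expM_mulVec d.ctl.A ((i + 1 : ℕ) * T)
        (intervalIntegrable_smul_const hωi' (d.ctl.B *ᵥ d.Bm))
      have hI3 : IntervalIntegrable (fun s => d.ctl.B *ᵥ (expM d.Am ((i + 1 : ℕ) * T - s)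
          *ᵥ (ω s • d.Bm))) volume (i * T) ((i + 1 : ℕ) * T) :=
        intervalIntegrable_mulVec (Φ := fun _ => d.ctl.B) (fun _ _ => continuous_const) hI1
      simp only [hW, hΞ]
      rw [mulVec_intervalIntegral _ hI1, ← intervalIntegral.integral_sub hI3 hI2]
      refine (intervalIntegral.norm_integral_le_of_norm_le_const
        (C := 2 * c * B * (‖d.Bm‖ * w) * T) fun s hs => ?_).trans (le_of_eq (by rw [hlen i]))
      obtain ⟨h1, h2⟩ := hmem i hi s hs
      set τ := ((i + 1 : ℕ) : ℝ) * T - s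
      have hτ : τ ∈ Set.Icc (0 : ℝ) 1 := ⟨h2.1, h2.2.trans hT1⟩
      have e2 : d.ctl.B *ᵥ (expM d.Am τ *ᵥ (ω s • d.Bm))
          - expM d.ctl.A τ *ᵥ (ω s • (d.ctl.B *ᵥ d.Bm))
          = d.ctl.B *ᵥ ((expM d.Am τ - 1) *ᵥ (ω s • d.Bm))
            - (expM d.ctl.A τ - 1) *ᵥ (d.ctl.B *ᵥ (ω s • d.Bm)) := by
        simp only [sub_mulVec, mulVec_sub, one_mulVec, mulVec_smul, smul_sub]
        abel
      rw [e2]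
      have hm1 : ‖expM d.Am τ - 1‖ ≤ c * T :=
        (mono (hcm τ hτ).2.1 hcm' hτ.1).trans (mul_le_mul_of_nonneg_left h2.2 hc0)
      have ho1 : ‖expM d.ctl.A τ - 1‖ ≤ c * T :=
        (mono (hco τ hτ).2.1 hco' hτ.1).trans (mul_le_mul_of_nonneg_left h2.2 hc0)
      have n1 := mv d.ctl.B _ le_rfl (mv _ _ hm1 (hωv d.Bm s h1))
      have n2 := mv _ _ ho1 (mv d.ctl.B _ le_rfl (hωv d.Bm s h1))
      refine (norm_sub_le _ _).trans ((add_le_add n1 n2).trans (le_of_eq ?_))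
      rw [hB]; ring
    have hcn1 := hcn T hTm
    rw [expM_neg_matrix] at hcn1
    have hmain := deviation_step (Ξ := Ξ) (W := W i) (b := b) hT.le
      (mono (hcm T hTm).2.2 hcm' (sq_nonneg T)) (mono (hco T hTm).2.2 hco' (sq_nonneg T))
      hholdm hholdo (hcn1.1.trans hcn') (mono hcn1.2.1 hcn' hT.le)
      (hd.sylvester (e i)) (hpb i hi.le).2 (hpb i hi.le).1 (hσ i hi.le)
    refine hmain.trans ((add_le_add le_rfl hWΞ).trans (le_of_eq ?_))
    rw [hK₁]; ring
  have hζb := norm_le_of_expM_recursion ha hM hexp hT.le hT1 (by positivity) hζ0 hζstep N le_rfl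
  have h0N : (0 : ℝ) ≤ N * T := by positivity
  have hξb : ‖ξ (N * T)‖ ≤ K₂ := by
    rw [hξ.eq_convolution hωo ⟨h0N, hNt.trans ht.2⟩]
    refine (norm_add_le _ _).trans (add_le_add ?_ ?_)
    · refine mv _ _ ((hexp _ h0N).trans ?_) (mv _ _ le_rfl hx0)
      refine mul_le_of_le_one_right hM.le (Real.exp_le_one_iff.2 ?_)
      have := mul_nonneg ha.le h0N
      linarith
    · exact norm_integral_expM_mulVec_le ha hM hexp h0N fun s hs =>
        hωv _ s ⟨hs.1, hs.2.trans (hNt.trans ht.2)⟩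
  have hξd : ‖ξ (N * T) - ξ t‖ ≤ (c * K₂ + c * β) * T := by
    set τ := t - N * T with hτd
    have hτ0 : 0 ≤ τ := by rw [hτd]; linarith
    have hτT : τ ≤ T := by rw [hτd]; linarith
    have hτ : τ ∈ Set.Icc (0 : ℝ) 1 := ⟨hτ0, hτT.trans hT1⟩
    have h1 := hξ.eq_step hωo h0N hNt ht.2
    have h2 : ξ t - ξ (N * T) = (expM d.ctl.A τ - 1) *ᵥ ξ (N * T)
        + ∫ s in (N * T)..t, expM d.ctl.A (t - s) *ᵥ (ω s • (d.ctl.B *ᵥ d.Bm)) := by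
      rw [h1, sub_mulVec, one_mulVec]; abel
    rw [norm_sub_rev, h2]
    have n1 := mv (expM d.ctl.A τ - 1) (ξ (N * T)) ((mono (hco τ hτ).2.1 hco' hτ0).trans
      (mul_le_mul_of_nonneg_left hτT hc0)) hξb
    have n2 : ‖∫ s in (N * T)..t, expM d.ctl.A (t - s) *ᵥ (ω s • (d.ctl.B *ᵥ d.Bm))‖
        ≤ c * β * |t - N * T| := by
      refine intervalIntegral.norm_integral_le_of_norm_le_const fun s hs => ?_
      rw [Set.uIoc_of_le hNt] at hs
      refine mv _ _ ((hco _ ⟨by linarith [hs.2], ?_⟩).1.trans hco')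
        (hωv _ s ⟨h0N.trans hs.1.le, hs.2.trans ht.2⟩)
      linarith [hs.1]
    rw [abs_of_nonneg hτ0] at n2
    refine (norm_add_le _ _).trans ((add_le_add n1 (n2.trans
      (mul_le_mul_of_nonneg_left hτT (by positivity)))).trans (le_of_eq ?_))
    ring
  have hsplit : (d.ctl.C *ᵥ d.ctrlLaw T z r N) 0 - (d.ctl.C *ᵥ ξ t) 0
      = d.ctl.C 0 ⬝ᵥ ζ N + (d.Cm ⬝ᵥ e N) * (d.ctl.C *ᵥ (d.ctl.B *ᵥ d.CmDag)) 0
        + d.ctl.C 0 ⬝ᵥ (ξ (N * T) - ξ t) := by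
    have h1 := congrFun (hd.ctl_C_B (e N)) 0
    rw [Pi.smul_apply, smul_eq_mul] at h1
    rw [← h1]
    simp only [hζ, mulVec, dotProduct_sub]
    ring
  rw [hsplit]
  refine (abs_add_le _ _).trans ?_
  have n1 := (abs_dotProduct_le (d.ctl.C 0) (ζ N)).trans (mul_le_mul_of_nonneg_left hζb hm0)
  have n2 : |(d.Cm ⬝ᵥ e N) * (d.ctl.C *ᵥ (d.ctl.B *ᵥ d.CmDag)) 0| ≤ R * T * D := by
    rw [abs_mul]
    exact mul_le_mul_of_nonneg_right (hpb N le_rfl).2 (abs_nonneg _)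
  have n3 := (abs_dotProduct_le (d.ctl.C 0) (ξ (N * T) - ξ t)).trans
    (mul_le_mul_of_nonneg_left hξd hm0)
  refine (add_le_add ((abs_add_le _ _).trans (add_le_add n1 n2)) n3).trans (le_of_eq ?_)
  ring

end Design
end
end L1Aug

namespace L1Aug

noncomputable section

/-! ### ℒ₁ gains, cascades and first exit. -/

section Gain

set_option linter.unusedSectionVars false

variable {ι p m : Type} [Fintype ι] [DecidableEq ι] [Fintype p] [Fintype m]

lemma HasL1Norm.nonneg {p m : Type} [Fintype m] {G : Matrix p m (RatFunc ℝ)} {c : ℝ} (h : HasL1Norm G c) : 0 ≤ c := by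
  obtain ⟨D, g, -, -, rfl⟩ := h
  exact Real.iSup_nonneg fun i => Finset.sum_nonneg fun j _ =>
    add_nonneg (abs_nonneg _) (integral_nonneg fun t => abs_nonneg _)

/-- The `ℒ₁` norm bounds the gain from `L∞` to `L∞` of every realization. -/
lemma HasL1Norm.norm_le {G : Matrix p m (RatFunc ℝ)} {c : ℝ} (h : HasL1Norm G c)
    {C : Matrix p ι ℝ} {A : Matrix ι ι ℝ} {B : Matrix ι m ℝ} {D : Matrix p m ℝ}
    (hG : const C * resolvent A * const B + const D = G) {t b : ℝ} (ht : 0 ≤ t) {w : m → ℝ}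
    (hw : ‖w‖ ≤ b) {v : ℝ → m → ℝ} (hv : IntervalIntegrable v volume 0 t)
    (hb : ∀ s ∈ Set.Icc 0 t, ‖v s‖ ≤ b) :
    ‖D *ᵥ w + ∫ s in (0 : ℝ)..t, C *ᵥ (expM A (t - s) *ᵥ (B *ᵥ v s))‖ ≤ c * b := by
  have hb0 : 0 ≤ b := (norm_nonneg _).trans hw
  have hc0 := h.nonneg
  obtain ⟨D', g, hg, hint, hc⟩ := h
  obtain ⟨hD, hg'⟩ := hg.eq_realization hG
  rw [hD] at hc
  have hcont : ∀ i j, Continuous fun s => g s i j := by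
    intro i j
    have e : (fun s => g s i j) = fun s => ∑ l, (C * expM A s) i l * B l j := by
      funext s; rw [hg', Matrix.mul_apply]; rfl
    rw [e]
    exact continuous_finsetSum _ fun l _ => (continuous_mul_expM_apply A C i l).mul_const _
  have hcont' : ∀ i j, Continuous fun s => g (t - s) i j := fun i j =>
    (hcont i j).comp (continuous_const.sub continuous_id)
  have e1 : (fun s => C *ᵥ (expM A (t - s) *ᵥ (B *ᵥ v s))) = fun s => g (t - s) *ᵥ v s := by
    funext s; rw [hg', mulVec_mulVec, mulVec_mulVec]; rfl
  rw [e1, pi_norm_le_iff_of_nonneg (mul_nonneg hc0 hb0)]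
  intro i
  have hgi : ∀ j, ∫ s in (0 : ℝ)..t, |g (t - s) i j| ≤ ∫ s in Set.Ioi (0 : ℝ), |g s i j| := by
    intro j
    rw [intervalIntegral.integral_comp_sub_left (fun s => |g s i j|) t, sub_self, sub_zero,
      intervalIntegral.integral_of_le ht]
    exact setIntegral_mono_set (hint i j).abs (Eventually.of_forall fun s => abs_nonneg _)
      (Eventually.of_forall fun s hs => hs.1)
  have h1 : |(D *ᵥ w) i| ≤ (∑ j, |D i j|) * b :=
    (Design.abs_dotProduct_le _ _).trans (mul_le_mul_of_nonneg_left hw (by positivity))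
  have h2 : |∫ s in (0 : ℝ)..t, (g (t - s) *ᵥ v s) i|
      ≤ (∑ j, ∫ s in Set.Ioi (0 : ℝ), |g s i j|) * b := by
    have hii : ∀ j, IntervalIntegrable (fun s => |g (t - s) i j|) volume 0 t := fun j =>
      (hcont' i j).abs.intervalIntegrable _ _
    have h3 : |∫ s in (0 : ℝ)..t, (g (t - s) *ᵥ v s) i|
        ≤ ∫ s in (0 : ℝ)..t, (∑ j, |g (t - s) i j|) * b := by
      rw [← Real.norm_eq_abs]
      refine intervalIntegral.norm_integral_le_of_norm_le ht (Eventually.of_forall fun s hs => ?_)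
        ?_
      · exact (Design.abs_dotProduct_le _ _).trans
          (mul_le_mul_of_nonneg_left (hb s ⟨hs.1.le, hs.2⟩) (by positivity))
      · exact ((continuous_finsetSum _ fun j _ => (hcont' i j).abs).mul_const b).intervalIntegrable
          _ _
    refine h3.trans ?_
    rw [intervalIntegral.integral_mul_const, intervalIntegral.integral_finsetSum fun j _ => hii j]
    exact mul_le_mul_of_nonneg_right (Finset.sum_le_sum fun j _ => hgi j) hb0
  have h4 : ∑ j, (|D i j| + ∫ s in Set.Ioi (0 : ℝ), |g s i j|) ≤ c := by
    rw [hc]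
    exact le_ciSup (f := fun i => ∑ j, (|D i j| + ∫ s in Set.Ioi (0 : ℝ), |g s i j|))
      (Set.finite_range _).bddAbove i
  rw [Pi.add_apply, intervalIntegral_apply (intervalIntegrable_mulVec hcont' hv)]
  calc |(D *ᵥ w) i + ∫ s in (0 : ℝ)..t, (g (t - s) *ᵥ v s) i|
      ≤ (∑ j, |D i j|) * b + (∑ j, ∫ s in Set.Ioi (0 : ℝ), |g s i j|) * b :=
        (abs_add_le _ _).trans (add_le_add h1 h2)
    _ = (∑ j, (|D i j| + ∫ s in Set.Ioi (0 : ℝ), |g s i j|)) * b := by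
        rw [Finset.sum_add_distrib, add_mul]
    _ ≤ c * b := mul_le_mul_of_nonneg_right h4 hb0

/-- A linear image of the solution of a linear equation. -/
lemma SolvesLinear.map {κ : Type} [Fintype κ] [DecidableEq κ] {A : Matrix ι ι ℝ} {f : ℝ → ι → ℝ}
    {y0 : ι → ℝ} {T : ℝ} {y : ℝ → ι → ℝ} (h : SolvesLinear A f y0 T y)
    (hf : IntervalIntegrable f volume 0 T) {L N : Matrix κ ι ℝ} {A' : Matrix κ κ ℝ}
    (hL : L * A = A' * L + N) :
    SolvesLinear A' (fun s => N *ᵥ y s + L *ᵥ f s) (L *ᵥ y0) T (fun t => L *ᵥ y t) := by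
  refine ⟨(LinearMap.continuous_of_finiteDimensional (Matrix.mulVecLin L)).comp_continuousOn h.1,
    fun t ht => ?_⟩
  have hy : IntervalIntegrable y volume 0 t := ContinuousOn.intervalIntegrable (by
    rw [Set.uIcc_of_le ht.1]; exact h.1.mono (Set.Icc_subset_Icc_right ht.2))
  have hA : IntervalIntegrable (fun s => A *ᵥ y s) volume 0 t :=
    intervalIntegrable_mulVec (Φ := fun _ => A) (fun _ _ => continuous_const) hy
  simp only
  rw [h.2 t ht, mulVec_add, mulVec_intervalIntegral L (hA.add (hf.restrict_right ht))]
  congr 2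
  funext s
  rw [mulVec_add, mulVec_mulVec, hL, add_mulVec, ← mulVec_mulVec, add_assoc]

/-- A continuous function that stays below a level as long as it does not exceed it. -/
lemma lt_of_continuousOn_of_lt {f : ℝ → ℝ} {τ δ : ℝ} (hf : ContinuousOn f (Set.Icc 0 τ))
    (h0 : f 0 < δ)
    (h : ∀ t ∈ Set.Icc 0 τ, (∀ s ∈ Set.Icc 0 t, f s ≤ δ) → f t < δ) :
    ∀ t ∈ Set.Icc 0 τ, f t < δ := by
  by_contra! hcon
  obtain ⟨t, ht, hft⟩ := hcon
  have hclosed : IsClosed (Set.Icc 0 τ ∩ f ⁻¹' Set.Ici δ) :=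
    hf.preimage_isClosed_of_isClosed isClosed_Icc isClosed_Ici
  have hcomp : IsCompact (Set.Icc 0 τ ∩ f ⁻¹' Set.Ici δ) :=
    isCompact_Icc.of_isClosed_subset hclosed Set.inter_subset_left
  obtain ⟨t₀, ⟨ht₀, hft₀⟩, hmin⟩ := hcomp.exists_isLeast ⟨t, ht, hft⟩
  obtain ⟨s, hs, hfs⟩ := intermediate_value_Icc ht₀.1
    (hf.mono (Set.Icc_subset_Icc_right ht₀.2)) ⟨h0.le, hft₀⟩
  have hst : t₀ ≤ s := hmin ⟨⟨hs.1, hs.2.trans ht₀.2⟩, hfs.ge⟩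
  have hs' : s = t₀ := le_antisymm hs.2 hst
  subst hs'
  refine absurd (h s ht₀ fun r hr => ?_) (not_lt.2 hft₀)
  by_contra! hr'
  exact absurd (hmin ⟨⟨hr.1, hr.2.trans ht₀.2⟩, hr'.le⟩) (not_le.2 (lt_of_le_of_ne hr.2 (by
    rintro rfl; linarith)))

end Gain

/-! ### Regularity of the uncertainty. -/

namespace IsUncertainty

variable {n : ℕ} {F : ℝ → ℝ} {L0 : ℝ} {σ : (Fin (n + 1) → ℝ) → ℝ → ℝ}

lemma nonneg_lipschitz (h : IsUncertainty F L0 σ) {δ : ℝ} (hδ : 0 < δ) : 0 ≤ F δ := by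
  have h1 := h.lipschitz δ hδ 0 (fun _ => δ) (by simpa using hδ.le)
    (by rw [pi_norm_const, Real.norm_eq_abs, abs_of_pos hδ]) 0 le_rfl
  rw [sub_zero, pi_norm_const, Real.norm_eq_abs, abs_of_pos hδ] at h1
  by_contra! hF
  nlinarith [abs_nonneg (σ (fun _ => δ) 0 - σ 0 0)]

lemma continuous (h : IsUncertainty F L0 σ) {t : ℝ} (ht : 0 ≤ t) : Continuous fun x => σ x t := by
  refine continuous_iff_continuousAt.2 fun x => ?_
  have hδ : 0 < ‖x‖ + 1 := by positivity
  have hball : ∀ᶠ y in 𝓝 x, ‖y‖ ≤ ‖x‖ + 1 :=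
    (continuous_norm.continuousAt.eventually (gt_mem_nhds (lt_add_one ‖x‖))).mono fun y hy => hy.le
  rw [ContinuousAt, tendsto_iff_dist_tendsto_zero]
  refine squeeze_zero' (g := fun y => F (‖x‖ + 1) * ‖y - x‖)
    (Eventually.of_forall fun _ => dist_nonneg)
    (hball.mono fun y hy => h.lipschitz _ hδ x y (by linarith) hy t ht) ?_
  have : Continuous fun y : Fin (n + 1) → ℝ => F (‖x‖ + 1) * ‖y - x‖ := by fun_prop
  simpa using this.tendsto x

end IsUncertainty

/-! ### The state as a response to disturbance, command and initial value. -/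

namespace Design

variable {n k : ℕ} {d : Design n k}

/-- The matched disturbance `K x + σ(x, t)` along a trajectory. -/
def disturbance (d : Design n k) (σ : (Fin (n + 1) → ℝ) → ℝ → ℝ) (x : ℝ → Fin (n + 1) → ℝ)
    (s : ℝ) : ℝ := d.K ⬝ᵥ x s + σ (x s) s

section Disturbance

variable {F : ℝ → ℝ} {L0 : ℝ} {σ : (Fin (n + 1) → ℝ) → ℝ → ℝ} {x y : ℝ → Fin (n + 1) → ℝ} {δ : ℝ}

lemma abs_disturbance_sub_le (hσ : IsUncertainty F L0 σ) (hδ : 0 < δ) {s : ℝ} (hs : 0 ≤ s)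
    (hx : ‖x s‖ ≤ δ) (hy : ‖y s‖ ≤ δ) :
    |d.disturbance σ y s - d.disturbance σ x s| ≤ (F δ + ∑ j, |d.K j|) * ‖y s - x s‖ := by
  have h1 := hσ.lipschitz δ hδ _ _ hx hy s hs
  have h2 := abs_dotProduct_le d.K (y s - x s)
  have e : d.disturbance σ y s - d.disturbance σ x s
      = d.K ⬝ᵥ (y s - x s) + (σ (y s) s - σ (x s) s) := by
    rw [disturbance, disturbance, dotProduct_sub]; ring
  rw [e, add_mul]
  linarith [abs_add_le (d.K ⬝ᵥ (y s - x s)) (σ (y s) s - σ (x s) s)]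

lemma abs_disturbance_le (hσ : IsUncertainty F L0 σ) (hδ : 0 < δ) {s : ℝ} (hs : 0 ≤ s)
    (hx : ‖x s‖ ≤ δ) :
    |d.disturbance σ x s| ≤ (F δ + ∑ j, |d.K j|) * δ + L0 := by
  have h1 := abs_disturbance_sub_le (d := d) (x := fun _ => 0) (y := x) hσ hδ hs (by simpa using hδ.le) hx
  have h2 := hσ.bounded s hs
  have h3 : d.disturbance σ (fun _ => 0) s = σ 0 s := by simp [disturbance]
  have hF : 0 ≤ F δ + ∑ j, |d.K j| := add_nonneg (hσ.nonneg_lipschitz hδ) (by positivity)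
  rw [h3, sub_zero] at h1
  have h4 := mul_le_mul_of_nonneg_left hx hF
  linarith [abs_add_le (d.disturbance σ x s - σ 0 s) (σ 0 s),
    congrArg abs (sub_add_cancel (d.disturbance σ x s) (σ 0 s))]

/-- Continuity in the state and measurability in time give joint measurability. Time is clamped, to
[0,t] in x and to nonnegative values in σ, because the continuity hypotheses hold only there. -/
lemma intervalIntegrable_disturbance (hσ : IsUncertainty F L0 σ) {t : ℝ} (ht : 0 ≤ t)
    (hx : ContinuousOn x (Set.Icc 0 t)) : IntervalIntegrable (d.disturbance σ x) volume 0 t := by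
  set x' : ℝ → Fin (n + 1) → ℝ := fun s => x (max 0 (min s t)) with hx'
  have hxc : Continuous x' := hx.comp_continuous (by fun_prop)
    fun s => ⟨le_max_left _ _, max_le ht (min_le_right _ _)⟩
  have heq : ∀ s ∈ Set.Icc 0 t, x' s = x s := fun s hs => by
    rw [hx']; simp only; rw [min_eq_left hs.2, max_eq_right hs.1]
  have hσ' : Measurable
      (Function.uncurry fun (p : Fin (n + 1) → ℝ) (s : ℝ) => σ p (max s 0)) :=
    measurable_uncurry_of_continuous_of_measurable (fun s => hσ.continuous (le_max_right s 0))
      fun p => (hσ.measurable p).comp (measurable_id.max measurable_const)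
  have hmeas : Measurable fun s => d.K ⬝ᵥ x' s + σ (x' s) (max s 0) := by
    refine Measurable.add ?_ (hσ'.comp (hxc.measurable.prodMk measurable_id))
    exact (Continuous.dotProduct continuous_const hxc).measurable
  have heq' : ∀ s ∈ Set.Icc 0 t, d.K ⬝ᵥ x' s + σ (x' s) (max s 0) = d.disturbance σ x s := by
    intro s hs
    rw [heq s hs, max_eq_left hs.1, disturbance]
  obtain ⟨b, hb⟩ := isCompact_Icc.exists_bound_of_continuousOn hx
  have hb1 : 0 < max b 1 := lt_max_of_lt_right one_pos
  have hint := intervalIntegrable_of_bounded ht hmeas fun s hs => by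
    rw [heq' s hs]
    exact abs_disturbance_le hσ hb1 hs.1 ((hb s hs).trans (le_max_left _ _))
  refine hint.congr fun s hs => heq' s ?_
  rw [Set.uIoc_of_le ht] at hs
  exact ⟨hs.1.le, hs.2⟩

end Disturbance

lemma replicateCol_mulVec_const {p : Type} (v : p → ℝ) (a : ℝ) :
    (replicateCol (Fin 1) v *ᵥ fun _ => a) = a • v := by
  ext i; simp [mulVec, dotProduct, mul_comm]

/-- The state of the plant as a function of the disturbance `ω`, of the command `q` and of the
initial state, when the control law cancels the filtered disturbance exactly. -/
def response (d : Design n k) (ω q : ℝ → ℝ) (x0 : Fin (n + 1) → ℝ) (t : ℝ) : Fin (n + 1) → ℝ :=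
  CG n k *ᵥ (expM d.AG t *ᵥ (d.IG *ᵥ x0))
    + (∫ s in (0 : ℝ)..t, CG n k *ᵥ (expM d.AG (t - s) *ᵥ (d.BG *ᵥ fun _ => ω s)))
    + ∫ s in (0 : ℝ)..t, (1 : Matrix (Fin (n + 1)) (Fin (n + 1)) ℝ) *ᵥ
        (expM d.Am (t - s) *ᵥ (replicateCol (Fin 1) d.Bm *ᵥ fun _ => q s))

lemma intervalIntegrable_fun_const {ω : ℝ → ℝ} {a b : ℝ} (h : IntervalIntegrable ω volume a b) :
    IntervalIntegrable (fun s => (fun _ => ω s : Fin 1 → ℝ)) volume a b :=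
  intervalIntegrable_pi fun _ => h

lemma intervalIntegrable_realization {ι p m : Type} [Fintype ι] [DecidableEq ι] [Fintype p]
    [Fintype m] (C : Matrix p ι ℝ) (A : Matrix ι ι ℝ) (B : Matrix ι m ℝ) {v : ℝ → m → ℝ} {a b : ℝ}
    (c : ℝ) (h : IntervalIntegrable v volume a b) :
    IntervalIntegrable (fun s => C *ᵥ (expM A (c - s) *ᵥ (B *ᵥ v s))) volume a b :=
  intervalIntegrable_mulVec (Φ := fun _ => C) (fun _ _ => continuous_const)
    (intervalIntegrable_expM_mulVec A c
      (intervalIntegrable_mulVec (Φ := fun _ => B) (fun _ _ => continuous_const) h))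

lemma response_sub {ω ω' q q' : ℝ → ℝ} {t : ℝ} (hω : IntervalIntegrable ω volume 0 t)
    (hω' : IntervalIntegrable ω' volume 0 t) (hq : IntervalIntegrable q volume 0 t)
    (hq' : IntervalIntegrable q' volume 0 t) (x0 : Fin (n + 1) → ℝ) :
    d.response ω q x0 t - d.response ω' q' x0 t
      = d.response (fun s => ω s - ω' s) (fun s => q s - q' s) 0 t := by
  have e : ∀ f g : ℝ → ℝ, (fun s => (fun _ => f s - g s : Fin 1 → ℝ))
      = fun s => (fun _ => f s) - (fun _ => g s) := fun f g => rfl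
  have e1 : (∫ s in (0 : ℝ)..t, CG n k *ᵥ (expM d.AG (t - s) *ᵥ (d.BG *ᵥ fun _ => ω s - ω' s)))
      = (∫ s in (0 : ℝ)..t, CG n k *ᵥ (expM d.AG (t - s) *ᵥ (d.BG *ᵥ fun _ => ω s)))
        - ∫ s in (0 : ℝ)..t, CG n k *ᵥ (expM d.AG (t - s) *ᵥ (d.BG *ᵥ fun _ => ω' s)) := by
    rw [← intervalIntegral.integral_sub
      (intervalIntegrable_realization _ _ _ t (intervalIntegrable_fun_const hω))
      (intervalIntegrable_realization _ _ _ t (intervalIntegrable_fun_const hω'))]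
    simp only [← mulVec_sub]
    rfl
  have e2 : (∫ s in (0 : ℝ)..t, (1 : Matrix (Fin (n + 1)) (Fin (n + 1)) ℝ) *ᵥ
        (expM d.Am (t - s) *ᵥ (replicateCol (Fin 1) d.Bm *ᵥ fun _ => q s - q' s)))
      = (∫ s in (0 : ℝ)..t, (1 : Matrix (Fin (n + 1)) (Fin (n + 1)) ℝ) *ᵥ
        (expM d.Am (t - s) *ᵥ (replicateCol (Fin 1) d.Bm *ᵥ fun _ => q s)))
        - ∫ s in (0 : ℝ)..t, (1 : Matrix (Fin (n + 1)) (Fin (n + 1)) ℝ) *ᵥ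
        (expM d.Am (t - s) *ᵥ (replicateCol (Fin 1) d.Bm *ᵥ fun _ => q' s)) := by
    rw [← intervalIntegral.integral_sub
      (intervalIntegrable_realization _ _ _ t (intervalIntegrable_fun_const hq))
      (intervalIntegrable_realization _ _ _ t (intervalIntegrable_fun_const hq'))]
    simp only [← mulVec_sub]
    rfl
  rw [response, response, response, e1, e2, mulVec_zero, mulVec_zero, mulVec_zero]
  abel

lemma Valid.norm_response_le (hd : d.Valid) {nG nIn nH0 : ℝ}
    (hG : HasL1Norm (replicateCol (Fin 1) d.G) nG) (hIn : HasL1Norm d.Tin nIn)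
    (hH0 : HasL1Norm (replicateCol (Fin 1) d.H0) nH0) {ω q : ℝ → ℝ} {t a b ρ : ℝ} (ht : 0 ≤ t)
    {x0 : Fin (n + 1) → ℝ} (hx0 : ‖x0‖ ≤ ρ)
    (hω : IntervalIntegrable ω volume 0 t) (hq : IntervalIntegrable q volume 0 t)
    (ha : ∀ s ∈ Set.Icc 0 t, |ω s| ≤ a) (hb : ∀ s ∈ Set.Icc 0 t, |q s| ≤ b) :
    ‖d.response ω q x0 t‖ ≤ nIn * ρ + nG * a + nH0 * b := by
  have ha0 : 0 ≤ a := (abs_nonneg _).trans (ha 0 ⟨le_rfl, ht⟩)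
  have hb0 : 0 ≤ b := (abs_nonneg _).trans (hb 0 ⟨le_rfl, ht⟩)
  -- The initial-state response is written as the response of T_in to the constant input x0. This is
  -- why ρ₁ carries the factor s and why the gain bound includes a direct term.
  have h1 : CG n k *ᵥ (expM d.AG t *ᵥ (d.IG *ᵥ x0)) = (1 : Matrix (Fin (n + 1)) (Fin (n + 1)) ℝ) *ᵥ x0
      + ∫ s in (0 : ℝ)..t, (CG n k * d.AG) *ᵥ (expM d.AG (t - s) *ᵥ (d.IG *ᵥ x0)) := by
    have h2 := (solvesLinear_convolution d.AG (f := fun _ => 0) (d.IG *ᵥ x0) ht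
      (continuous_const.intervalIntegrable _ _)).2 t ⟨ht, le_rfl⟩
    simp only [mulVec_zero, intervalIntegral.integral_zero, add_zero] at h2
    have hint : IntervalIntegrable (fun s => d.AG *ᵥ (expM d.AG s *ᵥ (d.IG *ᵥ x0))) volume 0 t :=
      intervalIntegrable_mulVec (Φ := fun _ => d.AG) (fun _ _ => continuous_const)
        (intervalIntegrable_mulVec (continuous_expM_apply d.AG)
          ((continuous_const (y := d.IG *ᵥ x0)).intervalIntegrable _ _))
    rw [h2, mulVec_add, mulVec_intervalIntegral _ hint, intervalIntegral.integral_comp_sub_left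
      (fun s => (CG n k * d.AG) *ᵥ (expM d.AG s *ᵥ (d.IG *ᵥ x0))) t, sub_self, sub_zero]
    congr 1
    · rw [mulVec_mulVec, CG, IG, fromCols_mul_fromRows]; simp
    · simp only [mulVec_mulVec, Matrix.mul_assoc]
  have h3 := hIn.norm_le hd.Tin_realization ht hx0 (v := fun _ => x0)
    (continuous_const.intervalIntegrable _ _) (fun s _ => hx0)
  have h4 := hG.norm_le hd.G_realization ht (w := 0) (by simpa using ha0)
    (intervalIntegrable_fun_const hω) (fun s hs => by
      rw [pi_norm_const]; exact ha s hs)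
  have h5 := hH0.norm_le H0_realization ht (w := 0) (by simpa using hb0)
    (intervalIntegrable_fun_const hq) (fun s hs => by
      rw [pi_norm_const]; exact hb s hs)
  rw [mulVec_zero, zero_add] at h4 h5
  rw [response, h1]
  exact (norm_add_le _ _).trans (add_le_add ((norm_add_le _ _).trans (add_le_add h3 h4)) h5)

/-- In the cascade A_G the lower block reproduces ξ by uniqueness, and the upper block is the plant
driven by ω − C_o ξ. The input q is added by linearity. -/
lemma eq_response {ω q : ℝ → ℝ} {τ : ℝ} {x0 : Fin (n + 1) → ℝ} {x : ℝ → Fin (n + 1) → ℝ}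
    {ξ : ℝ → Fin k → ℝ} (hω : IntervalIntegrable ω volume 0 τ)
    (hq : IntervalIntegrable q volume 0 τ)
    (hξ : SolvesLinear d.ctl.A (fun s => ω s • (d.ctl.B *ᵥ d.Bm)) (d.V *ᵥ x0) τ ξ)
    (hx : SolvesLinear d.Am (fun s => (q s - (d.ctl.C *ᵥ ξ s) 0 + ω s) • d.Bm) x0 τ x) {t : ℝ}
    (ht : t ∈ Set.Icc 0 τ) : x t = d.response ω q x0 t := by
  have hτ : 0 ≤ τ := ht.1.trans ht.2
  have hf : IntervalIntegrable (fun s => d.BG *ᵥ (fun _ => ω s : Fin 1 → ℝ)) volume 0 τ :=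
    intervalIntegrable_mulVec (Φ := fun _ => d.BG) (fun _ _ => continuous_const)
      (intervalIntegrable_fun_const hω)
  have hZ := solvesLinear_convolution d.AG (d.IG *ᵥ x0) hτ hf
  set Z : ℝ → Fin (n + 1) ⊕ Fin k → ℝ := fun t => expM d.AG t *ᵥ (d.IG *ᵥ x0)
    + ∫ s in (0 : ℝ)..t, expM d.AG (t - s) *ᵥ (d.BG *ᵥ fun _ => ω s) with hZdef
  have hL := hZ.map hf (L := LG n k) (N := 0) (A' := d.ctl.A) (by rw [add_zero, lower_mul_AG])
  have hC := hZ.map hf (L := CG n k) (N := -(replicateCol (Fin 1) d.Bm * d.ctl.C * LG n k))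
    (A' := d.Am) (by rw [CG_mul_AG, sub_eq_add_neg])
  have e1 : ∀ s, LG n k *ᵥ (d.BG *ᵥ (fun _ => ω s : Fin 1 → ℝ)) = ω s • (d.ctl.B *ᵥ d.Bm) := by
    intro s
    rw [mulVec_mulVec, LG, BG, fromCols_mul_fromRows, Matrix.zero_mul, Matrix.one_mul, zero_add,
      ← mulVec_mulVec, replicateCol_mulVec_const, mulVec_smul]
  have e2 : LG n k *ᵥ (d.IG *ᵥ x0) = d.V *ᵥ x0 := by
    rw [mulVec_mulVec, LG, IG, fromCols_mul_fromRows]; simp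
  have e3 : ∀ s, CG n k *ᵥ (d.BG *ᵥ (fun _ => ω s : Fin 1 → ℝ)) = ω s • d.Bm := by
    intro s
    rw [mulVec_mulVec, CG, BG, fromCols_mul_fromRows, Matrix.zero_mul, Matrix.one_mul, add_zero,
      replicateCol_mulVec_const]
  have e4 : CG n k *ᵥ (d.IG *ᵥ x0) = x0 := by
    rw [mulVec_mulVec, CG, IG, fromCols_mul_fromRows]; simp
  simp only [zero_mulVec, zero_add, e1, e2] at hL
  simp only [e3, e4] at hC
  have hωB : IntervalIntegrable (fun s => ω s • (d.ctl.B *ᵥ d.Bm)) volume 0 τ :=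
    intervalIntegrable_smul_const hω _
  have hξZ : ∀ s ∈ Set.Icc 0 τ, LG n k *ᵥ Z s = ξ s := fun s hs => by
    rw [hξ.eq_convolution hωB hs]; exact hL.eq_convolution hωB hs
  have e5 : ∀ s ∈ Set.Icc 0 τ, -(replicateCol (Fin 1) d.Bm * d.ctl.C * LG n k) *ᵥ Z s + ω s • d.Bm
      = (ω s - (d.ctl.C *ᵥ ξ s) 0) • d.Bm := by
    intro s hs
    have e6 : d.ctl.C *ᵥ ξ s = fun _ => (d.ctl.C *ᵥ ξ s) 0 := by
      ext i; rw [Subsingleton.elim i 0]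
    rw [neg_mulVec, ← mulVec_mulVec, hξZ s hs, ← mulVec_mulVec, e6, replicateCol_mulVec_const,
      sub_smul]
    abel
  have hCξ : IntervalIntegrable (fun s => (d.ctl.C *ᵥ ξ s) 0) volume 0 τ :=
    (intervalIntegrable_mulVec (Φ := fun _ => d.ctl.C) (fun _ _ => continuous_const)
      (ContinuousOn.intervalIntegrable (by rw [Set.uIcc_of_le hτ]; exact hξ.1))).pi_apply 0
  have hin : IntervalIntegrable (fun s => (ω s - (d.ctl.C *ᵥ ξ s) 0) • d.Bm) volume 0 τ :=
    intervalIntegrable_smul_const (hω.sub hCξ) _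
  have hqB : IntervalIntegrable (fun s => q s • d.Bm) volume 0 τ :=
    intervalIntegrable_smul_const hq _
  have hsub : ∀ s ∈ Set.uIoc 0 τ, s ∈ Set.Icc 0 τ := fun s hs => by
    rw [Set.uIoc_of_le hτ] at hs; exact ⟨hs.1.le, hs.2⟩
  have hin' : IntervalIntegrable (fun s =>
      -(replicateCol (Fin 1) d.Bm * d.ctl.C * LG n k) *ᵥ Z s + ω s • d.Bm) volume 0 τ :=
    hin.congr fun s hs => (e5 s (hsub s hs)).symm
  have e7 : ∀ s, (q s - (d.ctl.C *ᵥ ξ s) 0 + ω s) • d.Bm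
      = (ω s - (d.ctl.C *ᵥ ξ s) 0) • d.Bm + q s • d.Bm := by
    intro s; rw [← add_smul]; congr 1; ring
  have hCt := hC.eq_convolution hin' ht
  have hsubt : ∀ s ∈ Set.uIcc 0 t, s ∈ Set.Icc 0 τ := fun s hs => by
    rw [Set.uIcc_of_le ht.1] at hs; exact ⟨hs.1, hs.2.trans ht.2⟩
  rw [intervalIntegral.integral_congr (g := fun s =>
    expM d.Am (t - s) *ᵥ ((ω s - (d.ctl.C *ᵥ ξ s) 0) • d.Bm)) fun s hs => by
      simp only; rw [e5 s (hsubt s hs)]] at hCt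
  simp only [e7] at hx
  rw [hx.eq_convolution (hin.add hqB) ht]
  simp only [mulVec_add]
  rw [intervalIntegral.integral_add
    (intervalIntegrable_expM_mulVec _ t (hin.restrict_right ht))
    (intervalIntegrable_expM_mulVec _ t (hqB.restrict_right ht)), ← add_assoc, ← hCt, response,
    hZdef]
  simp only [mulVec_add, one_mulVec, replicateCol_mulVec_const]
  rw [mulVec_intervalIntegral _ (intervalIntegrable_expM_mulVec _ t (hf.restrict_right ht))]

end Design
end
end L1Aug

namespace L1Aug

noncomputable section

lemma SolvesLinear.congr {ι : Type} [Fintype ι] {A : Matrix ι ι ℝ} {f g : ℝ → ι → ℝ} {y0 : ι → ℝ}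
    {T : ℝ} {y : ℝ → ι → ℝ} (h : SolvesLinear A f y0 T y) (hfg : ∀ s ∈ Set.Icc 0 T, f s = g s) :
    SolvesLinear A g y0 T y := by
  refine ⟨h.1, fun t ht => ?_⟩
  rw [h.2 t ht, intervalIntegral.integral_congr fun s hs => ?_]
  rw [Set.uIcc_of_le ht.1] at hs
  rw [hfg s ⟨hs.1, hs.2.trans ht.2⟩]

/-! ### Reference system and closed loop in response form. -/

namespace Design

variable {n k : ℕ} {d : Design n k} {F : ℝ → ℝ} {L0 τ : ℝ} {σ : (Fin (n + 1) → ℝ) → ℝ → ℝ}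
  {x : ℝ → Fin (n + 1) → ℝ} {x0 : Fin (n + 1) → ℝ} {u zcmd : ℝ → ℝ}

lemma IsSolution.solvesLinear (h : d.IsSolution τ σ x0 x u) :
    SolvesLinear d.Am (fun s => (u s + d.disturbance σ x s) • d.Bm) x0 τ x := by
  refine ⟨h.1, fun t ht => ?_⟩
  rw [h.2 t ht]
  congr 2
  funext s
  have e : d.Az *ᵥ x s = d.Am *ᵥ x s + (d.K ⬝ᵥ x s) • d.Bm := by
    rw [Az, add_mulVec, vecMulVec_mulVec, op_smul_eq_smul]
  have e' : u s + d.disturbance σ x s = d.K ⬝ᵥ x s + (u s + σ (x s) s) := by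
    simp only [disturbance]; ring
  simp only [e', e]
  rw [add_assoc, ← add_smul]

/-- The state of the filter driven by the disturbance `ω`. -/
def filterState (d : Design n k) (ω : ℝ → ℝ) (x0 : Fin (n + 1) → ℝ) (t : ℝ) : Fin k → ℝ :=
  expM d.ctl.A t *ᵥ (d.V *ᵥ x0)
    + ∫ s in (0 : ℝ)..t, expM d.ctl.A (t - s) *ᵥ (ω s • (d.ctl.B *ᵥ d.Bm))

lemma solvesLinear_filterState {ω : ℝ → ℝ} (hτ : 0 ≤ τ) (hω : IntervalIntegrable ω volume 0 τ)
    (x0 : Fin (n + 1) → ℝ) : SolvesLinear d.ctl.A (fun s => ω s • (d.ctl.B *ᵥ d.Bm)) (d.V *ᵥ x0) τ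
      (d.filterState ω x0) :=
  solvesLinear_convolution _ _ hτ (intervalIntegrable_smul_const hω _)

lemma filterState_sub {ω ω' : ℝ → ℝ} {t : ℝ} (hω : IntervalIntegrable ω volume 0 t)
    (hω' : IntervalIntegrable ω' volume 0 t) (x0 : Fin (n + 1) → ℝ) :
    d.filterState ω x0 t - d.filterState ω' x0 t
      = ∫ s in (0 : ℝ)..t, expM d.ctl.A (t - s) *ᵥ ((ω s - ω' s) • (d.ctl.B *ᵥ d.Bm)) := by
  rw [filterState, filterState, add_sub_add_left_eq_sub, ← intervalIntegral.integral_sub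
    (intervalIntegrable_expM_mulVec _ t (intervalIntegrable_smul_const hω _))
    (intervalIntegrable_expM_mulVec _ t (intervalIntegrable_smul_const hω' _))]
  simp only [← mulVec_sub, ← sub_smul]

/-- Whatever realizations define c and h, uniqueness of impulse responses replaces both by the
single system (A_o, C_o) with inputs B_o B_m and V. -/
lemma IsReference.input_eq (hd : d.Valid) (h : d.IsReference τ σ zcmd x0 x u)
    (hω : IntervalIntegrable (d.disturbance σ x) volume 0 τ) {t : ℝ} (ht : t ∈ Set.Icc 0 τ) :
    u t = zcmd t - (d.ctl.C *ᵥ d.filterState (d.disturbance σ x) x0 t) 0 := by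
  obtain ⟨-, c, g, hc, hg, hu⟩ := h
  obtain ⟨-, hc'⟩ := hc.eq_realization hd.filt_realization
  obtain ⟨-, hg'⟩ := hg.eq_realization hd.Hin_realization
  have hint := intervalIntegrable_expM_mulVec d.ctl.A t
    (intervalIntegrable_smul_const (hω.restrict_right ht) (d.ctl.B *ᵥ d.Bm))
  have hint' : IntervalIntegrable (fun s => d.ctl.C *ᵥ (expM d.ctl.A (t - s) *ᵥ
      (d.disturbance σ x s • (d.ctl.B *ᵥ d.Bm)))) volume 0 t :=
    intervalIntegrable_mulVec (Φ := fun _ => d.ctl.C) (fun _ _ => continuous_const) hint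
  have e1 : ∀ s, c (t - s) 0 0 * (d.K ⬝ᵥ x s + σ (x s) s) = (d.ctl.C *ᵥ (expM d.ctl.A (t - s) *ᵥ
      (d.disturbance σ x s • (d.ctl.B *ᵥ d.Bm)))) 0 := by
    intro s
    have e2 : (d.ctl.C *ᵥ (expM d.ctl.A (t - s) *ᵥ (d.ctl.B *ᵥ d.Bm))) 0 = c (t - s) 0 0 := by
      rw [hc', mulVec_mulVec, ← replicateCol_mulVec]
      rfl
    rw [mulVec_smul, mulVec_smul, Pi.smul_apply, e2, smul_eq_mul, mul_comm, disturbance]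
  rw [hu t ht, filterState, mulVec_add, mulVec_intervalIntegral _ hint, Pi.add_apply,
    intervalIntegral_apply hint', hg', mulVec_mulVec, mulVec_mulVec,
    intervalIntegral.integral_congr fun s _ => e1 s]
  rw [expM]
  ring

lemma IsReference.state_eq (hd : d.Valid) (h : d.IsReference τ σ zcmd x0 x u)
    (hω : IntervalIntegrable (d.disturbance σ x) volume 0 τ)
    (hz : IntervalIntegrable zcmd volume 0 τ) {t : ℝ} (ht : t ∈ Set.Icc 0 τ) :
    x t = d.response (d.disturbance σ x) zcmd x0 t := by
  refine eq_response hω hz (solvesLinear_filterState (ht.1.trans ht.2) hω x0)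
    (h.1.solvesLinear.congr fun s hs => ?_) ht
  rw [h.input_eq hd hω hs]

/-- The part of the control input that does not cancel the filtered disturbance. -/
def residualInput (d : Design n k) (T : ℝ) (z r : ℕ → ℝ) (ω : ℝ → ℝ) (x0 : Fin (n + 1) → ℝ)
    (t : ℝ) : ℝ :=
  d.ctrlInput T z r t + (d.ctl.C *ᵥ d.filterState ω x0 t) 0

lemma intervalIntegrable_residualInput {T : ℝ} (hT : 0 < T) (z r : ℕ → ℝ) {ω : ℝ → ℝ}
    (hτ : 0 ≤ τ) (hω : IntervalIntegrable ω volume 0 τ) (x0 : Fin (n + 1) → ℝ) :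
    IntervalIntegrable (d.residualInput T z r ω x0) volume 0 τ := by
  have h1 : IntervalIntegrable (d.ctrlInput T z r) volume 0 τ :=
    intervalIntegrable_comp_floor hT (fun i => r i - (d.ctl.C *ᵥ (d.ctrlState T z r i).2) 0) hτ
  have h2 : IntervalIntegrable (fun s => (d.ctl.C *ᵥ d.filterState ω x0 s) 0) volume 0 τ :=
    (intervalIntegrable_mulVec (Φ := fun _ => d.ctl.C) (fun _ _ => continuous_const)
      (ContinuousOn.intervalIntegrable (by
        rw [Set.uIcc_of_le hτ]; exact (solvesLinear_filterState hτ hω x0).1))).pi_apply 0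
  exact h1.add h2

lemma IsClosedLoop.state_eq {T : ℝ} {zaug : ℝ → ℝ} (hT : 0 < T)
    (h : d.IsClosedLoop T τ σ zcmd x0 x zaug)
    (hω : IntervalIntegrable (d.disturbance σ x) volume 0 τ) {t : ℝ} (ht : t ∈ Set.Icc 0 τ) :
    x t = d.response (d.disturbance σ x) (d.residualInput T (fun i => d.Cm ⬝ᵥ x (i * T))
      (fun i => zcmd (i * T)) (d.disturbance σ x) x0) x0 t := by
  have hτ := ht.1.trans ht.2
  refine eq_response hω (intervalIntegrable_residualInput hT _ _ hτ hω x0)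
    (solvesLinear_filterState hτ hω x0) (h.1.solvesLinear.congr fun s hs => ?_) ht
  rw [h.2 s hs, residualInput, add_sub_cancel_right]

/-- A first-exit argument. The bound on q is required only while x remains in the ball, since the
control error estimate presupposes a bounded disturbance. -/
lemma Valid.norm_lt_of_eq_response (hd : d.Valid) {nG nIn nH0 δ ρ b : ℝ} {q : ℝ → ℝ}
    (hG : HasL1Norm (replicateCol (Fin 1) d.G) nG) (hIn : HasL1Norm d.Tin nIn)
    (hH0 : HasL1Norm (replicateCol (Fin 1) d.H0) nH0) (hσ : IsUncertainty F L0 σ) (hδ : 0 < δ)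
    (hb : 0 ≤ b) (hx0 : ‖x0‖ ≤ ρ) (hx : ContinuousOn x (Set.Icc 0 τ))
    (hq : IntervalIntegrable q volume 0 τ)
    (hresp : ∀ t ∈ Set.Icc 0 τ, x t = d.response (d.disturbance σ x) q x0 t)
    (hqb : ∀ t ∈ Set.Icc 0 τ, (∀ s ∈ Set.Icc 0 t, ‖x s‖ ≤ δ) → ∀ s ∈ Set.Icc 0 t, |q s| ≤ b)
    (hlt : nIn * ρ + nG * ((F δ + ∑ j, |d.K j|) * δ + L0) + nH0 * b < δ) :
    ∀ t ∈ Set.Icc 0 τ, ‖x t‖ < δ := by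
  intro t' ht'
  have hτ := ht'.1.trans ht'.2
  have hω := intervalIntegrable_disturbance (d := d) hσ hτ hx
  have hF := hσ.nonneg_lipschitz hδ
  have hL0 := (abs_nonneg _).trans (hσ.bounded 0 le_rfl)
  have hw : 0 ≤ (F δ + ∑ j, |d.K j|) * δ + L0 := by positivity
  refine lt_of_continuousOn_of_lt (f := fun t => ‖x t‖) hx.norm ?_ (fun t ht hs => ?_) t' ht'
  · have e : d.response (d.disturbance σ x) q x0 0 = d.response (fun _ => 0) (fun _ => 0) x0 0 := by
      simp [response]
    have h1 := hd.norm_response_le hG hIn hH0 (ω := fun _ => 0) (q := fun _ => 0) le_rfl hx0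
      (continuous_const.intervalIntegrable _ _) (continuous_const.intervalIntegrable _ _)
      (a := 0) (b := 0) (by simp) (by simp)
    rw [hresp 0 ⟨le_rfl, hτ⟩, e]
    have := mul_nonneg hG.nonneg hw
    have := mul_nonneg hH0.nonneg hb
    linarith
  · rw [hresp t ht]
    exact (hd.norm_response_le hG hIn hH0 ht.1 hx0 (hω.restrict_right ht) (hq.restrict_right ht)
      (fun s hs' => abs_disturbance_le hσ hδ hs'.1 (hs s hs')) (hqb t ht hs)).trans_lt hlt


end Design
end
end L1Aug

/-! ### The deviation estimate. -/

open L1Aug L1Aug.Design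

theorem theorem1 {n k : ℕ} (d : L1Aug.Design n k) (hd : d.Valid)
    (F : ℝ → ℝ) (L0 Mr ρ0 ρr γ0 : ℝ) (hγ0 : 0 < γ0) (hρr : 0 < ρr)
    (hL1 : d.L1Condition F L0 Mr ρ0 ρr γ0) :
    ∃ Tmax > (0 : ℝ), ∃ (αx αu : ℝ → ℝ) (κx κu : ℝ),
      Tendsto αx (𝓝[>] 0) (𝓝 0) ∧ Tendsto αu (𝓝[>] 0) (𝓝 0) ∧
      ∀ σ : (Fin (n + 1) → ℝ) → ℝ → ℝ, L1Aug.IsUncertainty F L0 σ →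
      ∀ zcmd : ℝ → ℝ, Measurable zcmd → (∀ t ≥ 0, |zcmd t| ≤ Mr) →
      ∀ x0 : Fin (n + 1) → ℝ, ‖x0‖ ≤ ρ0 →
      ∀ T : ℝ, 0 < T → T ≤ Tmax →
      ∀ ν : ℝ, (∀ t ≥ 0, |zcmd t - zcmd (⌊t / T⌋₊ * T)| ≤ ν) →
      ∀ (τ : ℝ) (x xref : ℝ → Fin (n + 1) → ℝ) (zaug uref : ℝ → ℝ),
        d.IsClosedLoop T τ σ zcmd x0 x zaug →
        d.IsReference τ σ zcmd x0 xref uref →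
        ∀ t ∈ Set.Icc 0 τ,
          ‖xref t - x t‖ ≤ αx T + κx * ν ∧ |uref t - zaug t| ≤ αu T + κu * ν := by
  obtain ⟨nG, nIn, nH0, hG, hIn, hH0, hlt⟩ := hL1
  have hδ : 0 < γ0 + ρr := by positivity
  -- Any admissible uncertainty, command and initial state force these signs; otherwise the claim is
  -- vacuous.
  by_cases hnonneg : 0 ≤ F (γ0 + ρr) ∧ 0 ≤ L0 ∧ 0 ≤ Mr ∧ 0 ≤ ρ0
  swap
  · refine ⟨1, one_pos, fun _ => 0, fun _ => 0, 0, 0, tendsto_const_nhds, tendsto_const_nhds,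
      fun σ hσ zcmd _ hz x0 hx0 => absurd ⟨hσ.nonneg_lipschitz hδ,
        (abs_nonneg _).trans (hσ.bounded 0 le_rfl), (abs_nonneg _).trans (hz 0 le_rfl),
        (norm_nonneg _).trans hx0⟩ hnonneg⟩
  obtain ⟨hF, hL0, hMr, hρ0⟩ := hnonneg
  set δ := γ0 + ρr with hδdef
  set L := F δ + ∑ j, |d.K j| with hL
  have hL0' : 0 ≤ L := by positivity
  have hnG := hG.nonneg
  have hnH0 := hH0.nonneg
  have hnIn := hIn.nonneg
  have hlt' : nIn * ρ0 + nG * (L * δ + L0) + nH0 * Mr < ρr := by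
    have e : δ / ρr * L * ρr = L * δ := by field_simp
    rw [e] at hlt
    linarith
  -- If ‖G‖ L ≥ 1, the term ‖G‖ L δ alone would reach δ > ρ_r.
  have hcontr : nG * L < 1 := by
    have h1 : 0 ≤ nIn * ρ0 := by positivity
    have h2 : 0 ≤ nG * L0 := by positivity
    have h3 : 0 ≤ nH0 * Mr := by positivity
    by_contra! h
    nlinarith [mul_le_mul_of_nonneg_right h hδ.le]
  have hctl := hd.isHurwitz_ctl hIn
  obtain ⟨C, hC, T₀, hT₀, herr⟩ := hd.exists_control_error_bound hctl hρ0
    (w := L * δ + L0) (by positivity)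
  obtain ⟨a, ha, M, hM, hexp⟩ := hctl.exists_norm_expM_le
  set g := nH0 / (1 - nG * L) with hg
  have hg0 : 0 ≤ g := div_nonneg hnH0 (by linarith)
  -- Gain from the state deviation, through the Lipschitz disturbance and the filter, to the input
  -- deviation.
  set κ := (∑ j, |d.ctl.C 0 j|) * (M * (L * ‖d.ctl.B *ᵥ d.Bm‖) / a) with hκ
  have hκ0 : 0 ≤ κ := by positivity
  have hlin : ∀ c : ℝ, Tendsto (fun T : ℝ => c * T) (𝓝[>] 0) (𝓝 0) := fun c =>
    tendsto_nhdsWithin_of_tendsto_nhds (by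
      have h : Continuous fun T : ℝ => c * T := by fun_prop
      simpa using h.tendsto 0)
  -- The second bound on T gives ‖H₀‖ C T ≤ γ₀: sampling may use up the margin γ₀ between ρ_r and δ.
  refine ⟨min T₀ (γ0 / (nH0 * C + 1)), lt_min hT₀ (by positivity), fun T => g * C * T,
    fun T => (κ * (g * C) + C) * T, g, κ * g + 1, hlin _, hlin _, ?_⟩
  intro σ hσ zcmd hzm hz x0 hx0 T hT hTmax ν hν τ x xref zaug uref hcl href t ht
  have hτ := ht.1.trans ht.2
  have hTC : nH0 * (C * T) ≤ γ0 := by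
    have h1 := (le_div_iff₀ (by positivity)).1 (hTmax.trans (min_le_right _ _))
    nlinarith
  have hzi : IntervalIntegrable zcmd volume 0 τ :=
    intervalIntegrable_of_bounded hτ hzm fun s hs => hz s hs.1
  have hωx := intervalIntegrable_disturbance (d := d) hσ hτ hcl.1.1
  have hωr := intervalIntegrable_disturbance (d := d) hσ hτ href.1.1
  have hxr : ∀ s ∈ Set.Icc 0 τ, xref s = d.response (d.disturbance σ xref) zcmd x0 s :=
    fun s hs => href.state_eq hd hωr hzi hs
  have hxrδ := hd.norm_lt_of_eq_response hG hIn hH0 hσ hδ hMr hx0 href.1.1 hzi hxr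
    (fun _ _ _ s hs => hz s hs.1) (hlt'.trans (by rw [hδdef]; linarith))
  set z : ℕ → ℝ := fun i => d.Cm ⬝ᵥ x (i * T) with hzdef
  set r : ℕ → ℝ := fun i => zcmd (i * T) with hrdef
  set q := d.residualInput T z r (d.disturbance σ x) x0 with hq
  have hqi : IntervalIntegrable q volume 0 τ := intervalIntegrable_residualInput hT _ _ hτ hωx x0
  have hxx : ∀ s ∈ Set.Icc 0 τ, x s = d.response (d.disturbance σ x) q x0 s :=
    fun s hs => hcl.state_eq hT hωx hs
  have hqr : ∀ t ∈ Set.Icc 0 τ, (∀ s ∈ Set.Icc 0 t, ‖x s‖ ≤ δ) →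
      ∀ s ∈ Set.Icc 0 t, |q s - r ⌊s / T⌋₊| ≤ C * T := by
    intro t ht hxt s hs
    have h1 := herr T hT (hTmax.trans (min_le_left _ _)) t ht.1 r z x0 x _ _ hx0
      (hωx.restrict_right ht) (fun s hs => abs_disturbance_le hσ hδ hs.1 (hxt s hs)) hzdef
      ((hcl.1.solvesLinear.mono ht.2).congr fun s hs => by
        rw [hcl.2 s ⟨hs.1, hs.2.trans ht.2⟩])
      (solvesLinear_filterState ht.1 (hωx.restrict_right ht) x0) s hs
    have e : q s - r ⌊s / T⌋₊ = -((d.ctl.C *ᵥ d.ctrlLaw T z r ⌊s / T⌋₊) 0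
        - (d.ctl.C *ᵥ d.filterState (d.disturbance σ x) x0 s) 0) := by
      rw [hq, residualInput, ctrlInput, ctrlLaw]; ring
    rwa [e, abs_neg]
  have hxδ := hd.norm_lt_of_eq_response hG hIn hH0 hσ hδ (b := Mr + C * T) (by positivity) hx0
    hcl.1.1 hqi hxx
    (fun t ht hxt s hs => by
      have h1 := hqr t ht hxt s hs
      have h2 : |r ⌊s / T⌋₊| ≤ Mr := hz _ (by positivity)
      have h3 := abs_add_le (q s - r ⌊s / T⌋₊) (r ⌊s / T⌋₊)
      rw [sub_add_cancel] at h3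
      linarith)
    (by rw [mul_add nH0, hδdef]; linarith)
  have hqz : ∀ s ∈ Set.Icc 0 τ, |zcmd s - q s| ≤ ν + C * T := by
    intro s hs
    have h1 := hqr τ ⟨hτ, le_rfl⟩ (fun s hs => (hxδ s hs).le) s hs
    have h2 : |zcmd s - r ⌊s / T⌋₊| ≤ ν := hν s hs.1
    rw [abs_sub_comm] at h1
    linarith [abs_sub_le (zcmd s) (r ⌊s / T⌋₊) (q s)]
  obtain ⟨tm, htm, hmax⟩ := isCompact_Icc.exists_isMaxOn ⟨t, ht⟩ (href.1.1.sub hcl.1.1).norm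
  set D := ‖xref tm - x tm‖ with hD
  have hDle : ∀ s ∈ Set.Icc 0 τ, ‖xref s - x s‖ ≤ D := fun s hs => hmax hs
  have hωD : ∀ s ∈ Set.Icc 0 τ,
      |d.disturbance σ xref s - d.disturbance σ x s| ≤ L * D := fun s hs =>
    (abs_disturbance_sub_le hσ hδ hs.1 (hxδ s hs).le (hxrδ s hs).le).trans
      (mul_le_mul_of_nonneg_left (hDle s hs) hL0')
  -- The initial states cancel in the difference of responses. At the time of largest deviation this
  -- gives D ≤ ‖G‖ L D + ‖H₀‖ (ν + C T), solved for D.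
  have hDbound : D ≤ g * (ν + C * T) := by
    have h1 : D ≤ nIn * 0 + nG * (L * D) + nH0 * (ν + C * T) := by
      have h2 := response_sub (d := d) (hωr.restrict_right htm) (hωx.restrict_right htm)
        (hzi.restrict_right htm) (hqi.restrict_right htm) x0
      rw [← hxr tm htm, ← hxx tm htm] at h2
      refine (congrArg norm h2).trans_le (hd.norm_response_le hG hIn hH0 htm.1 (by simp)
        ((hωr.sub hωx).restrict_right htm) ((hzi.sub hqi).restrict_right htm)
        (fun s hs => hωD s ⟨hs.1, hs.2.trans htm.2⟩) (fun s hs => hqz s ⟨hs.1, hs.2.trans htm.2⟩))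
    rw [hg, div_mul_eq_mul_div, le_div_iff₀ (by linarith)]
    linarith
  refine ⟨(hDle t ht).trans (hDbound.trans_eq (by ring)), ?_⟩
  have hu : uref t - zaug t = (zcmd t - q t) - d.ctl.C 0 ⬝ᵥ
      (d.filterState (d.disturbance σ xref) x0 t - d.filterState (d.disturbance σ x) x0 t) := by
    have h1 : q t = zaug t + (d.ctl.C *ᵥ d.filterState (d.disturbance σ x) x0 t) 0 := by
      rw [hcl.2 t ht]; rfl
    rw [href.input_eq hd hωr ht, h1, dotProduct_sub]
    simp only [mulVec]
    ring
  have hfil : ‖d.filterState (d.disturbance σ xref) x0 t - d.filterState (d.disturbance σ x) x0 t‖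
      ≤ M * (L * D * ‖d.ctl.B *ᵥ d.Bm‖) / a := by
    rw [filterState_sub (hωr.restrict_right ht) (hωx.restrict_right ht)]
    refine norm_integral_expM_mulVec_le ha hM hexp ht.1 fun s hs => ?_
    rw [norm_smul, Real.norm_eq_abs]
    exact mul_le_mul_of_nonneg_right (hωD s ⟨hs.1, hs.2.trans ht.2⟩) (norm_nonneg _)
  have hdot := (abs_dotProduct_le (d.ctl.C 0) (d.filterState (d.disturbance σ xref) x0 t
    - d.filterState (d.disturbance σ x) x0 t)).trans
      (mul_le_mul_of_nonneg_left hfil (by positivity))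
  have e : (∑ j, |d.ctl.C 0 j|) * (M * (L * D * ‖d.ctl.B *ᵥ d.Bm‖) / a) = κ * D := by
    rw [hκ]; ring
  rw [e] at hdot
  have h5 := mul_le_mul_of_nonneg_left hDbound hκ0
  calc |uref t - zaug t| ≤ |zcmd t - q t| + _ := by rw [hu]; exact abs_sub _ _
    _ ≤ (ν + C * T) + κ * (g * (ν + C * T)) := add_le_add (hqz t ht) (hdot.trans h5)
    _ = _ := by ring
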